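/- For an integer $n\ge 2$ and a prime $p$ let $G_p=\operatorname{PGL}_n(\mathbb Q_p)$, let $K_p=\operatorname{PGL}_n(\mathbb Z_p)$ and let $H_p\subset G_p$ be the diagonal torus. Let $\mathbf G(\mathbb A_f)=\operatorname{PGL}_n(\mathbb A_f)$ be the restricted product of the $G_p$ with respect to the $K_p$, let $\mathbf H(\mathbb A_f)\subset\mathbf G(\mathbb A_f)$ be the subgroup of points of the diagonal torus, and let $K_f=\prod_pK_p$. Equip $\mathbf G(\mathbb A_f)$ and $\mathbf H(\mathbb A_f)$ with the Haar measures for which $K_f$ and $\mathbf H(\mathbb A_f)\cap K_f$ have volume $1$. For functions on $\mathbf G(\mathbb A_f)$ put $(f_1*f_2)(g)=\int_{\mathbf G(\mathbb A_f)}f_1(h)f_2(h^{-1}g)\,dh$ and $f^*(g)=\overline{f(g^{-1})}$. For $a\in\mathbb Z^n$ write $\mu_a(p)=\operatorname{diag}(p^{a_1},\dots,p^{a_n})\in H_p$ and $$\|a\|=\max_{w\in S_n}\ \frac12\sum_{1\le i<j\le n}\bigl(a_{w(i)}-a_{w(j)}\bigr).$$ For $\kappa\ge 0$ let $\mathcal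 H_p^{\le\kappa}$ be the complex span of the functions $1_{K_p\mu_a(p)K_p}$ on $G_p$ with $\|a\|\le\kappa$. For $M\ge1$, with $\mathcal P$ the set of all primes, let $$\mathcal H_{\mathcal P,M}^{\le\kappa}=\sum_{\substack{m\le M\\ m\text{ squarefree}}}\ \bigotimes_{p\mid m}\mathcal H_p^{\le\kappa},$$ a space of functions on $\mathbf G(\mathbb A_f)$, where $\bigotimes_{p\mid m}f_p$ is viewed as the function $g\mapsto\prod_{p\mid m}f_p(g_p)\prod_{p\nmid m}1_{K_p}(g_p)$, and $\bigotimes_{p\mid m}\mathcal H_p^{\le\kappa}$ is the span of these functions. **Proposition.** Let $n\ge3$ and $\kappa>0$. There are constants $C$ and $A$, depending only on $n$ and $\kappa$, such that for every real $M\ge3$ and every nonzero $\omega\in\mathcal H_{\mathcal P,M}^{\le\kappa}$ the function $k_f=\omega*\omega^*$ satisfies $k_f(1)\neq0$, is integrable over $\mathbf H(\mathbb A_f)$, and $$\left|\frac{\int_{\mathbf H(\mathbb A_f)}k_f}{k_f(1)}\right|\le A\,(\log\log M)^{C}.$$ -/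

import Mathlib

open MeasureTheory
open scoped RestrictedProduct Matrix

noncomputable section

namespace ToricHecke

/-! ### The local groups -/

/-- The set of all primes. -/
abbrev Primes : Type := {p : ℕ // p.Prime}

instance factPrime (p : Primes) : Fact (p : ℕ).Prime := ⟨p.2⟩

/-- `PGL_n(R) = GL_n(R) / R^×` (for `R` a local ring, these are the `R`-points of the algebraic
group `PGL_n`). -/
abbrev PGL (n : ℕ) (R : Type*) [CommRing R] : Type _ := Matrix.ProjGenLinGroup (Fin n) R

/-- The quotient topology from `GL_n(R)`. -/
instance topologicalSpacePGL (n : ℕ) (R : Type*) [CommRing R] [TopologicalSpace R] :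
    TopologicalSpace (PGL n R) :=
  inferInstanceAs (TopologicalSpace (GL (Fin n) R ⧸ Subgroup.center (GL (Fin n) R)))

instance isTopologicalGroupPGL (n : ℕ) (R : Type*) [CommRing R] [TopologicalSpace R]
    [IsTopologicalRing R] : IsTopologicalGroup (PGL n R) :=
  inferInstanceAs (IsTopologicalGroup (GL (Fin n) R ⧸ Subgroup.center (GL (Fin n) R)))

/-- The diagonal matrix `diag(d_1, …, d_n)` as an element of `GL_n(R)`. -/
def diagGL (n : ℕ) (R : Type*) [CommRing R] : (Fin n → Rˣ) →* GL (Fin n) R :=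
  (Units.map (Matrix.diagonalRingHom (Fin n) R).toMonoidHom).comp
    MulEquiv.piUnits.symm.toMonoidHom

/-- The image of `GL_n(ℤ_p)` in `PGL_n(ℚ_p)`, that is `K_p = PGL_n(ℤ_p)`. -/
def localK (n : ℕ) (p : Primes) : Subgroup (PGL n ℚ_[p]) :=
  ((Matrix.ProjGenLinGroup.mk (n := Fin n) (R := ℚ_[p])).comp
    (Matrix.GeneralLinearGroup.map (n := Fin n) (algebraMap ℤ_[p] ℚ_[p]))).range

/-- The diagonal torus `H_p` in `PGL_n(ℚ_p)`. -/
def localH (n : ℕ) (p : Primes) : Subgroup (PGL n ℚ_[p]) :=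
  ((Matrix.ProjGenLinGroup.mk (n := Fin n) (R := ℚ_[p])).comp (diagGL n ℚ_[p])).range

/-- `p` as a unit of `ℚ_p`. -/
def uniformizer (p : Primes) : ℚ_[p]ˣ :=
  Units.mk0 ((p : ℕ) : ℚ_[p]) (Nat.cast_ne_zero.mpr p.2.ne_zero)

/-- The class of `diag(p^{a_1}, …, p^{a_n})` in `PGL_n(ℚ_p)`. -/
def cocharValue (n : ℕ) (p : Primes) (a : Fin n → ℤ) : PGL n ℚ_[p] :=
  Matrix.ProjGenLinGroup.mk (diagGL n ℚ_[p] fun i => uniformizer p ^ a i)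

/-- The norm `‖a‖ = max_{w ∈ S_n} ⟨w a, ρ⟩`, where `ρ` is half the sum of the positive roots
`a_i - a_j` (`i < j`). It is invariant under adding a constant to all `a_i`, so it is a norm on the
cocharacters `ℤ^n / ℤ` of the diagonal torus of `PGL_n`. -/
def cocharNorm (n : ℕ) (a : Fin n → ℤ) : ℝ :=
  Finset.univ.sup' ⟨1, Finset.mem_univ 1⟩ fun w : Equiv.Perm (Fin n) =>
    (1 / 2 : ℝ) * ∑ i, ∑ j ∈ Finset.Ioi i, ((a (w i) : ℝ) - a (w j))

/-- The truncated local Hecke algebra: the span of the `1_{K_p μ(p) K_p}` with `‖μ‖ ≤ κ`. -/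
def localHecke (n : ℕ) (κ : ℝ) (p : Primes) : Submodule ℂ (PGL n ℚ_[p] → ℂ) :=
  Submodule.span ℂ
    {f | ∃ a : Fin n → ℤ, cocharNorm n a ≤ κ ∧
      f = (DoubleCoset.doubleCoset (cocharValue n p a)
        (localK n p : Set (PGL n ℚ_[p])) (localK n p)).indicator 1}

/-! ### The adelic groups -/

/-- `PGL_n(𝔸_f)`, the restricted product of the `PGL_n(ℚ_p)` with respect to the `K_p`, with the
restricted product topology. -/
abbrev AdelicG (n : ℕ) : Type := Πʳ p : Primes, [PGL n ℚ_[p], localK n p]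

/-- The maximal compact subgroup `K_f = ∏_p K_p`. -/
def adelicK (n : ℕ) : Subgroup (AdelicG n) where
  carrier := {g | ∀ p, g p ∈ localK n p}
  one_mem' _ := one_mem _
  mul_mem' hg hh p := mul_mem (hg p) (hh p)
  inv_mem' hg p := inv_mem (hg p)

/-- The finite-adelic points `H(𝔸_f)` of the diagonal torus. -/
def adelicH (n : ℕ) : Subgroup (AdelicG n) where
  carrier := {g | ∀ p, g p ∈ localH n p}
  one_mem' _ := one_mem _
  mul_mem' hg hh p := mul_mem (hg p) (hh p)
  inv_mem' hg p := inv_mem (hg p)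

/-! ### `K_f` and `H(𝔸_f) ∩ K_f` are compact open -/

theorem continuous_mk (n : ℕ) (p : Primes) :
    Continuous (Matrix.ProjGenLinGroup.mk (n := Fin n) (R := ℚ_[p])) :=
  continuous_quot_mk

theorem isQuotientMap_mk (n : ℕ) (p : Primes) :
    Topology.IsQuotientMap (Matrix.ProjGenLinGroup.mk (n := Fin n) (R := ℚ_[p])) :=
  isQuotientMap_quot_mk

theorem isOpenMap_mk (n : ℕ) (p : Primes) :
    IsOpenMap (Matrix.ProjGenLinGroup.mk (n := Fin n) (R := ℚ_[p])) :=
  QuotientGroup.isOpenMap_coe (N := Subgroup.center (GL (Fin n) ℚ_[p]))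

/-- `GL_n(ℤ_p)` consists of the `g` for which `g` and `g⁻¹` have entries in `ℤ_p`. -/
theorem mem_range_map_iff (n : ℕ) (p : Primes) (g : GL (Fin n) ℚ_[p]) :
    g ∈ (Matrix.GeneralLinearGroup.map (n := Fin n) (algebraMap ℤ_[p] ℚ_[p])).range ↔
      ∀ i j, ‖(g : Matrix (Fin n) (Fin n) ℚ_[p]) i j‖ ≤ 1 ∧
        ‖((g⁻¹ : GL (Fin n) ℚ_[p]) : Matrix (Fin n) (Fin n) ℚ_[p]) i j‖ ≤ 1 := by
  constructor
  · rintro ⟨u, rfl⟩ i j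
    exact ⟨PadicInt.norm_le_one _, by
      rw [← map_inv]
      exact PadicInt.norm_le_one _⟩
  · intro h
    have hinj : Function.Injective
        ((algebraMap ℤ_[p] ℚ_[p]).mapMatrix (m := Fin n)) :=
      Matrix.map_injective (FaithfulSMul.algebraMap_injective ℤ_[p] ℚ_[p])
    let A : Matrix (Fin n) (Fin n) ℤ_[p] := fun i j => ⟨_, (h i j).1⟩
    let B : Matrix (Fin n) (Fin n) ℤ_[p] := fun i j => ⟨_, (h i j).2⟩
    have hA : (algebraMap ℤ_[p] ℚ_[p]).mapMatrix A = (g : Matrix (Fin n) (Fin n) ℚ_[p]) := rfl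
    have hB : (algebraMap ℤ_[p] ℚ_[p]).mapMatrix B =
      ((g⁻¹ : GL (Fin n) ℚ_[p]) : Matrix (Fin n) (Fin n) ℚ_[p]) := rfl
    refine ⟨⟨A, B, hinj ?_, hinj ?_⟩, Units.ext hA⟩
    · rw [map_mul, hA, hB, map_one, Units.mul_inv]
    · rw [map_mul, hA, hB, map_one, Units.inv_mul]

theorem localK_eq_image (n : ℕ) (p : Primes) : (localK n p : Set (PGL n ℚ_[p])) =
    Matrix.ProjGenLinGroup.mk ''
      ((Matrix.GeneralLinearGroup.map (n := Fin n) (algebraMap ℤ_[p] ℚ_[p])).range :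
        Set (GL (Fin n) ℚ_[p])) := by
  rw [localK, MonoidHom.range_comp]
  rfl

theorem isOpen_localK (n : ℕ) (p : Primes) : IsOpen (localK n p : Set (PGL n ℚ_[p])) := by
  rw [localK_eq_image]
  refine isOpenMap_mk n p _ ?_
  have hball : IsOpen {x : ℚ_[p] | ‖x‖ ≤ 1} := by
    have := IsUltrametricDist.isOpen_closedBall (0 : ℚ_[p]) one_ne_zero
    convert this using 1
    ext x
    simp
  have : ((Matrix.GeneralLinearGroup.map (n := Fin n) (algebraMap ℤ_[p] ℚ_[p])).range :
      Set (GL (Fin n) ℚ_[p])) = ⋂ i, ⋂ j,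
        ((fun g : GL (Fin n) ℚ_[p] => (g : Matrix (Fin n) (Fin n) ℚ_[p]) i j) ⁻¹'
            {x : ℚ_[p] | ‖x‖ ≤ 1} ∩
          (fun g : GL (Fin n) ℚ_[p] =>
              ((g⁻¹ : GL (Fin n) ℚ_[p]) : Matrix (Fin n) (Fin n) ℚ_[p]) i j) ⁻¹'
            {x : ℚ_[p] | ‖x‖ ≤ 1}) := by
    ext g
    simpa using mem_range_map_iff n p g
  rw [this]
  refine isOpen_iInter_of_finite fun i => isOpen_iInter_of_finite fun j => ?_
  exact (hball.preimage (Units.continuous_val.matrix_elem i j)).inter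
    (hball.preimage ((Units.continuous_val.comp continuous_inv).matrix_elem i j))

instance fact_isOpen_localK (n : ℕ) :
    Fact (∀ p : Primes, IsOpen (localK n p : Set (PGL n ℚ_[p]))) := ⟨isOpen_localK n⟩

theorem isCompact_localK (n : ℕ) (p : Primes) :
    IsCompact (localK n p : Set (PGL n ℚ_[p])) := by
  have : CompactSpace (Matrix (Fin n) (Fin n) ℤ_[p]) :=
    inferInstanceAs (CompactSpace (Fin n → Fin n → ℤ_[p]))
  have hc : Continuous (Matrix.GeneralLinearGroup.map (n := Fin n) (algebraMap ℤ_[p] ℚ_[p])) :=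
    Continuous.units_map _ (continuous_id.matrix_map continuous_subtype_val)
  rw [localK, MonoidHom.coe_range]
  exact isCompact_range ((continuous_mk n p).comp hc)

theorem isClosed_localH (n : ℕ) (p : Primes) :
    IsClosed (localH n p : Set (PGL n ℚ_[p])) := by
  rw [← (isQuotientMap_mk n p).isClosed_preimage]
  have : Matrix.ProjGenLinGroup.mk ⁻¹' (localH n p : Set (PGL n ℚ_[p])) =
      ⋂ i, ⋂ j, ⋂ (_ : i ≠ j),
        (fun g : GL (Fin n) ℚ_[p] => (g : Matrix (Fin n) (Fin n) ℚ_[p]) i j) ⁻¹' {0} := by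
    ext g
    simp only [Set.mem_preimage, Set.mem_iInter, Set.mem_singleton_iff, SetLike.mem_coe]
    constructor
    · rintro ⟨d, hd⟩ i j hij
      obtain ⟨u, rfl⟩ := Matrix.ProjGenLinGroup.mk_eq_mk_iff.mp hd
      simp [diagGL, Matrix.diagonal_apply_ne _ hij]
    · intro h
      have hg : (g : Matrix (Fin n) (Fin n) ℚ_[p]) =
          Matrix.diagonal fun i => (g : Matrix (Fin n) (Fin n) ℚ_[p]) i i := by
        ext i j
        by_cases hij : i = j
        · subst hij; simp
        · rw [h i j hij, Matrix.diagonal_apply_ne _ hij]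
      have hdet : ∀ i, (g : Matrix (Fin n) (Fin n) ℚ_[p]) i i ≠ 0 := by
        have := (Matrix.isUnit_iff_isUnit_det _).mp g.isUnit
        rw [hg, Matrix.det_diagonal, isUnit_iff_ne_zero, Finset.prod_ne_zero_iff] at this
        exact fun i => this i (Finset.mem_univ i)
      refine ⟨fun i => Units.mk0 _ (hdet i), congrArg Matrix.ProjGenLinGroup.mk (Units.ext ?_)⟩
      exact hg.symm
  rw [this]
  exact isClosed_iInter fun i => isClosed_iInter fun j => isClosed_iInter fun _ =>
    isClosed_singleton.preimage (Units.continuous_val.matrix_elem i j)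

theorem isOpen_adelicK (n : ℕ) : IsOpen (adelicK n : Set (AdelicG n)) :=
  RestrictedProduct.isOpen_forall_mem (isOpen_localK n)

theorem isCompact_adelicK (n : ℕ) : IsCompact (adelicK n : Set (AdelicG n)) := by
  have : ∀ p, CompactSpace (localK n p) := fun p =>
    isCompact_iff_compactSpace.mp (isCompact_localK n p)
  have h := isCompact_range (RestrictedProduct.isEmbedding_structureMap
    (R := fun p : Primes => PGL n ℚ_[p]) (A := fun p => (localK n p : Set (PGL n ℚ_[p])))
    (𝓕 := Filter.cofinite)).continuous
  convert h using 1
  ext g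
  exact ⟨fun hg => ⟨fun p => ⟨g p, hg p⟩, rfl⟩, by rintro ⟨x, rfl⟩ p; exact (x p).2⟩

theorem isClosed_adelicH (n : ℕ) : IsClosed (adelicH n : Set (AdelicG n)) := by
  have : (adelicH n : Set (AdelicG n)) =
      ⋂ p : Primes, (fun g : AdelicG n => g p) ⁻¹' (localH n p : Set (PGL n ℚ_[p])) := by
    ext g
    simp [adelicH]
  rw [this]
  exact isClosed_iInter fun p =>
    (isClosed_localH n p).preimage (RestrictedProduct.continuous_eval p)

/-- `K_f` as a compact set with nonempty interior. -/
def compactsK (n : ℕ) : TopologicalSpace.PositiveCompacts (AdelicG n) where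
  carrier := adelicK n
  isCompact' := isCompact_adelicK n
  interior_nonempty' := ⟨1, by
    rw [(isOpen_adelicK n).interior_eq]
    exact one_mem _⟩

/-- `H(𝔸_f) ∩ K_f` as a compact subset of `H(𝔸_f)` with nonempty interior. -/
def compactsHK (n : ℕ) : TopologicalSpace.PositiveCompacts (adelicH n) where
  carrier := {h | (h : AdelicG n) ∈ adelicK n}
  isCompact' :=
    (isClosed_adelicH n).isClosedEmbedding_subtypeVal.isCompact_preimage (isCompact_adelicK n)
  interior_nonempty' := ⟨1, by
    have h : IsOpen {h : adelicH n | (h : AdelicG n) ∈ adelicK n} :=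
      (isOpen_adelicK n).preimage continuous_subtype_val
    rw [h.interior_eq]
    exact one_mem (adelicK n)⟩

/-! ### Measures, convolution and Hecke algebras -/

instance measurableSpaceAdelicG (n : ℕ) : MeasurableSpace (AdelicG n) := borel _

instance borelSpaceAdelicG (n : ℕ) : BorelSpace (AdelicG n) := ⟨rfl⟩

/-- The Haar measure on `PGL_n(𝔸_f)` giving `K_f` volume `1`. -/
def muG (n : ℕ) : Measure (AdelicG n) := Measure.haarMeasure (compactsK n)

/-- The Haar measure on `H(𝔸_f)` giving `H(𝔸_f) ∩ K_f` volume `1`. -/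
def muH (n : ℕ) : Measure (adelicH n) := Measure.haarMeasure (compactsHK n)

/-- The convolution `(f₁ * f₂)(g) = ∫ f₁(h) f₂(h⁻¹ g) dh`. -/
def conv {n : ℕ} (f₁ f₂ : AdelicG n → ℂ) (g : AdelicG n) : ℂ :=
  ∫ h, f₁ h * f₂ (h⁻¹ * g) ∂(muG n)

/-- The adjoint `f^*(g) = conj (f(g⁻¹))`. -/
def adj {n : ℕ} (f : AdelicG n → ℂ) (g : AdelicG n) : ℂ :=
  starRingEnd ℂ (f g⁻¹)

/-- The image of `⨂_{p ∣ m} H_p^{≤ κ}` in the functions on `PGL_n(𝔸_f)`: the span of the functions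
`g ↦ ∏_p f_p(g_p)` with `f_p ∈ H_p^{≤ κ}` for `p ∣ m` and `f_p = 1_{K_p}` for all other `p`. (For
every `g`, all but finitely many factors of the product are `1`.) -/
def heckeAt (n : ℕ) (κ : ℝ) (m : ℕ) : Submodule ℂ (AdelicG n → ℂ) :=
  Submodule.span ℂ
    {F | ∃ f : ∀ p : Primes, PGL n ℚ_[p] → ℂ,
      (∀ p : Primes, (p : ℕ) ∣ m → f p ∈ localHecke n κ p) ∧
      (∀ p : Primes, ¬ (p : ℕ) ∣ m → f p = (localK n p : Set (PGL n ℚ_[p])).indicator 1) ∧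
      F = fun g => ∏ᶠ p : Primes, f p (g p)}

/-- The truncated Hecke algebra `H_{P,M}^{≤ κ}` for the set `P` of all primes: the sum of
the spaces `⨂_{p ∣ m} H_p^{≤ κ}` over all squarefree `m ≤ M`. -/
def truncHecke (n : ℕ) (κ M : ℝ) : Submodule ℂ (AdelicG n → ℂ) :=
  ⨆ m ∈ {m : ℕ | Squarefree m ∧ (m : ℝ) ≤ M}, heckeAt n κ m

end ToricHecke

end

/-! The statement is a bound for a quadratic form. Since `ω` is bi-invariant under `K_f`, it is a
combination of indicators of boxes `∏ d_p`, where `d_p` is a double coset ("cell") of `K_p` for the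
finitely many primes `p ≤ M`, and `d_p = K_p` elsewhere. Let `x_d` be the coefficient of the box `d`
times the square root of its volume. Then `k_f(1) = ∑ |x_d|^2`, while the torus integral is a form
in the `x_d` whose matrix is a tensor product over `p` of local matrices. The local entry at cells
`X`, `Y` is the sum over cocharacters `b` of the number of cosets of `K_p` in `X ∩ p^b Y`, divided
by the square root of the product of the coset numbers of `X` and `Y`.

Local estimate (`cosetCount_inter_le`): for nonconstant `b` the normalized count is at most `2n/p`.
Take `a` antitone and `b` monotone, as permutation matrices allow. By the big cell, all but a
proportion `n/p` of the cosets in `K p^a K` are generic, that is, of the form `u p^a K` with `u`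
upper triangular and integral (`le_cosetCount_genericSet`). If `p^b K p^c K` contains a generic
coset, then it must be that `K p^c K = K p^(a-b) K`. This double coset is larger by a factor of
about `p^2`, since `-b` expands at least two positive roots when `n ≥ 3`
(`sq_mul_cosetCount_genericSet_le`). Otherwise the intersection consists of nongeneric cosets only.
Combining this with the same dichotomy for the roles of `a` and `c` exchanged gives the bound. For
`n = 2` there is only one positive root, and the argument would save only `p^(-1/2)`.

Global estimate: each local matrix is the identity plus `O(1/p)`, and its entry at `(K_p, K_p)` is
at most `1` with no error. A Schur test with product weights (`sum_schurKernel_le`) gives weight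
`w_p` to each prime where `d_p ≠ K_p`. A row then costs `1 + O(w_p/p)` at a prime with `d_p = K_p`
and `1 + O(1/(p w_p))` at the others. With `w_p = 1` for `p ≤ (log M)^2` and `w_p = p^(-1/2)`
beyond, the small primes contribute a power of `log log M`. The large primes contribute `O(1)`: `∑
p^(-3/2)` converges, and a row in the support of `ω` has `O(log M)` primes with `d_p ≠ K_p`, each
costing at most `1 + O(1/log M)` (`prod_primeWeight_le`). -/

noncomputable section

namespace ToricHecke

/-! ### Counting cosets -/

section CosetCount

open scoped Pointwise

variable {G : Type*} [Group G]

/-- The number of left cosets of `K` that meet `A`. -/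
def cosetCount (K : Subgroup G) (A : Set G) : ℕ :=
  ((QuotientGroup.mk : G → G ⧸ K) '' A).ncard

/-- `A` is a union of left cosets of `K`. -/
def RightInvariant (K : Subgroup G) (A : Set G) : Prop :=
  ∀ g ∈ A, ∀ k ∈ K, g * k ∈ A

/-- `A` consists of finitely many left cosets of `K`. -/
def FiniteCosets (K : Subgroup G) (A : Set G) : Prop :=
  ((QuotientGroup.mk : G → G ⧸ K) '' A).Finite

theorem cosetCount_mono {K : Subgroup G} {A B : Set G} (h : A ⊆ B) (hB : FiniteCosets K B) :
    cosetCount K A ≤ cosetCount K B :=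
  Set.ncard_le_ncard (Set.image_mono h) hB

theorem FiniteCosets.mono {K : Subgroup G} {A B : Set G} (h : A ⊆ B) (hB : FiniteCosets K B) :
    FiniteCosets K A :=
  Set.Finite.subset hB (Set.image_mono h)

theorem image_mk_smul (K : Subgroup G) (g : G) (A : Set G) :
    (QuotientGroup.mk : G → G ⧸ K) '' (g • A) =
      (fun x : G ⧸ K => g • x) '' ((QuotientGroup.mk : G → G ⧸ K) '' A) := by
  rw [Set.image_image]
  change _ '' ((fun x => g • x) '' A) = _
  rw [Set.image_image]
  rfl

theorem cosetCount_smul (K : Subgroup G) (g : G) (A : Set G) :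
    cosetCount K (g • A) = cosetCount K A := by
  rw [cosetCount, image_mk_smul, Set.ncard_image_of_injective _ (MulAction.injective g), cosetCount]

theorem FiniteCosets.smul {K : Subgroup G} {A : Set G} (hA : FiniteCosets K A) (g : G) :
    FiniteCosets K (g • A) := by
  rw [FiniteCosets, image_mk_smul]
  exact Set.Finite.image _ hA

theorem cosetCount_empty (K : Subgroup G) : cosetCount K ∅ = 0 := by simp [cosetCount]

theorem cosetCount_self (K : Subgroup G) : cosetCount K (K : Set G) = 1 := by
  rw [cosetCount, Set.ncard_eq_one]
  refine ⟨((1 : G) : G ⧸ K), ?_⟩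
  ext x
  simp only [Set.mem_image, SetLike.mem_coe, Set.mem_singleton_iff]
  constructor
  · rintro ⟨k, hk, rfl⟩
    exact QuotientGroup.eq.mpr (by simpa using hk)
  · rintro rfl
    exact ⟨1, K.one_mem, rfl⟩

theorem cosetCount_pos {K : Subgroup G} {A : Set G} (hA : FiniteCosets K A) (hne : A.Nonempty) :
    0 < cosetCount K A :=
  (Set.ncard_pos hA).mpr (hne.image _)

theorem RightInvariant.inter {K : Subgroup G} {A B : Set G} (hA : RightInvariant K A)
    (hB : RightInvariant K B) : RightInvariant K (A ∩ B) :=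
  fun g hg k hk => ⟨hA g hg.1 k hk, hB g hg.2 k hk⟩

theorem RightInvariant.smul {K : Subgroup G} {A : Set G} (hA : RightInvariant K A) (g : G) :
    RightInvariant K (g • A) := by
  intro x hx k hk
  rw [Set.mem_smul_set_iff_inv_smul_mem, smul_eq_mul] at hx ⊢
  rw [← mul_assoc]
  exact hA _ hx k hk

/-- Representatives of the cosets of `K` in `A`. -/
theorem exists_coset_reps {K : Subgroup G} {A : Set G} (hA : FiniteCosets K A)
    (hinv : RightInvariant K A) :
    ∃ E : Finset G, E.card = cosetCount K A ∧ (∀ e ∈ E, e ∈ A) ∧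
      (∀ e ∈ E, ∀ e' ∈ E, e⁻¹ * e' ∈ K → e = e') ∧ ∀ g ∈ A, ∃ e ∈ E, e⁻¹ * g ∈ K := by
  classical
  have hout : ∀ x : G ⧸ K, ((Quotient.out x : G) : G ⧸ K) = x := fun x => Quotient.out_eq' x
  refine ⟨hA.toFinset.image Quotient.out, ?_, ?_, ?_, ?_⟩
  · rw [Finset.card_image_of_injective _ Quotient.out_injective, cosetCount,
      Set.ncard_eq_toFinset_card _ hA]
  · intro e he
    obtain ⟨x, hx, rfl⟩ := Finset.mem_image.mp he
    obtain ⟨a, ha, rfl⟩ := hA.mem_toFinset.mp hx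
    have := QuotientGroup.eq.mp (hout (a : G ⧸ K)).symm
    simpa using hinv a ha _ this
  · intro e he e' he' h
    obtain ⟨x, hx, rfl⟩ := Finset.mem_image.mp he
    obtain ⟨y, hy, rfl⟩ := Finset.mem_image.mp he'
    have := QuotientGroup.eq.mpr h
    rw [hout, hout] at this
    rw [this]
  · intro g hg
    refine ⟨Quotient.out (g : G ⧸ K), Finset.mem_image_of_mem _
      (hA.mem_toFinset.mpr ⟨g, hg, rfl⟩), ?_⟩
    exact QuotientGroup.eq.mp (hout (g : G ⧸ K))

theorem doubleCoset_rightInvariant (K : Subgroup G) (x : G) :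
    RightInvariant K (DoubleCoset.doubleCoset x (K : Set G) K) := by
  intro g hg k hk
  obtain ⟨a, ha, b, hb, rfl⟩ := DoubleCoset.mem_doubleCoset.mp hg
  exact DoubleCoset.mem_doubleCoset.mpr ⟨a, ha, b * k, K.mul_mem hb hk, by simp only [mul_assoc]⟩

theorem doubleCoset_leftInvariant (K : Subgroup G) (x : G) {k g : G} (hk : k ∈ K)
    (hg : g ∈ DoubleCoset.doubleCoset x (K : Set G) K) :
    k * g ∈ DoubleCoset.doubleCoset x (K : Set G) K := by
  obtain ⟨a, ha, b, hb, rfl⟩ := DoubleCoset.mem_doubleCoset.mp hg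
  exact DoubleCoset.mem_doubleCoset.mpr ⟨k * a, K.mul_mem hk ha, b, hb, by simp only [mul_assoc]⟩

theorem doubleCoset_smul (K : Subgroup G) (x : G) {k : G} (hk : k ∈ K) :
    k • DoubleCoset.doubleCoset x (K : Set G) K = DoubleCoset.doubleCoset x (K : Set G) K := by
  ext g
  rw [Set.mem_smul_set_iff_inv_smul_mem, smul_eq_mul]
  constructor
  · intro h
    simpa using doubleCoset_leftInvariant K x hk h
  · exact doubleCoset_leftInvariant K x (K.inv_mem hk)

theorem doubleCoset_one (K : Subgroup G) :
    DoubleCoset.doubleCoset 1 (K : Set G) K = (K : Set G) := by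
  ext g
  rw [DoubleCoset.mem_doubleCoset]
  constructor
  · rintro ⟨a, ha, b, hb, rfl⟩
    exact K.mul_mem (K.mul_mem ha K.one_mem) hb
  · intro hg
    exact ⟨g, hg, 1, K.one_mem, by simp⟩

/-- A compact set meets finitely many cosets of an open subgroup. -/
theorem finiteCosets_of_isCompact [TopologicalSpace G] [IsTopologicalGroup G] {K : Subgroup G}
    (hK : IsOpen (K : Set G)) {A : Set G} (hA : IsCompact A) : FiniteCosets K A := by
  have : DiscreteTopology (G ⧸ K) := QuotientGroup.discreteTopology hK
  exact (hA.image QuotientGroup.continuous_mk).finite_of_discrete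

theorem finiteCosets_doubleCoset [TopologicalSpace G] [IsTopologicalGroup G] {K : Subgroup G}
    (hK : IsOpen (K : Set G)) (hc : IsCompact (K : Set G)) (x : G) :
    FiniteCosets K (DoubleCoset.doubleCoset x (K : Set G) K) := by
  refine finiteCosets_of_isCompact hK ?_
  unfold DoubleCoset.doubleCoset
  exact (hc.mul isCompact_singleton).mul hc

end CosetCount

/-! ### Integrals of functions that are constant on cosets -/

theorem integrable_and_integral_eq_sum {G ι : Type*} [Group G] [TopologicalSpace G]
    [IsTopologicalGroup G] [MeasurableSpace G] [BorelSpace G] (μ : Measure G)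
    [μ.IsMulLeftInvariant] {K : Subgroup G} (hK : IsOpen (K : Set G)) (hμ : μ K = 1)
    (E : Finset ι) (r : ι → G) (hr : ∀ i ∈ E, ∀ j ∈ E, (r i)⁻¹ * r j ∈ K → i = j)
    (f : G → ℂ) (hf : ∀ g, ∀ k ∈ K, f (g * k) = f g)
    (hs : ∀ g, f g ≠ 0 → ∃ i ∈ E, (r i)⁻¹ * g ∈ K) :
    Integrable f μ ∧ ∫ g, f g ∂μ = ∑ i ∈ E, f (r i) := by
  classical
  -- The cosets `r i * K` are disjoint and cover the support of `f`, so at each point at most one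
  -- summand is nonzero.
  have key : f = fun g => ∑ i ∈ E,
      ((fun x => (r i)⁻¹ * x) ⁻¹' (K : Set G)).indicator (fun _ => f (r i)) g := by
    funext g
    by_cases hg : ∃ i ∈ E, (r i)⁻¹ * g ∈ K
    · obtain ⟨i, hi, hig⟩ := hg
      rw [Finset.sum_eq_single i]
      · rw [Set.indicator_of_mem (by exact hig)]
        have := hf (r i) _ hig
        rwa [mul_inv_cancel_left] at this
      · intro j hj hji
        refine Set.indicator_of_notMem (fun hjg => hji ?_) _
        refine hr j hj i hi ?_
        have := K.mul_mem (show (r j)⁻¹ * g ∈ K from hjg) (K.inv_mem hig)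
        simpa [mul_assoc] using this
      · exact fun h => absurd hi h
    · have h0 : f g = 0 := by
        by_contra h
        exact hg (hs g h)
      rw [h0, eq_comm]
      refine Finset.sum_eq_zero fun i hi => Set.indicator_of_notMem ?_ _
      exact fun h => hg ⟨i, hi, h⟩
  have hmeas : ∀ i, MeasurableSet ((fun x => (r i)⁻¹ * x) ⁻¹' (K : Set G)) := fun i =>
    (hK.preimage (continuous_const_mul _)).measurableSet
  have hvol : ∀ i, μ ((fun x => (r i)⁻¹ * x) ⁻¹' (K : Set G)) = 1 := fun i => by
    rw [measure_preimage_mul, hμ]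
  have hint : ∀ i, Integrable
      (((fun x => (r i)⁻¹ * x) ⁻¹' (K : Set G)).indicator (fun _ => f (r i))) μ := fun i =>
    (integrable_indicator_iff (hmeas i)).mpr
      (integrableOn_const (by rw [hvol]; exact ENNReal.one_ne_top))
  have hsum : ∀ i, ∫ g, ((fun x => (r i)⁻¹ * x) ⁻¹' (K : Set G)).indicator
      (fun _ => f (r i)) g ∂μ = f (r i) := fun i => by
    rw [integral_indicator_const _ (hmeas i), Measure.real, hvol]
    simp
  constructor
  · rw [key]
    exact integrable_finsetSum _ fun i _ => hint i
  · conv_lhs => rw [key]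
    rw [integral_finsetSum _ fun i _ => hint i]
    exact Finset.sum_congr rfl fun i _ => hsum i

/-! ### Integral points of the local group -/

section Local

variable {n : ℕ} {p : Primes}

/-- The map `GL_n(ℤ_p) → PGL_n(ℚ_p)`, whose image is `K_p`. -/
def intToPGL (n : ℕ) (p : Primes) : GL (Fin n) ℤ_[p] →* PGL n ℚ_[p] :=
  (Matrix.ProjGenLinGroup.mk (n := Fin n) (R := ℚ_[p])).comp
    (Matrix.GeneralLinearGroup.map (n := Fin n) (algebraMap ℤ_[p] ℚ_[p]))

theorem intToPGL_mem (k : GL (Fin n) ℤ_[p]) : intToPGL n p k ∈ localK n p := ⟨k, rfl⟩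

theorem exists_intToPGL {g : PGL n ℚ_[p]} (hg : g ∈ localK n p) : ∃ k, intToPGL n p k = g := hg

theorem norm_det_map (k : GL (Fin n) ℤ_[p]) :
    ‖((Matrix.GeneralLinearGroup.map (n := Fin n) (algebraMap ℤ_[p] ℚ_[p]) k :
      GL (Fin n) ℚ_[p]) : Matrix (Fin n) (Fin n) ℚ_[p]).det‖ = 1 := by
  have h : ((Matrix.GeneralLinearGroup.map (n := Fin n) (algebraMap ℤ_[p] ℚ_[p]) k :
      GL (Fin n) ℚ_[p]) : Matrix (Fin n) (Fin n) ℚ_[p]).det =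
      algebraMap ℤ_[p] ℚ_[p] (k : Matrix (Fin n) (Fin n) ℤ_[p]).det :=
    (RingHom.map_det (algebraMap ℤ_[p] ℚ_[p]) (k : Matrix (Fin n) (Fin n) ℤ_[p])).symm
  rw [h]
  exact PadicInt.isUnit_iff.mp ((Matrix.isUnit_iff_isUnit_det _).mp k.isUnit)

/-- A matrix with unit determinant defines a point of `K_p` if and only if it is integral. -/
theorem mk_mem_localK_iff (hn : 0 < n) (g : GL (Fin n) ℚ_[p])
    (hg : ‖(g : Matrix (Fin n) (Fin n) ℚ_[p]).det‖ = 1) :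
    Matrix.ProjGenLinGroup.mk g ∈ localK n p ↔
      ∀ i j, ‖(g : Matrix (Fin n) (Fin n) ℚ_[p]) i j‖ ≤ 1 := by
  constructor
  · rintro ⟨k, hk⟩ i j
    obtain ⟨u, hu⟩ := Matrix.ProjGenLinGroup.mk_eq_mk_iff.mp hk
    have hdet := congrArg (fun x : GL (Fin n) ℚ_[p] =>
      ‖(x : Matrix (Fin n) (Fin n) ℚ_[p]).det‖) hu
    simp only [Matrix.GeneralLinearGroup.coe_mul, Matrix.det_mul, norm_mul, norm_det_map, one_mul,
      Matrix.GeneralLinearGroup.coe_scalar, hg] at hdet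
    -- Two representatives of a class differ by a scalar `u`. Both determinants are units, so `‖u‖ ^
    -- n = 1`, and `n > 0` gives `‖u‖ = 1`.
    have hu1 : ‖(u : ℚ_[p])‖ = 1 := by
      simp only [Matrix.scalar_apply, Matrix.det_diagonal, Finset.prod_const, Finset.card_univ,
        Fintype.card_fin, norm_pow] at hdet
      exact (pow_eq_one_iff_of_nonneg (norm_nonneg _) hn.ne').mp hdet
    have hij := congrArg (fun x : GL (Fin n) ℚ_[p] =>
      ‖(x : Matrix (Fin n) (Fin n) ℚ_[p]) i j‖) hu
    simp only [Matrix.GeneralLinearGroup.coe_mul, Matrix.GeneralLinearGroup.coe_scalar,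
      Matrix.scalar_apply, Matrix.mul_diagonal, norm_mul, hu1, mul_one] at hij
    rw [← hij]
    exact PadicInt.norm_le_one _
  · intro h
    let A : Matrix (Fin n) (Fin n) ℤ_[p] := fun i j => ⟨_, h i j⟩
    have hA : (algebraMap ℤ_[p] ℚ_[p]).mapMatrix A = (g : Matrix (Fin n) (Fin n) ℚ_[p]) := rfl
    have hdet : IsUnit A.det := by
      rw [PadicInt.isUnit_iff, PadicInt.norm_def]
      rw [← hA, ← RingHom.map_det] at hg
      exact hg
    refine ⟨Matrix.GeneralLinearGroup.mk'' A hdet, congrArg Matrix.ProjGenLinGroup.mk (Units.ext ?_)⟩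
    exact hA

theorem norm_uniformizer_zpow (p : Primes) (m : ℤ) :
    ‖((uniformizer p ^ m : ℚ_[p]ˣ) : ℚ_[p])‖ = ((p : ℕ) : ℝ) ^ (-m) := by
  rw [Units.val_zpow_eq_zpow_val]
  simp [uniformizer]

theorem one_lt_cast (p : Primes) : (1 : ℝ) < ((p : ℕ) : ℝ) := by exact_mod_cast p.2.one_lt

theorem cocharValue_add (a b : Fin n → ℤ) :
    cocharValue n p (a + b) = cocharValue n p a * cocharValue n p b := by
  simp only [cocharValue, ← map_mul]
  congr 2
  funext i
  simp [zpow_add]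

theorem cocharValue_zero : cocharValue n p 0 = 1 := by
  have h : (fun i : Fin n => uniformizer p ^ (0 : Fin n → ℤ) i) = 1 := by
    funext i
    simp
  rw [cocharValue, h, map_one, map_one]

theorem cocharValue_neg (a : Fin n → ℤ) : cocharValue n p (-a) = (cocharValue n p a)⁻¹ := by
  rw [eq_inv_iff_mul_eq_one, ← cocharValue_add, neg_add_cancel, cocharValue_zero]

theorem cocharValue_const (c : ℤ) : cocharValue n p (fun _ => c) = 1 := by
  have h : diagGL n ℚ_[p] (fun _ => uniformizer p ^ c) =
      Matrix.GeneralLinearGroup.scalar (Fin n) (uniformizer p ^ c) := by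
    apply Units.ext
    rfl
  rw [cocharValue, h, Matrix.ProjGenLinGroup.mk_scalar]

theorem diagGL_apply (d : Fin n → ℚ_[p]ˣ) :
    (diagGL n ℚ_[p] d : Matrix (Fin n) (Fin n) ℚ_[p]) = Matrix.diagonal fun i => (d i : ℚ_[p]) :=
  rfl

/-- Conjugation of an integral matrix by `diag(p^a)` stays integral if and only if the entries are
small enough. -/
theorem conj_mem_localK_iff (hn : 0 < n) (a : Fin n → ℤ) (k : GL (Fin n) ℤ_[p]) :
    (cocharValue n p a)⁻¹ * intToPGL n p k * cocharValue n p a ∈ localK n p ↔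
      ∀ i j, ‖(k : Matrix (Fin n) (Fin n) ℤ_[p]) i j‖ * ((p : ℕ) : ℝ) ^ (a i - a j) ≤ 1 := by
  rw [← cocharValue_neg]
  change Matrix.ProjGenLinGroup.mk (_ * _ * _) ∈ _ ↔ _
  rw [mk_mem_localK_iff hn]
  · refine forall_congr' fun i => forall_congr' fun j => ?_
    simp only [Matrix.GeneralLinearGroup.coe_mul, diagGL_apply, Matrix.mul_diagonal,
      Matrix.diagonal_mul, norm_mul, norm_uniformizer_zpow]
    have hp : ((p : ℕ) : ℝ) ≠ 0 := (zero_lt_one.trans (one_lt_cast p)).ne'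
    have : ‖(Matrix.GeneralLinearGroup.map (n := Fin n) (algebraMap ℤ_[p] ℚ_[p]) k :
      Matrix (Fin n) (Fin n) ℚ_[p]) i j‖ = ‖(k : Matrix (Fin n) (Fin n) ℤ_[p]) i j‖ := rfl
    rw [this, Pi.neg_apply, neg_neg, mul_right_comm, ← zpow_add₀ hp, mul_comm, sub_eq_add_neg]
  · rw [Matrix.GeneralLinearGroup.coe_mul, Matrix.GeneralLinearGroup.coe_mul, Matrix.det_mul,
      Matrix.det_mul, norm_mul, norm_mul, norm_det_map, diagGL_apply, diagGL_apply,
      Matrix.det_diagonal, Matrix.det_diagonal, mul_one, ← norm_mul, ← Finset.prod_mul_distrib]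
    rw [Finset.prod_eq_one, norm_one]
    intro i _
    rw [← Units.val_mul, ← zpow_add]
    simp

/-- Permutation matrices as integral points. -/
def permGL (n : ℕ) (p : Primes) (w : Equiv.Perm (Fin n)) : GL (Fin n) ℤ_[p] :=
  Matrix.GeneralLinearGroup.mk'' (w.permMatrix ℤ_[p]) (by
    rw [Matrix.det_permutation]
    exact (Units.map (Int.castRingHom ℤ_[p]).toMonoidHom (Equiv.Perm.sign w)).isUnit)

theorem permGL_conj (w : Equiv.Perm (Fin n)) (a : Fin n → ℤ) :
    intToPGL n p (permGL n p w) * cocharValue n p a =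
      cocharValue n p (a ∘ w) * intToPGL n p (permGL n p w) := by
  change Matrix.ProjGenLinGroup.mk (_ * _) = Matrix.ProjGenLinGroup.mk (_ * _)
  congr 1
  ext i j
  simp only [Matrix.GeneralLinearGroup.coe_mul, diagGL_apply, Matrix.mul_diagonal,
    Matrix.diagonal_mul]
  simp only [permGL, Matrix.GeneralLinearGroup.map_apply, Matrix.GeneralLinearGroup.mk'',
    Matrix.nonsingInvUnit, Equiv.Perm.permMatrix, Function.comp_apply]
  by_cases h : w i = j
  · subst h
    simp
  · simp [h]

/-- The double coset of `diag(p^a)` is invariant under permutations of `a`. -/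
theorem doubleCoset_comp_perm (w : Equiv.Perm (Fin n)) (a : Fin n → ℤ) :
    DoubleCoset.doubleCoset (cocharValue n p (a ∘ w)) (localK n p : Set (PGL n ℚ_[p]))
      (localK n p) =
    DoubleCoset.doubleCoset (cocharValue n p a) (localK n p : Set (PGL n ℚ_[p]))
      (localK n p) := by
  refine DoubleCoset.doubleCoset_eq_of_mem (DoubleCoset.mem_doubleCoset.mpr
    ⟨_, intToPGL_mem (permGL n p w), _, inv_mem (intToPGL_mem (permGL n p w)), ?_⟩)
  rw [permGL_conj, mul_inv_cancel_right]

end Local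

/-! ### Triangular factorizations -/

section Triangular

variable {n : ℕ} {R : Type*} [CommRing R]

/-- The upper triangular part of a matrix, including the diagonal. -/
def upperPart (M : Matrix (Fin n) (Fin n) R) : Matrix (Fin n) (Fin n) R :=
  Matrix.of fun i j => if i ≤ j then M i j else 0

/-- The strictly lower triangular part of a matrix, with ones on the diagonal. -/
def lowerPart (M : Matrix (Fin n) (Fin n) R) : Matrix (Fin n) (Fin n) R :=
  Matrix.of fun i j => if j < i then M i j else if i = j then 1 else 0

theorem upperPart_blockTriangular (M : Matrix (Fin n) (Fin n) R) :
    (upperPart M).BlockTriangular id := fun i j h => by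
  simp only [id] at h
  simp [upperPart, not_le.mpr h]

theorem lowerPart_blockTriangular (M : Matrix (Fin n) (Fin n) R) :
    (lowerPart M).BlockTriangular OrderDual.toDual := fun i j h => by
  have h' : i < j := h
  simp [lowerPart, not_lt.mpr h'.le, h'.ne]

theorem det_upperPart (M : Matrix (Fin n) (Fin n) R) : (upperPart M).det = ∏ i, M i i := by
  rw [Matrix.det_of_isUpperTriangular (upperPart_blockTriangular M)]
  simp [upperPart]

theorem det_lowerPart (M : Matrix (Fin n) (Fin n) R) : (lowerPart M).det = 1 := by
  rw [Matrix.det_of_isLowerTriangular _ (lowerPart_blockTriangular M)]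
  simp [lowerPart]

theorem map_upperPart {S : Type*} [CommRing S] (f : R →+* S) (M : Matrix (Fin n) (Fin n) R) :
    (upperPart M).map f = upperPart (M.map f) := by
  ext i j
  simp only [upperPart, Matrix.map_apply, Matrix.of_apply]
  split_ifs <;> simp

theorem map_lowerPart {S : Type*} [CommRing S] (f : R →+* S) (M : Matrix (Fin n) (Fin n) R) :
    (lowerPart M).map f = lowerPart (M.map f) := by
  ext i j
  simp only [lowerPart, Matrix.map_apply, Matrix.of_apply]
  split_ifs <;> simp

/-- A factorization into an upper triangular and a lower unitriangular matrix is unique. -/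
theorem eq_of_upperPart_mul_lowerPart {M M' : Matrix (Fin n) (Fin n) R}
    (hM' : ∀ i, IsUnit (M' i i))
    (h : upperPart M * lowerPart M = upperPart M' * lowerPart M') : M = M' := by
  have hU' : IsUnit (upperPart M').det := by
    rw [det_upperPart]
    exact IsUnit.prod_univ_iff.mpr hM'
  have hL : IsUnit (lowerPart M).det := by rw [det_lowerPart]; exact isUnit_one
  let := (upperPart M').invertibleOfIsUnitDet hU'
  let := (lowerPart M).invertibleOfIsUnitDet hL
  -- This matrix is upper triangular by its left side and lower triangular by its right side, hence
  -- diagonal. Comparing the unit diagonals of the lower factors shows that it is `1`.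
  have hX : (upperPart M')⁻¹ * upperPart M = lowerPart M' * (lowerPart M)⁻¹ := by
    have h2 := congrArg (fun X => (upperPart M')⁻¹ * X * (lowerPart M)⁻¹) h
    simp only [Matrix.mul_assoc] at h2
    rw [Matrix.mul_nonsing_inv _ hL, Matrix.mul_one, Matrix.nonsing_inv_mul_cancel_left _ _ hU'] at h2
    exact h2
  have hup : ((upperPart M')⁻¹ * upperPart M).BlockTriangular id :=
    (Matrix.blockTriangular_inv_of_blockTriangular (upperPart_blockTriangular M')).mul
      (upperPart_blockTriangular M)
  have hlo : ((upperPart M')⁻¹ * upperPart M).BlockTriangular OrderDual.toDual := by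
    rw [hX]
    exact (lowerPart_blockTriangular M').mul
      (Matrix.blockTriangular_inv_of_blockTriangular (lowerPart_blockTriangular M))
  set X := (upperPart M')⁻¹ * upperPart M with hXdef
  have hXL : X * lowerPart M = lowerPart M' := by
    rw [hX, Matrix.nonsing_inv_mul_cancel_right _ _ hL]
  have hdiag : ∀ i j, i ≠ j → X i j = 0 := fun i j hij => by
    rcases lt_or_gt_of_ne hij with h1 | h1
    · exact hlo h1
    · exact hup h1
  have hX1 : X = 1 := by
    ext i j
    by_cases hij : i = j
    · subst hij
      have := congrFun (congrFun hXL i) i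
      rw [Matrix.mul_apply, Finset.sum_eq_single i (fun j _ hj => by rw [hdiag i j hj.symm, zero_mul])
        (fun h => absurd (Finset.mem_univ _) h)] at this
      simpa [lowerPart] using this
    · rw [hdiag i j hij, Matrix.one_apply_ne hij]
  rw [hX1, Matrix.one_mul] at hXL
  have hUU : upperPart M = upperPart M' := by
    have h2 := congrArg (fun Y => upperPart M' * Y) hXdef
    simp only [hX1, Matrix.mul_one] at h2
    rw [Matrix.mul_nonsing_inv_cancel_left _ _ hU'] at h2
    exact h2.symm
  ext i j
  rcases le_or_gt i j with hij | hij
  · have := congrFun (congrFun hUU i) j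
    simpa [upperPart, hij] using this
  · have := congrFun (congrFun hXL i) j
    simpa [lowerPart, hij] using this

end Triangular

/-! ### Generic cosets in a double coset of `K_p` -/

section GenericCosets

variable {n : ℕ} {p : Primes}

/-- The set `B(ℤ_p) diag(p^a) K_p`, where `B` is the group of upper triangular matrices. -/
def genericSet (n : ℕ) (p : Primes) (a : Fin n → ℤ) : Set (PGL n ℚ_[p]) :=
  {g | ∃ u : GL (Fin n) ℤ_[p], (u : Matrix (Fin n) (Fin n) ℤ_[p]).BlockTriangular id ∧
    ∃ k ∈ localK n p, g = intToPGL n p u * cocharValue n p a * k}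

/-- The double coset `K_p diag(p^a) K_p`. -/
abbrev cell (n : ℕ) (p : Primes) (a : Fin n → ℤ) : Set (PGL n ℚ_[p]) :=
  DoubleCoset.doubleCoset (cocharValue n p a) (localK n p : Set (PGL n ℚ_[p])) (localK n p)

theorem mem_cell {a : Fin n → ℤ} {g : PGL n ℚ_[p]} :
    g ∈ cell n p a ↔ ∃ k ∈ localK n p, ∃ k' ∈ localK n p, g = k * cocharValue n p a * k' := by
  simp only [cell, DoubleCoset.mem_doubleCoset, SetLike.mem_coe]

theorem finiteCosets_cell (a : Fin n → ℤ) : FiniteCosets (localK n p) (cell n p a) :=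
  finiteCosets_doubleCoset (isOpen_localK n p) (isCompact_localK n p) _

theorem genericSet_subset (a : Fin n → ℤ) : genericSet n p a ⊆ cell n p a := by
  rintro g ⟨u, _, k, hk, rfl⟩
  exact mem_cell.mpr ⟨_, intToPGL_mem u, k, hk, rfl⟩

/-- The stabilizer in `GL_n(ℤ_p)` of the coset `diag(p^a) K_p`. -/
def stabilizerCoset (n : ℕ) (p : Primes) (a : Fin n → ℤ) : Subgroup (GL (Fin n) ℤ_[p]) :=
  (localK n p).comap ((MulAut.conj (cocharValue n p a)⁻¹).toMonoidHom.comp (intToPGL n p))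

theorem mem_stabilizerCoset {a : Fin n → ℤ} {k : GL (Fin n) ℤ_[p]} :
    k ∈ stabilizerCoset n p a ↔
      (cocharValue n p a)⁻¹ * intToPGL n p k * cocharValue n p a ∈ localK n p := by
  rw [stabilizerCoset, Subgroup.mem_comap]
  simp

/-- The orbit map from `GL_n(ℤ_p)` modulo the stabilizer to cosets of `K_p`. -/
def orbitCoset (n : ℕ) (p : Primes) (a : Fin n → ℤ)
    (q : GL (Fin n) ℤ_[p] ⧸ stabilizerCoset n p a) : PGL n ℚ_[p] ⧸ localK n p :=
  ((intToPGL n p q.out * cocharValue n p a : PGL n ℚ_[p]) : PGL n ℚ_[p] ⧸ localK n p)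

theorem coset_eq_iff (a : Fin n → ℤ) (k k' : GL (Fin n) ℤ_[p]) :
    ((intToPGL n p k * cocharValue n p a : PGL n ℚ_[p]) : PGL n ℚ_[p] ⧸ localK n p) =
      ((intToPGL n p k' * cocharValue n p a : PGL n ℚ_[p]) : PGL n ℚ_[p] ⧸ localK n p) ↔
      k⁻¹ * k' ∈ stabilizerCoset n p a := by
  rw [QuotientGroup.eq, mem_stabilizerCoset]
  simp only [mul_inv_rev, map_mul, map_inv, mul_assoc]

theorem orbitCoset_mk (a : Fin n → ℤ) (k : GL (Fin n) ℤ_[p]) :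
    orbitCoset n p a (k : GL (Fin n) ℤ_[p] ⧸ stabilizerCoset n p a) =
      ((intToPGL n p k * cocharValue n p a : PGL n ℚ_[p]) : PGL n ℚ_[p] ⧸ localK n p) := by
  rw [orbitCoset, coset_eq_iff]
  exact QuotientGroup.eq.mp (Quotient.out_eq' (k : GL (Fin n) ℤ_[p] ⧸ stabilizerCoset n p a))

theorem orbitCoset_injective (a : Fin n → ℤ) : Function.Injective (orbitCoset n p a) := by
  intro q q' h
  obtain ⟨k, rfl⟩ := QuotientGroup.mk_surjective q
  obtain ⟨k', rfl⟩ := QuotientGroup.mk_surjective q'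
  rw [orbitCoset_mk, orbitCoset_mk, coset_eq_iff] at h
  exact QuotientGroup.eq.mpr h

theorem image_cell (a : Fin n → ℤ) :
    (QuotientGroup.mk : PGL n ℚ_[p] → PGL n ℚ_[p] ⧸ localK n p) '' cell n p a =
      orbitCoset n p a '' Set.univ := by
  ext x
  constructor
  · rintro ⟨g, hg, rfl⟩
    obtain ⟨k, hk, k', hk', rfl⟩ := mem_cell.mp hg
    obtain ⟨k, rfl⟩ := exists_intToPGL hk
    refine ⟨(k : GL (Fin n) ℤ_[p] ⧸ stabilizerCoset n p a), trivial, ?_⟩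
    rw [orbitCoset_mk]
    exact (QuotientGroup.mk_mul_of_mem _ hk').symm
  · rintro ⟨q, -, rfl⟩
    obtain ⟨k, rfl⟩ := QuotientGroup.mk_surjective q
    rw [orbitCoset_mk]
    exact ⟨_, mem_cell.mpr ⟨_, intToPGL_mem k, 1, one_mem _, (mul_one _).symm⟩, rfl⟩

theorem image_genericSet (a : Fin n → ℤ) :
    (QuotientGroup.mk : PGL n ℚ_[p] → PGL n ℚ_[p] ⧸ localK n p) '' genericSet n p a =
      orbitCoset n p a '' ((QuotientGroup.mk : _ → GL (Fin n) ℤ_[p] ⧸ stabilizerCoset n p a) ''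
        {u | (u : Matrix (Fin n) (Fin n) ℤ_[p]).BlockTriangular id}) := by
  rw [Set.image_image]
  simp only [orbitCoset_mk]
  ext x
  constructor
  · rintro ⟨g, ⟨u, hu, k, hk, rfl⟩, rfl⟩
    exact ⟨u, hu, (QuotientGroup.mk_mul_of_mem _ hk).symm⟩
  · rintro ⟨u, hu, rfl⟩
    exact ⟨_, ⟨u, hu, 1, one_mem _, (mul_one _).symm⟩, rfl⟩

/-- Orbit-stabilizer for `GL_n(ℤ_p)` acting on the coset of `diag(p^a)`. -/
theorem cosetCount_cell (a : Fin n → ℤ) :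
    cosetCount (localK n p) (cell n p a) =
      Nat.card (GL (Fin n) ℤ_[p] ⧸ stabilizerCoset n p a) := by
  rw [cosetCount, image_cell, Set.ncard_image_of_injective _ (orbitCoset_injective a),
    Set.ncard_univ]

theorem finite_quotient_stabilizerCoset (a : Fin n → ℤ) :
    Finite (GL (Fin n) ℤ_[p] ⧸ stabilizerCoset n p a) := by
  have h : FiniteCosets (localK n p) (cell n p a) := finiteCosets_cell a
  rw [FiniteCosets, image_cell] at h
  exact Set.finite_univ_iff.mp (h.of_finite_image (orbitCoset_injective a).injOn)

/-- The principal congruence subgroup of level `p^r`. -/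
def congruenceSubgroup (n : ℕ) (p : Primes) (r : ℕ) : Subgroup (GL (Fin n) ℤ_[p]) :=
  (Matrix.GeneralLinearGroup.map (n := Fin n) (PadicInt.toZModPow (p := p) r)).ker

theorem toZModPow_eq_zero_iff {r : ℕ} {x : ℤ_[p]} :
    PadicInt.toZModPow (p := p) r x = 0 ↔ ‖x‖ ≤ ((p : ℕ) : ℝ) ^ (-(r : ℤ)) := by
  rw [← RingHom.mem_ker, PadicInt.ker_toZModPow, ← PadicInt.norm_le_pow_iff_mem_span_pow]

/-- Conjugation scales the norm of the entry `(i, j)` by `p^(a i - a j) ≤ p^r`, which divisibility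
of the off-diagonal entries by `p^r` absorbs. Coset counts thus reduce to counts modulo `p^r`. -/
theorem congruenceSubgroup_le (hn : 0 < n) (a : Fin n → ℤ) {r : ℕ}
    (hr : ∀ i j, a i - a j ≤ r) : congruenceSubgroup n p r ≤ stabilizerCoset n p a := by
  intro k hk
  rw [mem_stabilizerCoset, conj_mem_localK_iff hn]
  intro i j
  have hp := one_lt_cast p
  by_cases hij : i = j
  · subst hij
    simpa using PadicInt.norm_le_one _
  · have h1 : PadicInt.toZModPow (p := p) r ((k : Matrix (Fin n) (Fin n) ℤ_[p]) i j) = 0 := by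
      have h2 := congrArg (fun x : GL (Fin n) (ZMod ((p : ℕ) ^ r)) =>
        (x : Matrix (Fin n) (Fin n) (ZMod ((p : ℕ) ^ r))) i j) (MonoidHom.mem_ker.mp hk)
      simpa [Matrix.one_apply_ne hij] using h2
    rw [toZModPow_eq_zero_iff] at h1
    calc _ ≤ ((p : ℕ) : ℝ) ^ (-(r : ℤ)) * ((p : ℕ) : ℝ) ^ (r : ℤ) := by
          refine mul_le_mul h1 (zpow_le_zpow_right₀ hp.le (hr i j)) (by positivity) (by positivity)
      _ = 1 := by rw [← zpow_add₀ (by positivity), neg_add_cancel, zpow_zero]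

/-- The bound counts all matrices over `ℤ/p^r`, invertible or not. This suffices because the big
cell already has proportion `(1 - 1/p)^n` among all matrices. -/
theorem finite_quotient_congruenceSubgroup (r : ℕ) :
    Finite (GL (Fin n) ℤ_[p] ⧸ congruenceSubgroup n p r) ∧
      Nat.card (GL (Fin n) ℤ_[p] ⧸ congruenceSubgroup n p r) ≤ (((p : ℕ) ^ r) ^ n) ^ n := by
  have : NeZero ((p : ℕ) ^ r) := ⟨pow_ne_zero _ p.2.ne_zero⟩
  let f : GL (Fin n) ℤ_[p] ⧸ congruenceSubgroup n p r →
      (Fin n → Fin n → ZMod ((p : ℕ) ^ r)) := fun q =>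
    ((QuotientGroup.kerLift
      (Matrix.GeneralLinearGroup.map (n := Fin n) (PadicInt.toZModPow (p := p) r)) q :
      GL (Fin n) (ZMod ((p : ℕ) ^ r))) : Matrix (Fin n) (Fin n) (ZMod ((p : ℕ) ^ r)))
  have hf : Function.Injective f := fun x y h =>
    QuotientGroup.kerLift_injective _ (Units.ext h)
  refine ⟨Finite.of_injective f hf, (Nat.card_le_card_of_injective f hf).trans ?_⟩
  simp

theorem surjective_toZModPow (r : ℕ) : Function.Surjective (PadicInt.toZModPow (p := p) r) :=
  ZMod.ringHom_surjective _

theorem isUnit_of_isUnit_toZModPow {r : ℕ} (hr : 0 < r) {x : ℤ_[p]}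
    (h : IsUnit (PadicInt.toZModPow (p := p) r x)) : IsUnit x := by
  have : Fact (1 < (p : ℕ) ^ r) := ⟨Nat.one_lt_pow hr.ne' p.2.one_lt⟩
  have := IsLocalHom.of_surjective _ (surjective_toZModPow (p := p) r)
  exact isUnit_of_map_unit _ x h

/-- Products of an upper triangular and a lower unitriangular matrix fill up most of
`GL_n(ℤ/p^r)`. -/
theorem le_ncard_triangular_products {r : ℕ} (hr : 0 < r) :
    (((p : ℕ) ^ r - (p : ℕ) ^ (r - 1)) * ((p : ℕ) ^ r) ^ (n - 1)) ^ n ≤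
      ((QuotientGroup.mk : _ → GL (Fin n) ℤ_[p] ⧸ congruenceSubgroup n p r) ''
        {k | ∃ u l : GL (Fin n) ℤ_[p], (u : Matrix (Fin n) (Fin n) ℤ_[p]).BlockTriangular id ∧
          (l : Matrix (Fin n) (Fin n) ℤ_[p]).BlockTriangular OrderDual.toDual ∧
          k = u * l}).ncard := by
  classical
  have : NeZero ((p : ℕ) ^ r) := ⟨pow_ne_zero _ p.2.ne_zero⟩
  have := (finite_quotient_congruenceSubgroup (n := n) (p := p) r).1
  -- A matrix with unit diagonal stores both factors at once: its upper part, diagonal included, and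
  -- its strictly lower part. By uniqueness of the factorization, counting products amounts to
  -- counting such matrices.
  let X : Finset (Fin n → Fin n → ZMod ((p : ℕ) ^ r)) :=
    Fintype.piFinset fun i => Fintype.piFinset fun j =>
      if i = j then Finset.univ.filter fun x => IsUnit x else Finset.univ
  have hX : X.card = (((p : ℕ) ^ r - (p : ℕ) ^ (r - 1)) * ((p : ℕ) ^ r) ^ (n - 1)) ^ n := by
    have hunits : (Finset.univ.filter fun x : ZMod ((p : ℕ) ^ r) => IsUnit x).card =
        (p : ℕ) ^ r - (p : ℕ) ^ (r - 1) := by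
      have h1 : (Finset.univ.filter fun x : ZMod ((p : ℕ) ^ r) => IsUnit x) =
          Finset.univ.image (Units.val : (ZMod ((p : ℕ) ^ r))ˣ → _) := by
        ext x
        simp only [Finset.mem_filter, Finset.mem_univ, true_and, Finset.mem_image]
        rfl
      rw [h1, Finset.card_image_of_injective _ Units.val_injective, Finset.card_univ,
        ZMod.card_units_eq_totient, Nat.totient_prime_pow p.2 hr, Nat.mul_sub, mul_one, ← pow_succ,
        Nat.sub_add_cancel hr]
    simp only [X, Fintype.card_piFinset]
    have hrow : ∀ i : Fin n, ∏ j : Fin n, (if i = j then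
        (Finset.univ.filter fun x : ZMod ((p : ℕ) ^ r) => IsUnit x) else Finset.univ).card =
        ((p : ℕ) ^ r - (p : ℕ) ^ (r - 1)) * ((p : ℕ) ^ r) ^ (n - 1) := fun i => by
      rw [← Finset.mul_prod_erase _ _ (Finset.mem_univ i), if_pos rfl, hunits]
      congr 1
      rw [Finset.prod_congr rfl (g := fun _ => (p : ℕ) ^ r)
        (fun j hj => by rw [if_neg (Finset.ne_of_mem_erase hj).symm]; simp [ZMod.card])]
      simp
    rw [Finset.prod_congr rfl fun i _ => hrow i]
    simp
  rw [← hX]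
  choose s hs using surjective_toZModPow (p := p) r
  let lift : (Fin n → Fin n → ZMod ((p : ℕ) ^ r)) → Matrix (Fin n) (Fin n) ℤ_[p] :=
    fun m => Matrix.of fun i j => s (m i j)
  have hdiag : ∀ m ∈ X, ∀ i, IsUnit (m i i) := fun m hm i => by
    have := Fintype.mem_piFinset.mp (Fintype.mem_piFinset.mp hm i) i
    simpa using this
  have hunit : ∀ m ∈ X, IsUnit (upperPart (lift m)).det := fun m hm => by
    rw [det_upperPart, IsUnit.prod_univ_iff]
    intro i
    refine isUnit_of_isUnit_toZModPow hr ?_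
    change IsUnit (PadicInt.toZModPow (p := p) r (s (m i i)))
    rw [hs]
    exact hdiag m hm i
  let F : (Fin n → Fin n → ZMod ((p : ℕ) ^ r)) → GL (Fin n) ℤ_[p] := fun m =>
    if hm : m ∈ X then Matrix.GeneralLinearGroup.mk'' (upperPart (lift m)) (hunit m hm) *
      Matrix.GeneralLinearGroup.mk'' (lowerPart (lift m)) (by
        rw [det_lowerPart]; exact isUnit_one) else 1
  rw [← Set.ncard_coe_finset]
  refine Set.ncard_le_ncard_of_injOn (fun m => (F m : GL (Fin n) ℤ_[p] ⧸ congruenceSubgroup n p r))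
    ?_ ?_ (Set.toFinite _)
  · intro m hm
    have hm' : m ∈ X := hm
    refine ⟨F m, ⟨Matrix.GeneralLinearGroup.mk'' (upperPart (lift m)) (hunit m hm'),
      Matrix.GeneralLinearGroup.mk'' (lowerPart (lift m)) (by
        rw [det_lowerPart]; exact isUnit_one), upperPart_blockTriangular _, lowerPart_blockTriangular (lift m), ?_⟩, rfl⟩
    simp only [F, dif_pos hm']
  · intro m hm m' hm' h
    have hm2 : m ∈ X := hm
    have hm2' : m' ∈ X := hm'
    have h1 := QuotientGroup.eq.mp h
    rw [congruenceSubgroup, MonoidHom.mem_ker, map_mul, map_inv, inv_mul_eq_one] at h1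
    have hval : ∀ m, (hm : m ∈ X) →
        ((Matrix.GeneralLinearGroup.map (n := Fin n) (PadicInt.toZModPow (p := p) r) (F m) :
          GL (Fin n) (ZMod ((p : ℕ) ^ r))) : Matrix (Fin n) (Fin n) (ZMod ((p : ℕ) ^ r))) =
        upperPart (Matrix.of m) * lowerPart (Matrix.of m) := fun m hm => by
      have hl : (lift m).map (PadicInt.toZModPow (p := p) r) = Matrix.of m := by
        ext i j
        exact hs _
      rw [← hl, ← map_upperPart, ← map_lowerPart, ← Matrix.map_mul]
      simp only [F, dif_pos hm]
      rfl
    have h2 := congrArg Units.val h1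
    rw [hval m hm2, hval m' hm2'] at h2
    exact eq_of_upperPart_mul_lowerPart (hdiag m' hm2') h2

/-- Most cosets in `K_p diag(p^a) K_p` are generic. -/
theorem le_cosetCount_genericSet (hn : 0 < n) {a : Fin n → ℤ} (ha : Antitone a) :
    (1 - (n : ℝ) / (p : ℕ)) * cosetCount (localK n p) (cell n p a) ≤
      cosetCount (localK n p) (genericSet n p a) := by
  -- The summand `1` in the witness ensures `r > 0`, so that units are detected modulo `p^r`.
  obtain ⟨r, hr0, hr⟩ : ∃ r : ℕ, 0 < r ∧ ∀ i j, a i - a j ≤ r := by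
    refine ⟨(∑ i, ∑ j, (a i - a j).natAbs) + 1, Nat.succ_pos _, fun i j => ?_⟩
    have h1 : (a i - a j).natAbs ≤ ∑ i, ∑ j, (a i - a j).natAbs :=
      (Finset.single_le_sum (f := fun j => (a i - a j).natAbs) (fun _ _ => Nat.zero_le _)
        (Finset.mem_univ j)).trans
      (Finset.single_le_sum (f := fun i => ∑ j, (a i - a j).natAbs) (fun _ _ => Nat.zero_le _)
        (Finset.mem_univ i))
    omega
  set Γ := GL (Fin n) ℤ_[p]
  set E := stabilizerCoset n p a with hE
  set D := congruenceSubgroup n p r with hD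
  have hDE : D ≤ E := congruenceSubgroup_le hn a hr
  have hfinD : Finite (Γ ⧸ D) := (finite_quotient_congruenceSubgroup r).1
  have hfinE : Finite (Γ ⧸ E) := finite_quotient_stabilizerCoset a
  let e := Subgroup.quotientEquivProdOfLE hDE
  have he : ∀ k : Γ, (e (k : Γ ⧸ D)).1 = (k : Γ ⧸ E) := fun k => rfl
  have hne : Nonempty (Γ ⧸ D) := ⟨((1 : Γ) : Γ ⧸ D)⟩
  have hfinS : Finite (E ⧸ D.subgroupOf E) :=
    Finite.of_surjective (fun x => (e x).2) fun y => ⟨e.symm (((1 : Γ) : Γ ⧸ E), y), by simp⟩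
  set m := Nat.card (E ⧸ D.subgroupOf E) with hm
  have hmpos : 0 < m := by
    have : Nonempty (E ⧸ D.subgroupOf E) := ⟨((1 : E) : E ⧸ D.subgroupOf E)⟩
    exact Nat.card_pos
  set B : Set (Γ ⧸ E) := (QuotientGroup.mk : Γ → Γ ⧸ E) ''
    {u | (u : Matrix (Fin n) (Fin n) ℤ_[p]).BlockTriangular id} with hB
  have hgen : cosetCount (localK n p) (genericSet n p a) = B.ncard := by
    rw [cosetCount, image_genericSet, Set.ncard_image_of_injective _ (orbitCoset_injective a)]
  have hcard : Nat.card (Γ ⧸ D) = Nat.card (Γ ⧸ E) * m := by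
    rw [Nat.card_congr e, Nat.card_prod]
  have hp := one_lt_cast p
  have hprod := le_ncard_triangular_products (n := n) (p := p) hr0
  set S := (QuotientGroup.mk : Γ → Γ ⧸ D) ''
        {k | ∃ u l : Γ, (u : Matrix (Fin n) (Fin n) ℤ_[p]).BlockTriangular id ∧
          (l : Matrix (Fin n) (Fin n) ℤ_[p]).BlockTriangular OrderDual.toDual ∧
          k = u * l} with hS
  -- As `a` is antitone, integral lower triangular matrices fix the coset of `diag(p^a)`. So `u * l`
  -- and `u` have the same image in `Γ ⧸ E`, which is generic, and every fibre of `Γ ⧸ D → Γ ⧸ E`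
  -- has `m` elements.
  have hSB : S.ncard ≤ B.ncard * m := by
    have h1 : S.ncard ≤ (B ×ˢ (Set.univ : Set (E ⧸ D.subgroupOf E))).ncard := by
      refine Set.ncard_le_ncard_of_injOn e ?_ e.injective.injOn (Set.toFinite _)
      rintro _ ⟨_, ⟨u, l, hu, hl, rfl⟩, rfl⟩
      refine ⟨⟨u, hu, ?_⟩, trivial⟩
      rw [he]
      refine (QuotientGroup.mk_mul_of_mem _ ?_).symm
      rw [hE, mem_stabilizerCoset, conj_mem_localK_iff hn]
      intro i j
      rcases lt_or_ge i j with hij | hij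
      · rw [hl hij]
        simp
      · have h2 : a i - a j ≤ 0 := sub_nonpos.mpr (ha hij)
        exact mul_le_one₀ (PadicInt.norm_le_one _) (by positivity)
          (zpow_le_one_of_nonpos₀ hp.le h2)
    rwa [Set.ncard_prod, Set.ncard_univ] at h1
  have hq : ((p : ℕ) : ℝ) ^ (r - 1) = (p : ℕ) ^ r / (p : ℕ) := by
    rw [eq_div_iff (by positivity), ← pow_succ, Nat.sub_add_cancel hr0]
  -- The proportion of matrices with unit diagonal is `(1 - 1/p)^n`, which is at least `1 - n/p` by
  -- Bernoulli's inequality.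
  have hbig : (1 - (n : ℝ) / (p : ℕ)) * ((((p : ℕ) : ℝ) ^ r) ^ n) ^ n ≤ (S.ncard : ℝ) := by
    have h1 : ((((((p : ℕ) ^ r - (p : ℕ) ^ (r - 1)) * ((p : ℕ) ^ r) ^ (n - 1)) ^ n : ℕ)) : ℝ) ≤
        (S.ncard : ℝ) := by exact_mod_cast hprod
    refine le_trans ?_ h1
    push_cast [Nat.pow_le_pow_right p.2.pos (Nat.sub_le r 1)]
    rw [hq]
    have h2 : (((p : ℕ) : ℝ) ^ r - (p : ℕ) ^ r / (p : ℕ)) * (((p : ℕ) : ℝ) ^ r) ^ (n - 1) =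
        (1 + -(1 / ((p : ℕ) : ℝ))) * (((p : ℕ) : ℝ) ^ r) ^ n := by
      conv_rhs => rw [← Nat.sub_add_cancel hn, pow_succ]
      ring
    rw [h2, mul_pow]
    refine mul_le_mul_of_nonneg_right ?_ (by positivity)
    have h3 : (-2 : ℝ) ≤ -(1 / ((p : ℕ) : ℝ)) := by
      rw [neg_le_neg_iff, div_le_iff₀ (by positivity)]
      linarith
    refine le_trans (le_of_eq ?_) (one_add_mul_le_pow h3 n)
    ring
  rw [hgen, cosetCount_cell]
  change _ * (Nat.card (Γ ⧸ E) : ℝ) ≤ _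
  rcases le_or_gt (1 - (n : ℝ) / (p : ℕ)) 0 with h0 | h0
  · exact (mul_nonpos_of_nonpos_of_nonneg h0 (Nat.cast_nonneg _)).trans (Nat.cast_nonneg _)
  · have hmR : (0 : ℝ) < m := by exact_mod_cast hmpos
    refine le_of_mul_le_mul_right ?_ hmR
    have h4 : (Nat.card (Γ ⧸ D) : ℝ) ≤ ((((p : ℕ) : ℝ) ^ r) ^ n) ^ n := by
      exact_mod_cast (finite_quotient_congruenceSubgroup r).2
    calc (1 - (n : ℝ) / (p : ℕ)) * (Nat.card (Γ ⧸ E) : ℝ) * m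
        = (1 - (n : ℝ) / (p : ℕ)) * (Nat.card (Γ ⧸ D) : ℝ) := by rw [hcard]; push_cast; ring
      _ ≤ (1 - (n : ℝ) / (p : ℕ)) * ((((p : ℕ) : ℝ) ^ r) ^ n) ^ n :=
          mul_le_mul_of_nonneg_left h4 h0.le
      _ ≤ S.ncard := hbig
      _ ≤ B.ncard * m := by exact_mod_cast hSB

end GenericCosets

/-! ### Root subgroups and the growth of the number of generic cosets -/

section RootElements

variable {n : ℕ} {p : Primes}

theorem blockTriangular_inv {R : Type*} [CommRing R] {g : GL (Fin n) R}
    (hg : (g : Matrix (Fin n) (Fin n) R).BlockTriangular id) :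
    ((g⁻¹ : GL (Fin n) R) : Matrix (Fin n) (Fin n) R).BlockTriangular id := by
  rw [Matrix.GeneralLinearGroup.coe_inv]
  let := g.isUnit.invertible
  exact Matrix.blockTriangular_inv_of_blockTriangular hg

theorem blockTriangular_mul {R : Type*} [CommRing R] {g h : GL (Fin n) R}
    (hg : (g : Matrix (Fin n) (Fin n) R).BlockTriangular id)
    (hh : (h : Matrix (Fin n) (Fin n) R).BlockTriangular id) :
    ((g * h : GL (Fin n) R) : Matrix (Fin n) (Fin n) R).BlockTriangular id := by
  rw [Matrix.GeneralLinearGroup.coe_mul]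
  exact Matrix.BlockTriangular.mul hg hh

/-- Two positive root positions whose root subgroups commute and multiply to zero. -/
structure RootPair (n : ℕ) where
  /-- row of the first root -/
  i : Fin n
  /-- column of the first root -/
  j : Fin n
  /-- row of the second root -/
  i' : Fin n
  /-- column of the second root -/
  j' : Fin n
  lt : i < j
  lt' : i' < j'
  ne : j ≠ i'
  ne' : j' ≠ i
  distinct : ¬ (i = i' ∧ j = j')

/-- The nilpotent matrix `s E_{ij} + t E_{i'j'}`. -/
def RootPair.nil {R : Type*} [CommRing R] (P : RootPair n) (s t : R) : Matrix (Fin n) (Fin n) R :=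
  Matrix.single P.i P.j s + Matrix.single P.i' P.j' t

theorem RootPair.nil_mul_nil {R : Type*} [CommRing R] (P : RootPair n) (s t s' t' : R) :
    P.nil s t * P.nil s' t' = 0 := by
  simp only [RootPair.nil, Matrix.add_mul, Matrix.mul_add]
  rw [Matrix.single_mul_single_of_ne _ _ _ _ P.lt.ne', Matrix.single_mul_single_of_ne _ _ _ _ P.ne,
    Matrix.single_mul_single_of_ne _ _ _ _ P.ne', Matrix.single_mul_single_of_ne _ _ _ _ P.lt'.ne']
  simp

/-- The unipotent matrix `1 + s E_{ij} + t E_{i'j'}`. -/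
def RootPair.unip {R : Type*} [CommRing R] (P : RootPair n) (s t : R) : GL (Fin n) R where
  val := 1 + P.nil s t
  inv := 1 - P.nil s t
  val_inv := by
    rw [mul_sub, add_mul, add_mul, P.nil_mul_nil]
    simp
  inv_val := by
    rw [mul_add, sub_mul, sub_mul, P.nil_mul_nil]
    simp

theorem RootPair.unip_inv_mul {R : Type*} [CommRing R] (P : RootPair n) (s t s' t' : R) :
    (P.unip s t)⁻¹ * P.unip s' t' = P.unip (s' - s) (t' - t) := by
  apply Units.ext
  change (1 - P.nil s t) * (1 + P.nil s' t') = 1 + P.nil (s' - s) (t' - t)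
  rw [mul_add, sub_mul, sub_mul, P.nil_mul_nil]
  have : P.nil (s' - s) (t' - t) = P.nil s' t' - P.nil s t := by
    ext x y
    simp only [RootPair.nil, Matrix.add_apply, Matrix.sub_apply, Matrix.single_apply]
    split_ifs <;> ring
  rw [this]
  simp only [mul_one, one_mul, sub_zero]
  abel

theorem RootPair.nil_blockTriangular {R : Type*} [CommRing R] (P : RootPair n) (s t : R) :
    (P.nil s t).BlockTriangular id :=
  (Matrix.blockTriangular_single (b := id) P.lt.le s).add
    (Matrix.blockTriangular_single (b := id) P.lt'.le t)

theorem RootPair.unip_blockTriangular {R : Type*} [CommRing R] (P : RootPair n) (s t : R) :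
    (P.unip s t : Matrix (Fin n) (Fin n) R).BlockTriangular id :=
  Matrix.blockTriangular_one.add (P.nil_blockTriangular s t)

theorem RootPair.unip_apply_fst {R : Type*} [CommRing R] (P : RootPair n) (s t : R) :
    (P.unip s t : Matrix (Fin n) (Fin n) R) P.i P.j = s := by
  change (1 + (Matrix.single P.i P.j s + Matrix.single P.i' P.j' t)) P.i P.j = s
  have h : ¬ (P.i' = P.i ∧ P.j' = P.j) := fun h => P.distinct ⟨h.1.symm, h.2.symm⟩
  simp [Matrix.one_apply_ne P.lt.ne, Matrix.single_apply_of_ne _ _ _ _ _ h]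

theorem RootPair.unip_apply_snd {R : Type*} [CommRing R] (P : RootPair n) (s t : R) :
    (P.unip s t : Matrix (Fin n) (Fin n) R) P.i' P.j' = t := by
  change (1 + (Matrix.single P.i P.j s + Matrix.single P.i' P.j' t)) P.i' P.j' = t
  simp [Matrix.one_apply_ne P.lt'.ne, Matrix.single_apply_of_ne _ _ _ _ _ P.distinct]

theorem RootPair.unip_mem_stabilizerCoset (hn : 0 < n) (P : RootPair n) (a : Fin n → ℤ)
    {s t : ℤ_[p]} :
    P.unip s t ∈ stabilizerCoset n p a ↔
      ‖s‖ * ((p : ℕ) : ℝ) ^ (a P.i - a P.j) ≤ 1 ∧ ‖t‖ * ((p : ℕ) : ℝ) ^ (a P.i' - a P.j') ≤ 1 := by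
  rw [mem_stabilizerCoset, conj_mem_localK_iff hn]
  constructor
  · intro h
    have h1 := h P.i P.j
    have h2 := h P.i' P.j'
    rw [P.unip_apply_fst] at h1
    rw [P.unip_apply_snd] at h2
    exact ⟨h1, h2⟩
  · rintro ⟨h1, h2⟩ i j
    by_cases hs : i = P.i ∧ j = P.j
    · obtain ⟨rfl, rfl⟩ := hs
      rwa [P.unip_apply_fst]
    by_cases ht : i = P.i' ∧ j = P.j'
    · obtain ⟨rfl, rfl⟩ := ht
      rwa [P.unip_apply_snd]
    have hval : (P.unip s t : Matrix (Fin n) (Fin n) ℤ_[p]) i j =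
        (1 : Matrix (Fin n) (Fin n) ℤ_[p]) i j := by
      change (1 + (Matrix.single P.i P.j s + Matrix.single P.i' P.j' t)) i j = _
      rw [Matrix.add_apply, Matrix.add_apply,
        Matrix.single_apply_of_ne _ _ _ _ _ (fun h => hs ⟨h.1.symm, h.2.symm⟩),
        Matrix.single_apply_of_ne _ _ _ _ _ (fun h => ht ⟨h.1.symm, h.2.symm⟩)]
      simp
    rw [hval]
    by_cases hij : i = j
    · subst hij
      simp
    · simp [Matrix.one_apply_ne hij]

/-- An antitone nonconstant `b` drops from index `0` to `n - 1`, so the position `(0, n-1)` always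
qualifies. The second is `(0, 1)` if `b` already drops at index `1`, and `(1, n-1)` otherwise. Three
indices are needed. -/
theorem exists_rootPair (hn : 3 ≤ n) {b : Fin n → ℤ} (hb : Antitone b)
    (hne : ∃ i j, b i ≠ b j) : ∃ P : RootPair n, b P.j < b P.i ∧ b P.j' < b P.i' := by
  obtain ⟨i, j, hij⟩ := hne
  let z : Fin n := ⟨0, by omega⟩
  let o : Fin n := ⟨1, by omega⟩
  let l : Fin n := ⟨n - 1, by omega⟩
  have hzo : z < o := by simp [z, o]
  have hol : o < l := by simp only [o, l, Fin.mk_lt_mk]; omega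
  have hzl : z < l := hzo.trans hol
  have hz : ∀ i, z ≤ i := fun i => by simp [z, Fin.le_def]
  have hl : ∀ i, i ≤ l := fun i => by simp only [l, Fin.le_def]; omega
  have hlt : b l < b z := by
    have h1 := hb (hz i)
    have h2 := hb (hz j)
    have h3 := hb (hl i)
    have h4 := hb (hl j)
    omega
  rcases lt_or_ge (b o) (b z) with h | h
  · exact ⟨⟨z, l, z, o, hzl, hzo, hzl.ne', hzo.ne', fun h => hol.ne' h.2⟩, hlt, h⟩
  · exact ⟨⟨z, l, o, l, hzl, hol, hol.ne', hzl.ne', fun h => hzo.ne h.1⟩, hlt, hlt.trans_le h⟩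

/-- Above the diagonal `b i - b j ≥ 0`, so the integrality conditions at `a + b` are stronger than
those at `a`; below it the entries vanish. -/
theorem stabilizerCoset_of_add (hn : 0 < n) {a b : Fin n → ℤ} (hb : Antitone b)
    {g : GL (Fin n) ℤ_[p]} (hg : (g : Matrix (Fin n) (Fin n) ℤ_[p]).BlockTriangular id)
    (h : g ∈ stabilizerCoset n p (a + b)) : g ∈ stabilizerCoset n p a := by
  rw [mem_stabilizerCoset, conj_mem_localK_iff hn] at h ⊢
  intro i j
  rcases lt_or_ge j i with hij | hij
  · rw [hg hij]
    simp
  · refine le_trans (mul_le_mul_of_nonneg_left (zpow_le_zpow_right₀ (one_lt_cast p).le ?_)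
      (norm_nonneg _)) (h i j)
    have := hb hij
    simp only [Pi.add_apply]
    omega

theorem norm_pow_mul_natCast_mul_le (p : Primes) {d : ℤ} (hd : 0 ≤ d) (x : ℤ_[p]) :
    ‖((p : ℕ) : ℤ_[p]) ^ d.toNat * x‖ * ((p : ℕ) : ℝ) ^ d = ‖x‖ := by
  have hp := one_lt_cast p
  rw [norm_mul, norm_pow, PadicInt.norm_p, ← zpow_natCast, Int.toNat_of_nonneg hd, inv_zpow,
    mul_right_comm, inv_mul_cancel₀ (by positivity), one_mul]

theorem eq_of_norm_sub_mul_zpow_le (p : Primes) {d : ℤ} (hd : 0 < d) {x y : ℕ} (hx : x < (p : ℕ))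
    (hy : y < (p : ℕ)) (h : ‖((x : ℤ_[p]) - y)‖ * ((p : ℕ) : ℝ) ^ d ≤ 1) : x = y := by
  have hp := one_lt_cast p
  have h1 : ‖(((x : ℤ) - (y : ℤ) : ℤ) : ℤ_[p])‖ < 1 := by
    push_cast
    by_contra h2
    have h3 : 1 < ((p : ℕ) : ℝ) ^ d := one_lt_zpow₀ hp hd
    have h4 := mul_le_mul_of_nonneg_right (not_lt.mp h2) (zero_le_one.trans h3.le)
    linarith
  rw [PadicInt.norm_int_lt_one_iff_dvd] at h1
  have h2 := Int.eq_zero_of_abs_lt_dvd h1 (by rw [abs_lt]; constructor <;> omega)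
  omega

/-- Translating by a nonconstant antitone cocharacter multiplies the number of generic cosets by at
least `p^2`. -/
theorem sq_mul_cosetCount_genericSet_le (hn : 3 ≤ n) {a b : Fin n → ℤ} (ha : Antitone a)
    (hb : Antitone b) (hne : ∃ i j, b i ≠ b j) :
    (p : ℕ) ^ 2 * cosetCount (localK n p) (genericSet n p a) ≤
      cosetCount (localK n p) (genericSet n p (a + b)) := by
  have hn0 : 0 < n := by omega
  obtain ⟨P, hP, hP'⟩ := exists_rootPair hn hb hne
  simp only [cosetCount, image_genericSet]
  rw [Set.ncard_image_of_injective _ (orbitCoset_injective a),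
    Set.ncard_image_of_injective _ (orbitCoset_injective (a + b))]
  set U : Set (GL (Fin n) ℤ_[p]) :=
    {u | (u : Matrix (Fin n) (Fin n) ℤ_[p]).BlockTriangular id} with hU
  set B := (QuotientGroup.mk : _ → GL (Fin n) ℤ_[p] ⧸ stabilizerCoset n p a) '' U
  have hrep : ∀ q : B, ∃ u ∈ U, (u : GL (Fin n) ℤ_[p] ⧸ stabilizerCoset n p a) = q := fun q => q.2
  choose s hsU hs using hrep
  have hd : 0 ≤ a P.i - a P.j := sub_nonneg.mpr (ha P.lt.le)
  have hd' : 0 ≤ a P.i' - a P.j' := sub_nonneg.mpr (ha P.lt'.le)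
  -- These `p^2` unipotents have entries just small enough to fix the coset of `diag(p^a)`. Since
  -- `b` drops along both roots, they are distinct modulo the smaller group fixing the coset of
  -- `diag(p^(a+b))`, so each generic coset for `a` yields `p^2` for `a + b`.
  let v : Fin (p : ℕ) × Fin (p : ℕ) → GL (Fin n) ℤ_[p] := fun x =>
    P.unip (((p : ℕ) : ℤ_[p]) ^ (a P.i - a P.j).toNat * ((x.1 : ℕ) : ℤ_[p]))
      (((p : ℕ) : ℤ_[p]) ^ (a P.i' - a P.j').toNat * ((x.2 : ℕ) : ℤ_[p]))
  have hvU : ∀ x, v x ∈ U := fun x => P.unip_blockTriangular _ _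
  have hva : ∀ x, v x ∈ stabilizerCoset n p a := fun x => by
    rw [P.unip_mem_stabilizerCoset hn0, norm_pow_mul_natCast_mul_le p hd,
      norm_pow_mul_natCast_mul_le p hd']
    exact ⟨PadicInt.norm_le_one _, PadicInt.norm_le_one _⟩
  have := finite_quotient_stabilizerCoset (p := p) (a + b)
  have hcard : (p : ℕ) ^ 2 * B.ncard =
      (Set.univ : Set (B × (Fin (p : ℕ) × Fin (p : ℕ)))).ncard := by
    rw [Set.ncard_univ, Nat.card_prod, Nat.card_prod, Nat.card_coe_set_eq]
    simp only [Nat.card_eq_fintype_card, Fintype.card_fin]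
    ring
  rw [hcard]
  refine Set.ncard_le_ncard_of_injOn
    (fun x => ((s x.1 * v x.2 : GL (Fin n) ℤ_[p]) : GL (Fin n) ℤ_[p] ⧸ stabilizerCoset n p (a + b)))
    ?_ ?_ (Set.toFinite _)
  · rintro x -
    exact ⟨_, blockTriangular_mul (hsU x.1) (hvU x.2), rfl⟩
  · rintro ⟨q, x⟩ - ⟨q', x'⟩ - h
    have h1 := QuotientGroup.eq.mp h
    have hUT : ((s q * v x)⁻¹ * (s q' * v x')) ∈ U :=
      blockTriangular_mul (blockTriangular_inv (blockTriangular_mul (hsU q) (hvU x)))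
        (blockTriangular_mul (hsU q') (hvU x'))
    -- The quotient is upper triangular, so it also lies in the stabilizer for `a`. As `v x` and `v
    -- x'` lie there too, the representatives `s q` and `s q'` define the same coset.
    have h2 := stabilizerCoset_of_add hn0 hb hUT h1
    have h3 : (s q)⁻¹ * s q' ∈ stabilizerCoset n p a := by
      have := mul_mem (mul_mem (hva x) h2) (inv_mem (hva x'))
      simpa [mul_assoc] using this
    have hq : q = q' := Subtype.ext (by rw [← hs q, ← hs q']; exact QuotientGroup.eq.mpr h3)
    subst hq
    have h4 : (v x)⁻¹ * v x' ∈ stabilizerCoset n p (a + b) := by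
      simpa [mul_assoc] using h1
    simp only [v] at h4
    rw [P.unip_inv_mul, P.unip_mem_stabilizerCoset hn0, ← mul_sub, ← mul_sub] at h4
    have hp := one_lt_cast p
    have e1 : (a + b) P.i - (a + b) P.j = (a P.i - a P.j) + (b P.i - b P.j) := by
      simp only [Pi.add_apply]; ring
    have e2 : (a + b) P.i' - (a + b) P.j' = (a P.i' - a P.j') + (b P.i' - b P.j') := by
      simp only [Pi.add_apply]; ring
    rw [e1, e2, zpow_add₀ (by positivity), zpow_add₀ (by positivity), ← mul_assoc, ← mul_assoc,
      norm_pow_mul_natCast_mul_le p hd, norm_pow_mul_natCast_mul_le p hd'] at h4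
    have x1 := eq_of_norm_sub_mul_zpow_le p (sub_pos.mpr hP) x'.1.2 x.1.2 h4.1
    have x2 := eq_of_norm_sub_mul_zpow_le p (sub_pos.mpr hP') x'.2.2 x.2.2 h4.2
    exact Prod.ext rfl (Prod.ext (Fin.ext x1.symm) (Fin.ext x2.symm))

end RootElements

/-! ### Intersections of double cosets with translates -/

section Intersection

open scoped Pointwise

variable {n : ℕ} {p : Primes}

theorem genericSet_rightInvariant (a : Fin n → ℤ) :
    RightInvariant (localK n p) (genericSet n p a) := by
  rintro g ⟨u, hu, k, hk, rfl⟩ k' hk'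
  exact ⟨u, hu, k * k', mul_mem hk hk', by rw [mul_assoc]⟩

theorem cell_eq_of_mem {a c : Fin n → ℤ} {g : PGL n ℚ_[p]} (ha : g ∈ cell n p a)
    (hc : g ∈ cell n p c) : cell n p a = cell n p c := by
  rw [cell, cell, ← DoubleCoset.doubleCoset_eq_of_mem ha, ← DoubleCoset.doubleCoset_eq_of_mem hc]

theorem cosetCount_sdiff_genericSet (a : Fin n → ℤ) :
    cosetCount (localK n p) (cell n p a \ genericSet n p a) +
      cosetCount (localK n p) (genericSet n p a) ≤ cosetCount (localK n p) (cell n p a) := by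
  have hfin := finiteCosets_cell (p := p) a
  have h1 : FiniteCosets (localK n p) (cell n p a \ genericSet n p a) :=
    hfin.mono Set.sdiff_subset
  have h2 : FiniteCosets (localK n p) (genericSet n p a) := hfin.mono (genericSet_subset a)
  rw [cosetCount, cosetCount, ← Set.ncard_union_eq _ h1 h2, ← Set.image_union,
    Set.sdiff_union_of_subset (genericSet_subset a)]
  · rfl
  · rw [Set.disjoint_left]
    rintro _ ⟨g, hg, rfl⟩ ⟨g', hg', h⟩
    refine hg.2 ?_
    have := genericSet_rightInvariant a g' hg' _ (QuotientGroup.eq.mp h)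
    simpa using this

/-- If the intersection has no generic element, it lies in the exceptional proportion `n/p`. If it
contains `u p^a k`, then `p^(-b) u p^b` is integral because `b` is monotone and `u` upper
triangular. Hence `p^c` and `p^(a-b)` have the same double coset, and growth along the antitone `-b`
applies. -/
theorem inter_cell_alternative_of_monotone (hn : 3 ≤ n) {a b : Fin n → ℤ} (ha : Antitone a)
    (hb : Monotone b) (hne : ∃ i j, b i ≠ b j) (c : Fin n → ℤ) :
    (cosetCount (localK n p) (cell n p a ∩ cocharValue n p b • cell n p c) : ℝ) ≤
        (n : ℝ) / (p : ℕ) * cosetCount (localK n p) (cell n p a) ∨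
      ((p : ℕ) : ℝ) ^ 2 * ((1 - (n : ℝ) / (p : ℕ)) * cosetCount (localK n p) (cell n p a)) ≤
        cosetCount (localK n p) (cell n p c) := by
  have hn0 : 0 < n := by omega
  have hgen := le_cosetCount_genericSet (p := p) hn0 ha
  by_cases h : ∃ g ∈ genericSet n p a, g ∈ cocharValue n p b • cell n p c
  · right
    obtain ⟨g, ⟨u, hu, k, hk, rfl⟩, hg⟩ := h
    rw [Set.mem_smul_set_iff_inv_smul_mem, smul_eq_mul] at hg
    have hu' : (cocharValue n p b)⁻¹ * intToPGL n p u * cocharValue n p b ∈ localK n p := by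
      rw [conj_mem_localK_iff hn0]
      intro i j
      rcases lt_or_ge j i with hij | hij
      · rw [hu hij]
        simp
      · exact mul_le_one₀ (PadicInt.norm_le_one _)
          (zpow_nonneg (zero_le_one.trans (one_lt_cast p).le) _)
          (zpow_le_one_of_nonpos₀ (one_lt_cast p).le (sub_nonpos.mpr (hb hij)))
    have hcell : cell n p (a + -b) = cell n p c := by
      refine cell_eq_of_mem (mem_cell.mpr ⟨_, hu', k, hk, ?_⟩) hg
      rw [add_comm, cocharValue_add, cocharValue_neg]
      group
    have hb' : Antitone (-b) := hb.neg
    have h1 := sq_mul_cosetCount_genericSet_le (p := p) hn ha hb'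
      (by obtain ⟨i, j, hij⟩ := hne; exact ⟨i, j, fun h => hij (neg_injective h)⟩)
    have h2 := cosetCount_mono (genericSet_subset (p := p) (a + -b)) (finiteCosets_cell _)
    rw [hcell] at h2
    calc _ ≤ ((p : ℕ) : ℝ) ^ 2 * cosetCount (localK n p) (genericSet n p a) :=
          mul_le_mul_of_nonneg_left hgen (by positivity)
      _ ≤ _ := by exact_mod_cast h1.trans h2
  · left
    have hsub : cell n p a ∩ cocharValue n p b • cell n p c ⊆ cell n p a \ genericSet n p a :=
      fun g hg => ⟨hg.1, fun hg' => h ⟨g, hg', hg.2⟩⟩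
    have h1 := cosetCount_mono hsub ((finiteCosets_cell a).mono Set.sdiff_subset)
    have h2 := cosetCount_sdiff_genericSet (p := p) a
    have h3 : (cosetCount (localK n p) (cell n p a ∩ cocharValue n p b • cell n p c) : ℝ) +
        cosetCount (localK n p) (genericSet n p a) ≤ cosetCount (localK n p) (cell n p a) := by
      exact_mod_cast (Nat.add_le_add_right h1 _).trans h2
    linarith

/-- Permutation matrices lie in `K_p` and preserve both cells, so translating by one of them only
permutes the exponents of the torus element. -/
theorem cosetCount_inter_comp_perm (w : Equiv.Perm (Fin n)) (a b c : Fin n → ℤ) :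
    cosetCount (localK n p) (cell n p a ∩ cocharValue n p (b ∘ w) • cell n p c) =
      cosetCount (localK n p) (cell n p a ∩ cocharValue n p b • cell n p c) := by
  set k := intToPGL n p (permGL n p w)
  have hk : k ∈ localK n p := intToPGL_mem _
  rw [← cosetCount_smul (localK n p) k (cell n p a ∩ cocharValue n p b • cell n p c),
    Set.smul_set_inter, doubleCoset_smul _ _ hk, smul_smul, permGL_conj, ← smul_smul,
    doubleCoset_smul _ _ hk]

/-- The exponents `a` and `b` may be sorted independently: the cell does not see the order of `a`,
nor the count that of `b`. -/
theorem inter_cell_alternative (hn : 3 ≤ n) (a : Fin n → ℤ) {b : Fin n → ℤ}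
    (hne : ∃ i j, b i ≠ b j) (c : Fin n → ℤ) :
    (cosetCount (localK n p) (cell n p a ∩ cocharValue n p b • cell n p c) : ℝ) ≤
        (n : ℝ) / (p : ℕ) * cosetCount (localK n p) (cell n p a) ∨
      ((p : ℕ) : ℝ) ^ 2 * ((1 - (n : ℝ) / (p : ℕ)) * cosetCount (localK n p) (cell n p a)) ≤
        cosetCount (localK n p) (cell n p c) := by
  have ha : Antitone (a ∘ Tuple.sort (-a)) := by
    have := (Tuple.monotone_sort (-a)).neg
    intro i j hij
    simpa using this hij
  have hb := Tuple.monotone_sort b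
  have h := inter_cell_alternative_of_monotone (p := p) hn ha hb (by
    obtain ⟨i, j, hij⟩ := hne
    exact ⟨(Tuple.sort b).symm i, (Tuple.sort b).symm j, by simpa using hij⟩) c
  rw [cosetCount_inter_comp_perm, cell, doubleCoset_comp_perm] at h
  exact h

theorem cosetCount_inter_swap (a b c : Fin n → ℤ) :
    cosetCount (localK n p) (cell n p c ∩ cocharValue n p (-b) • cell n p a) =
      cosetCount (localK n p) (cell n p a ∩ cocharValue n p b • cell n p c) := by
  rw [← cosetCount_smul (localK n p) (cocharValue n p b), Set.smul_set_inter, smul_smul,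
    ← cocharValue_add, add_neg_cancel, cocharValue_zero, one_smul, Set.inter_comm]

/-- The dichotomy is applied to `(a, b, c)` and to `(c, -b, a)`. If both intersections are small,
the geometric mean of the two bounds gives the claim. If one cell is about `p^2` times larger than
the other, the trivial bound by the smaller cell already saves a factor of order `p`. -/
theorem cosetCount_inter_le (hn : 3 ≤ n) (a : Fin n → ℤ) {b : Fin n → ℤ}
    (hne : ∃ i j, b i ≠ b j) (c : Fin n → ℤ) :
    (cosetCount (localK n p) (cell n p a ∩ cocharValue n p b • cell n p c) : ℝ) ≤
      2 * n / (p : ℕ) * √(cosetCount (localK n p) (cell n p a) *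
        cosetCount (localK n p) (cell n p c)) := by
  have hne' : ∃ i j, (-b) i ≠ (-b) j := by
    obtain ⟨i, j, hij⟩ := hne
    exact ⟨i, j, fun h => hij (neg_injective h)⟩
  have h1 := inter_cell_alternative (p := p) hn a hne c
  have h2 := inter_cell_alternative (p := p) hn c hne' a
  rw [cosetCount_inter_swap] at h2
  have hNa : (cosetCount (localK n p) (cell n p a ∩ cocharValue n p b • cell n p c) : ℝ) ≤
      cosetCount (localK n p) (cell n p a) := by
    exact_mod_cast cosetCount_mono Set.inter_subset_left (finiteCosets_cell a)
  have hNc : (cosetCount (localK n p) (cell n p a ∩ cocharValue n p b • cell n p c) : ℝ) ≤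
      cosetCount (localK n p) (cell n p c) := by
    rw [← cosetCount_inter_swap]
    exact_mod_cast cosetCount_mono Set.inter_subset_left (finiteCosets_cell c)
  generalize (cosetCount (localK n p) (cell n p a ∩ cocharValue n p b • cell n p c) : ℝ) = N at *
  have hA0 : (0 : ℝ) ≤ cosetCount (localK n p) (cell n p a) := Nat.cast_nonneg _
  have hC0 : (0 : ℝ) ≤ cosetCount (localK n p) (cell n p c) := Nat.cast_nonneg _
  generalize (cosetCount (localK n p) (cell n p a) : ℝ) = A at *
  generalize (cosetCount (localK n p) (cell n p c) : ℝ) = C at *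
  have hp := one_lt_cast p
  have hnR : (3 : ℝ) ≤ n := by exact_mod_cast hn
  generalize ((p : ℕ) : ℝ) = q at *
  have hq0 : 0 < q := by linarith
  rcases le_or_gt N 0 with hN0 | hN0
  · exact hN0.trans (by positivity)
  have hbase : ∀ t : ℝ, 0 ≤ t → N ^ 2 ≤ t ^ 2 * (A * C) → N ≤ t * √(A * C) := fun t ht h => by
    refine le_of_sq_le_sq ?_ (by positivity)
    rwa [mul_pow, Real.sq_sqrt (by positivity)]
  refine hbase _ (by positivity) ?_
  have hNAC : N ^ 2 ≤ A * C := by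
    rw [sq]
    exact mul_le_mul hNa hNc hN0.le hA0
  -- For `q ≤ 2n` the constant `2n/q` is at least `1` and the trivial bound suffices; for larger `q`
  -- the factor `1 - n/q` is at least `1/2`.
  rcases le_or_gt q (2 * n) with hq | hq
  · refine hNAC.trans (le_mul_of_one_le_left (by positivity) ?_)
    exact one_le_pow₀ ((one_le_div hq0).mpr hq)
  · have hhalf : (1 : ℝ) / 2 ≤ 1 - n / q := by
      have : (n : ℝ) / q ≤ 1 / 2 := by
        rw [div_le_div_iff₀ hq0 two_pos]
        linarith
      linarith
    have hsq : (2 * (n : ℝ) / q) ^ 2 = 4 * n ^ 2 / q ^ 2 := by ring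
    have hstep : ∀ X Y : ℝ, 0 ≤ X → 0 ≤ Y → N ≤ X → q ^ 2 * ((1 - n / q) * X) ≤ Y →
        N ^ 2 ≤ (2 * (n : ℝ) / q) ^ 2 * (X * Y) := fun X Y hX hY hNX h => by
      have h3 : q ^ 2 * (1 / 2 * X) ≤ Y :=
        (mul_le_mul_of_nonneg_left (mul_le_mul_of_nonneg_right hhalf hX) (sq_nonneg q)).trans h
      have h4 : N ^ 2 ≤ X ^ 2 := pow_le_pow_left₀ hN0.le hNX 2
      rw [hsq, div_mul_eq_mul_div, le_div_iff₀ (by positivity)]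
      have h5 : X * (q ^ 2 * (1 / 2 * X)) ≤ X * Y := mul_le_mul_of_nonneg_left h3 hX
      have h6 : (2 : ℝ) ≤ 4 * n ^ 2 := by nlinarith
      have h7 : 2 * (X * Y) ≤ 4 * n ^ 2 * (X * Y) :=
        mul_le_mul_of_nonneg_right h6 (mul_nonneg hX hY)
      have h8 : N ^ 2 * q ^ 2 ≤ X ^ 2 * q ^ 2 := mul_le_mul_of_nonneg_right h4 (sq_nonneg q)
      linarith
    rcases h1 with h1 | h1
    · rcases h2 with h2 | h2
      · have h3 : N ^ 2 ≤ (n / q * A) * (n / q * C) := by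
          rw [sq]
          exact mul_le_mul h1 h2 hN0.le (by positivity)
        refine h3.trans ?_
        have h4 : (n / q * A) * (n / q * C) = (n / q) ^ 2 * (A * C) := by ring
        rw [h4]
        refine mul_le_mul_of_nonneg_right (pow_le_pow_left₀ (by positivity) ?_ 2) (by positivity)
        exact div_le_div_of_nonneg_right (by linarith) hq0.le
      · rw [mul_comm A C]
        exact hstep C A hC0 hA0 hNc h2
    · exact hstep A C hA0 hC0 hNa h1

end Intersection

/-! ### Bounded elements of the local group -/

section Bounded

open scoped Pointwise

variable {n : ℕ} {p : Primes}

/-- The set of `g` represented by an integral matrix `A` such that `p^D A⁻¹` is integral. -/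
def boundedSet (n : ℕ) (p : Primes) (D : ℕ) : Set (PGL n ℚ_[p]) :=
  {g | ∃ A : GL (Fin n) ℚ_[p], Matrix.ProjGenLinGroup.mk A = g ∧
    ∀ i j, ‖(A : Matrix (Fin n) (Fin n) ℚ_[p]) i j‖ ≤ 1 ∧
      ‖((A⁻¹ : GL (Fin n) ℚ_[p]) : Matrix (Fin n) (Fin n) ℚ_[p]) i j‖ ≤ ((p : ℕ) : ℝ) ^ D}

theorem localK_subset_boundedSet : (localK n p : Set (PGL n ℚ_[p])) ⊆ boundedSet n p 0 := by
  rintro _ ⟨k, rfl⟩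
  exact ⟨_, rfl, by simpa using (mem_range_map_iff n p _).mp ⟨k, rfl⟩⟩

theorem norm_mul_apply_le {A B : Matrix (Fin n) (Fin n) ℚ_[p]} {s t : ℝ} (hs : 0 ≤ s) (ht : 0 ≤ t)
    (hA : ∀ i j, ‖A i j‖ ≤ s) (hB : ∀ i j, ‖B i j‖ ≤ t) (i j : Fin n) :
    ‖(A * B) i j‖ ≤ s * t := by
  rw [Matrix.mul_apply]
  refine IsUltrametricDist.norm_sum_le_of_forall_le_of_nonneg (mul_nonneg hs ht) fun k _ => ?_
  rw [norm_mul]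
  exact mul_le_mul (hA i k) (hB k j) (norm_nonneg _) hs

theorem mul_mem_boundedSet {D D' : ℕ} {g g' : PGL n ℚ_[p]} (hg : g ∈ boundedSet n p D)
    (hg' : g' ∈ boundedSet n p D') : g * g' ∈ boundedSet n p (D + D') := by
  obtain ⟨A, rfl, hA⟩ := hg
  obtain ⟨B, rfl, hB⟩ := hg'
  refine ⟨A * B, map_mul _ _ _, fun i j => ⟨?_, ?_⟩⟩
  · have := norm_mul_apply_le zero_le_one zero_le_one (fun i j => (hA i j).1)
      (fun i j => (hB i j).1) i j
    rwa [mul_one] at this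
  · rw [mul_inv_rev, add_comm, pow_add]
    exact norm_mul_apply_le (by positivity) (by positivity) (fun i j => (hB i j).2)
      (fun i j => (hA i j).2) i j

theorem norm_uniformizer (p : Primes) : ‖(uniformizer p : ℚ_[p])‖ = ((p : ℕ) : ℝ)⁻¹ := by
  simp [uniformizer]

theorem inv_mem_boundedSet {D : ℕ} {g : PGL n ℚ_[p]} (hg : g ∈ boundedSet n p D) :
    g⁻¹ ∈ boundedSet n p D := by
  obtain ⟨A, rfl, hA⟩ := hg
  have hp : (0 : ℝ) < (p : ℕ) := zero_lt_one.trans (one_lt_cast p)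
  -- The matrix `p^D A⁻¹` is integral and represents the inverse class.
  refine ⟨A⁻¹ * Matrix.GeneralLinearGroup.scalar (Fin n) (uniformizer p ^ D), ?_, fun i j => ?_⟩
  · rw [map_mul, Matrix.ProjGenLinGroup.mk_scalar, mul_one, map_inv]
  · have h1 := hA i j
    rw [mul_inv_rev, inv_inv, ← map_inv]
    simp only [Matrix.GeneralLinearGroup.coe_mul, Matrix.GeneralLinearGroup.coe_scalar,
      Matrix.scalar_apply, Matrix.mul_diagonal, Matrix.diagonal_mul, norm_mul]
    rw [Units.val_inv_eq_inv_val, norm_inv, Units.val_pow_eq_pow_val, norm_pow, norm_uniformizer,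
      inv_pow, inv_inv]
    exact ⟨by rw [mul_inv_le_iff₀ (by positivity), one_mul]; exact h1.2,
      mul_le_of_le_one_right (by positivity) h1.1⟩

theorem cocharValue_mem_boundedSet {D : ℕ} {a : Fin n → ℤ} (ha : ∀ i j, a i - a j ≤ D) :
    cocharValue n p a ∈ boundedSet n p D := by
  have hp := one_lt_cast p
  rcases Nat.eq_zero_or_pos n with rfl | hn
  · exact ⟨_, rfl, fun i => i.elim0⟩
  have : Nonempty (Fin n) := ⟨⟨0, hn⟩⟩
  obtain ⟨i₀, hi₀⟩ := Finite.exists_min a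
  -- Subtracting the minimum puts all exponents into `[0, D]` without changing the class.
  have h1 : cocharValue n p a = cocharValue n p (a + fun _ => -a i₀) := by
    rw [cocharValue_add, cocharValue_const, mul_one]
  rw [h1]
  refine ⟨_, rfl, fun i j => ?_⟩
  rw [← map_inv]
  by_cases hij : i = j
  · subst hij
    simp only [diagGL_apply, Matrix.diagonal_apply_eq, Pi.inv_apply]
    rw [norm_uniformizer_zpow, ← zpow_neg, norm_uniformizer_zpow, neg_neg, ← zpow_natCast]
    refine ⟨zpow_le_one_of_nonpos₀ hp.le ?_, zpow_le_zpow_right₀ hp.le ?_⟩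
    · have := hi₀ i
      simp only [Pi.add_apply]
      omega
    · have := ha i i₀
      simp only [Pi.add_apply]
      omega
  · simp only [diagGL_apply, Matrix.diagonal_apply_ne _ hij, norm_zero]
    exact ⟨zero_le_one, by positivity⟩

/-- The unknown scalar relating the bounded representative to `diag(d)` cancels between the bound
for the entry `(i, i)` and the bound for the entry `(j, j)` of the inverse. -/
theorem norm_le_of_diag_mem_boundedSet {D : ℕ} {d : Fin n → ℚ_[p]ˣ}
    (h : Matrix.ProjGenLinGroup.mk (diagGL n ℚ_[p] d) ∈ boundedSet n p D) (i j : Fin n) :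
    ‖(d i : ℚ_[p])‖ ≤ ((p : ℕ) : ℝ) ^ D * ‖(d j : ℚ_[p])‖ := by
  obtain ⟨A, hA, hb⟩ := h
  obtain ⟨u, rfl⟩ := Matrix.ProjGenLinGroup.mk_eq_mk_iff.mp hA.symm
  have h1 := (hb i i).1
  have h2 := (hb j j).2
  rw [mul_inv_rev, ← map_inv, ← map_inv] at h2
  simp only [Matrix.GeneralLinearGroup.coe_mul, Matrix.GeneralLinearGroup.coe_scalar,
    Matrix.scalar_apply, Matrix.mul_diagonal, norm_mul, diagGL_apply,
    Matrix.diagonal_apply_eq, Pi.inv_apply, Units.val_inv_eq_inv_val, norm_inv] at h1 h2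
  have hu : 0 < ‖(u : ℚ_[p])‖ := norm_pos_iff.mpr u.ne_zero
  have hd : 0 < ‖(d j : ℚ_[p])‖ := norm_pos_iff.mpr (d j).ne_zero
  rw [← mul_inv, inv_le_iff_one_le_mul₀ (by positivity)] at h2
  refine le_of_mul_le_mul_right ?_ hu
  calc _ ≤ 1 := h1
    _ ≤ _ := h2
    _ = _ := by ring

theorem sub_le_of_cocharValue_mem_boundedSet {D : ℕ} {b : Fin n → ℤ}
    (h : cocharValue n p b ∈ boundedSet n p D) (i j : Fin n) : b i - b j ≤ D := by
  have hp := one_lt_cast p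
  have h1 := norm_le_of_diag_mem_boundedSet h j i
  rw [norm_uniformizer_zpow, norm_uniformizer_zpow, ← zpow_natCast, ← zpow_add₀ (by positivity),
    zpow_le_zpow_iff_right₀ hp] at h1
  omega

theorem eq_of_cocharValue_mem_localK {b : Fin n → ℤ} (h : cocharValue n p b ∈ localK n p)
    (i j : Fin n) : b i = b j := by
  have h1 := sub_le_of_cocharValue_mem_boundedSet (localK_subset_boundedSet h) i j
  have h2 := sub_le_of_cocharValue_mem_boundedSet (localK_subset_boundedSet h) j i
  push_cast at h1 h2
  omega

theorem cell_subset_boundedSet {D : ℕ} {a : Fin n → ℤ} (ha : ∀ i j, a i - a j ≤ D) :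
    cell n p a ⊆ boundedSet n p D := by
  intro g hg
  obtain ⟨k, hk, k', hk', rfl⟩ := mem_cell.mp hg
  have := mul_mem_boundedSet (mul_mem_boundedSet (localK_subset_boundedSet hk)
    (cocharValue_mem_boundedSet (p := p) ha)) (localK_subset_boundedSet hk')
  rwa [zero_add, add_zero] at this

/-- For `g` in the intersection, `p^b = g (p^(-b) g)⁻¹` is a product of two bounded elements. Hence
only finitely many `b`, up to constants, matter in the torus integral. -/
theorem sub_le_of_inter_nonempty {D : ℕ} {a b c : Fin n → ℤ} (ha : ∀ i j, a i - a j ≤ D)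
    (hc : ∀ i j, c i - c j ≤ D)
    (h : (cell n p a ∩ cocharValue n p b • cell n p c).Nonempty) (i j : Fin n) :
    b i - b j ≤ (D + D : ℕ) := by
  obtain ⟨g, hg, hg'⟩ := h
  rw [Set.mem_smul_set_iff_inv_smul_mem, smul_eq_mul] at hg'
  refine sub_le_of_cocharValue_mem_boundedSet (p := p) ?_ i j
  have := mul_mem_boundedSet (cell_subset_boundedSet ha hg)
    (inv_mem_boundedSet (cell_subset_boundedSet hc hg'))
  simpa using this

/-- The norm of a cocharacter bounds the differences of its coordinates. -/
theorem sub_le_cocharNorm (a : Fin n → ℤ) (i j : Fin n) :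
    ((a i : ℝ) - a j) ≤ 2 * cocharNorm n a := by
  rcases Nat.eq_zero_or_pos n with rfl | hn
  · exact i.elim0
  -- For the decreasing order all summands are nonnegative, and one of them is the largest
  -- difference of coordinates (if `n > 1`).
  let w := Tuple.sort (-a)
  have ha : Antitone (a ∘ w) := by
    have := (Tuple.monotone_sort (-a)).neg
    intro i j hij
    simpa using this hij
  let z : Fin n := ⟨0, hn⟩
  let l : Fin n := ⟨n - 1, by omega⟩
  have hz : ∀ i, z ≤ i := fun i => by simp [z, Fin.le_def]
  have hl : ∀ i, i ≤ l := fun i => by simp only [l, Fin.le_def]; omega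
  have h1 : (1 / 2 : ℝ) * ∑ i, ∑ j ∈ Finset.Ioi i, ((a (w i) : ℝ) - a (w j)) ≤ cocharNorm n a :=
    Finset.le_sup' (f := fun w : Equiv.Perm (Fin n) =>
      (1 / 2 : ℝ) * ∑ i, ∑ j ∈ Finset.Ioi i, ((a (w i) : ℝ) - a (w j))) (Finset.mem_univ w)
  have hnn : ∀ i, ∀ j ∈ Finset.Ioi i, (0 : ℝ) ≤ (a (w i) : ℝ) - a (w j) := fun i j hj => by
    have : a (w j) ≤ a (w i) := ha (Finset.mem_Ioi.mp hj).le
    rw [sub_nonneg]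
    exact_mod_cast this
  have h2 : (a (w z) : ℝ) - a (w l) ≤ ∑ i, ∑ j ∈ Finset.Ioi i, ((a (w i) : ℝ) - a (w j)) := by
    rcases (hz l).eq_or_lt with h | h
    · rw [← h, sub_self]
      exact Finset.sum_nonneg fun i _ => Finset.sum_nonneg (hnn i)
    · exact (Finset.single_le_sum (f := fun j => (a (w z) : ℝ) - a (w j)) (hnn z)
        (Finset.mem_Ioi.mpr h)).trans
        (Finset.single_le_sum (f := fun i => ∑ j ∈ Finset.Ioi i, ((a (w i) : ℝ) - a (w j)))
          (fun i _ => Finset.sum_nonneg (hnn i)) (Finset.mem_univ z))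
  have h3 : a i ≤ a (w z) := by
    have := ha (hz (w.symm i))
    simpa using this
  have h4 : a (w l) ≤ a j := by
    have := ha (hl (w.symm j))
    simpa using this
  have h3' : (a i : ℝ) ≤ a (w z) := by exact_mod_cast h3
  have h4' : (a (w l) : ℝ) ≤ a j := by exact_mod_cast h4
  linarith

end Bounded

/-! ### Representatives -/

section Representatives

open scoped Pointwise

variable {n : ℕ} {p : Primes}

/-- The exponents `b` with `b_0 = 0` and `|b_i| ≤ D`. -/
def exponentBox (n D : ℕ) : Finset (Fin n → ℤ) :=
  Fintype.piFinset fun i => if (i : ℕ) = 0 then {0} else Finset.Icc (-(D : ℤ)) D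

theorem card_exponentBox_le (n D : ℕ) : (exponentBox n D).card ≤ (2 * D + 1) ^ n := by
  rw [exponentBox, Fintype.card_piFinset]
  calc _ ≤ ∏ _i : Fin n, (2 * D + 1) := Finset.prod_le_prod' fun i _ => by
        split_ifs
        · simp
        · rw [Int.card_Icc]
          omega
    _ = _ := by simp

theorem mem_exponentBox (hn : 0 < n) {D : ℕ} {b : Fin n → ℤ} :
    b ∈ exponentBox n D ↔ b ⟨0, hn⟩ = 0 ∧ ∀ i, -(D : ℤ) ≤ b i ∧ b i ≤ D := by
  rw [exponentBox, Fintype.mem_piFinset]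
  constructor
  · intro h
    refine ⟨by simpa using h ⟨0, hn⟩, fun i => ?_⟩
    have := h i
    split_ifs at this
    · rw [Finset.mem_singleton] at this
      omega
    · simpa using this
  · rintro ⟨h0, h⟩ i
    split_ifs with hi
    · have : i = ⟨0, hn⟩ := Fin.ext hi
      rw [this, h0]
      simp
    · simpa using h i

theorem eq_zero_of_mem_exponentBox (hn : 0 < n) {D : ℕ} {b : Fin n → ℤ}
    (hb : b ∈ exponentBox n D) (h : cocharValue n p b ∈ localK n p) : b = 0 := by
  funext i
  rw [eq_of_cocharValue_mem_localK h i ⟨0, hn⟩, ((mem_exponentBox hn).mp hb).1]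
  rfl

theorem eq_of_mem_exponentBox (hn : 0 < n) {D : ℕ} {b c : Fin n → ℤ}
    (hb : b ∈ exponentBox n D) (hc : c ∈ exponentBox n D)
    (h : (cocharValue n p b)⁻¹ * cocharValue n p c ∈ localK n p) : b = c := by
  rw [← cocharValue_neg, ← cocharValue_add] at h
  funext i
  have h1 := eq_of_cocharValue_mem_localK h i ⟨0, hn⟩
  have h2 := ((mem_exponentBox hn).mp hb).1
  have h3 := ((mem_exponentBox hn).mp hc).1
  simp only [Pi.add_apply, Pi.neg_apply] at h1
  omega

/-- Every element of the torus is `diag(p^b)` with `b_0 = 0`, up to `H_p ∩ K_p`. -/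
theorem exists_exponent (hn : 0 < n) {h : PGL n ℚ_[p]} (hh : h ∈ localH n p) :
    ∃ b : Fin n → ℤ, b ⟨0, hn⟩ = 0 ∧ (cocharValue n p b)⁻¹ * h ∈ localK n p := by
  obtain ⟨d, rfl⟩ := hh
  let v : Fin n → ℤ := fun i => (d i : ℚ_[p]).valuation
  refine ⟨v + fun _ => -v ⟨0, hn⟩, by simp, ?_⟩
  rw [cocharValue_add, cocharValue_const, mul_one, ← cocharValue_neg]
  change Matrix.ProjGenLinGroup.mk (diagGL n ℚ_[p] _ * diagGL n ℚ_[p] d) ∈ _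
  have hp := one_lt_cast p
  have hnorm : ∀ i, ‖(((uniformizer p ^ (-v) i * d i : ℚ_[p]ˣ)) : ℚ_[p])‖ = 1 := fun i => by
    rw [Units.val_mul, norm_mul, norm_uniformizer_zpow, Padic.norm_eq_zpow_neg_valuation
      (d i).ne_zero, ← zpow_add₀ (by positivity)]
    simp [v]
  rw [← map_mul, mk_mem_localK_iff hn]
  · intro i j
    by_cases hij : i = j
    · subst hij
      rw [diagGL_apply, Matrix.diagonal_apply_eq]
      exact (hnorm i).le
    · rw [diagGL_apply, Matrix.diagonal_apply_ne _ hij, norm_zero]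
      exact zero_le_one
  · rw [diagGL_apply, Matrix.det_diagonal, norm_prod]
    exact Finset.prod_eq_one fun i _ => hnorm i

theorem cocharValue_mem_localH (b : Fin n → ℤ) : cocharValue n p b ∈ localH n p := ⟨_, rfl⟩

open scoped Classical in
/-- The number of cosets in the intersections of a double coset with the torus translates of
another one. -/
theorem sum_cosetCount_inter_le (hn : 3 ≤ n) (D : ℕ) (a c : Fin n → ℤ) :
    ∑ b ∈ exponentBox n D,
      (cosetCount (localK n p) (cell n p a ∩ cocharValue n p b • cell n p c) : ℝ) ≤
      ((if cell n p a = cell n p c then 1 else 0) +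
        (2 * D + 1) ^ n * (2 * n) / (p : ℕ)) *
      √(cosetCount (localK n p) (cell n p a) * cosetCount (localK n p) (cell n p c)) := by
  have hn0 : 0 < n := by omega
  set S := √((cosetCount (localK n p) (cell n p a) : ℝ) * cosetCount (localK n p) (cell n p c))
  have hS : 0 ≤ S := Real.sqrt_nonneg _
  have hp := one_lt_cast p
  have hterm : ∀ b ∈ exponentBox n D,
      (cosetCount (localK n p) (cell n p a ∩ cocharValue n p b • cell n p c) : ℝ) ≤
      (if b = 0 then (if cell n p a = cell n p c then 1 else 0) * S else 0) +
        2 * n / (p : ℕ) * S := by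
    intro b hb
    have hpos : 0 ≤ 2 * n / ((p : ℕ) : ℝ) * S := by positivity
    -- For `b = 0` the cells are equal or disjoint, which produces the identity matrix. Every other
    -- `b` in the box is nonconstant because its entry at `0` vanishes.
    by_cases h0 : b = 0
    · subst h0
      rw [if_pos rfl, cocharValue_zero, one_smul]
      by_cases hac : cell n p a = cell n p c
      · rw [if_pos hac, one_mul]
        have : S = cosetCount (localK n p) (cell n p a) := by
          simp only [S]
          rw [← hac, Real.sqrt_mul_self (Nat.cast_nonneg _)]
        rw [← hac, Set.inter_self, this]
        rw [this] at hpos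
        linarith
      · rw [if_neg hac]
        have : cell n p a ∩ cell n p c = ∅ := by
          rw [Set.eq_empty_iff_forall_notMem]
          exact fun g hg => hac (cell_eq_of_mem hg.1 hg.2)
        rw [this, cosetCount_empty]
        simpa using hpos
    · rw [if_neg h0, zero_add]
      refine cosetCount_inter_le hn a ?_ c
      by_contra hcon
      push Not at hcon
      refine h0 (funext fun i => ?_)
      rw [hcon i ⟨0, hn0⟩, ((mem_exponentBox hn0).mp hb).1]
      rfl
  refine (Finset.sum_le_sum hterm).trans ?_
  rw [Finset.sum_add_distrib, Finset.sum_const, nsmul_eq_mul, Finset.sum_ite_eq', add_mul]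
  refine add_le_add ?_ ?_
  · split_ifs <;> simp [hS]
  · have h1 : ((exponentBox n D).card : ℝ) ≤ (2 * D + 1) ^ n := by
      exact_mod_cast card_exponentBox_le n D
    calc _ ≤ (2 * (D : ℝ) + 1) ^ n * (2 * n / (p : ℕ) * S) :=
          mul_le_mul_of_nonneg_right h1 (by positivity)
      _ = _ := by ring

/-- The intersection is empty unless `p^b ∈ K_p`, which forces `b = 0`. The absence of an error term
is essential: an error of order `1/p` here, at every prime up to `M`, would cost a power of `log M`.
-/
theorem sum_cosetCount_inter_localK_le (hn : 0 < n) (D : ℕ) :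
    ∑ b ∈ exponentBox n D, (cosetCount (localK n p)
      ((localK n p : Set (PGL n ℚ_[p])) ∩ cocharValue n p b • (localK n p : Set _)) : ℝ) ≤ 1 := by
  classical
  calc _ ≤ ∑ b ∈ exponentBox n D, if b = 0 then (1 : ℝ) else 0 := by
        refine Finset.sum_le_sum fun b hb => ?_
        by_cases h0 : b = 0
        · rw [if_pos h0, h0, cocharValue_zero, one_smul, Set.inter_self, cosetCount_self]
          simp
        · rw [if_neg h0]
          have : (localK n p : Set (PGL n ℚ_[p])) ∩ cocharValue n p b • (localK n p : Set _) = ∅ := by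
            rw [Set.eq_empty_iff_forall_notMem]
            rintro g ⟨hg, hg'⟩
            rw [Set.mem_smul_set_iff_inv_smul_mem, smul_eq_mul] at hg'
            refine h0 (eq_zero_of_mem_exponentBox (p := p) hn hb ?_)
            have := mul_mem (SetLike.mem_coe.mp hg) (inv_mem (SetLike.mem_coe.mp hg'))
            simpa using this
          rw [this, cosetCount_empty]
          simp
    _ ≤ 1 := by
        rw [Finset.sum_ite_eq']
        split_ifs <;> norm_num

end Representatives

/-! ### A weighted Schur test for tensor products -/

section Schur

variable {ι : Type*} [Fintype ι] {α : ι → Type*}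

open scoped Classical in
/-- The majorant of the local matrix coefficients: the trivial entry is `1`, all other entries
differ from those of the identity matrix by `ε`. -/
def schurKernel {β : Type*} (o : β) (ε : ℝ) (x y : β) : ℝ :=
  if x = o ∧ y = o then 1 else (if x = y then 1 else 0) + ε

theorem schurKernel_comm {β : Type*} (o : β) (ε : ℝ) (x y : β) :
    schurKernel o ε x y = schurKernel o ε y x := by
  grind [schurKernel]

theorem schurKernel_nonneg {β : Type*} (o : β) {ε : ℝ} (hε : 0 ≤ ε) (x y : β) :
    0 ≤ schurKernel o ε x y := by
  unfold schurKernel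
  split_ifs <;> linarith

-- In the row of `o` every off-diagonal entry gains the factor `w`. In any other row the worst entry
-- is the column of `o`, where division by `w` gives `ε / w`.
open scoped Classical in
theorem schurKernel_row_le {β : Type*} (Λ : Finset β) (o : β) {ε w B : ℝ} (hε : 0 ≤ ε) (hw : 0 < w)
    (hw1 : w ≤ 1) (hB : (Λ.card : ℝ) ≤ B) (x : β) :
    ∑ y ∈ Λ, schurKernel o ε x y * ((if y = o then 1 else w) / (if x = o then 1 else w)) ≤
      if x = o then 1 + B * (ε * w) else 1 + B * (ε / w) := by
  have hdelta : ∑ y ∈ Λ, (if x = y then (1 : ℝ) else 0) ≤ 1 := by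
    rw [Finset.sum_ite_eq]
    split_ifs <;> norm_num
  have hεw : ε ≤ ε / w := le_div_self hε hw hw1
  have main : ∀ η : ℝ, 0 ≤ η →
      (∀ y, schurKernel o ε x y * ((if y = o then 1 else w) / (if x = o then 1 else w)) ≤
        (if x = y then 1 else 0) + η) →
      ∑ y ∈ Λ, schurKernel o ε x y * ((if y = o then 1 else w) / (if x = o then 1 else w)) ≤
        1 + B * η := by
    intro η hη h
    refine (Finset.sum_le_sum fun y _ => h y).trans ?_
    rw [Finset.sum_add_distrib, Finset.sum_const, nsmul_eq_mul]
    exact add_le_add hdelta (mul_le_mul_of_nonneg_right hB hη)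
  by_cases hx : x = o
  · refine (main (ε * w) (by positivity) fun y => ?_).trans_eq (if_pos hx).symm
    rw [if_pos hx, div_one, schurKernel]
    by_cases hy : y = o
    · rw [if_pos ⟨hx, hy⟩, if_pos hy, if_pos (hx.trans hy.symm)]
      have : 0 ≤ ε * w := by positivity
      linarith
    · have hxy : ¬ x = y := fun h => hy (h.symm.trans hx)
      rw [if_neg (fun h => hy h.2), if_neg hy, if_neg hxy, zero_add, zero_add]
  · refine (main (ε / w) (by positivity) fun y => ?_).trans_eq (if_neg hx).symm
    rw [if_neg hx, schurKernel, if_neg (fun h => hx h.1)]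
    by_cases hy : y = o
    · have hxy : ¬ x = y := fun h => hx (h.trans hy)
      rw [if_pos hy, if_neg hxy, zero_add, zero_add, mul_one_div]
    · rw [if_neg hy, div_self hw.ne', mul_one]
      linarith

-- Schur's test with the product weight `W`: a weighted arithmetic-geometric inequality bounds `f x
-- * f y` by `f x ^ 2 * (W y / W x)` and its mirror image, and the row sums then factor over `ι`.
-- Only rows with `f x ≠ 0` enter, which makes the support condition on `ω` usable.
open scoped Classical in
theorem sum_schurKernel_le [DecidableEq ι] (Λ : ∀ i, Finset (α i)) (o : ∀ i, α i) {ε w : ι → ℝ} {B R : ℝ}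
    (hε : ∀ i, 0 ≤ ε i) (hw : ∀ i, 0 < w i) (hw1 : ∀ i, w i ≤ 1)
    (hB : ∀ i, ((Λ i).card : ℝ) ≤ B) (f : (∀ i, α i) → ℝ)
    (hR : ∀ x, f x ≠ 0 →
      ∏ i, (if x i = o i then 1 + B * (ε i * w i) else 1 + B * (ε i / w i)) ≤ R) :
    ∑ x ∈ Fintype.piFinset Λ, ∑ y ∈ Fintype.piFinset Λ,
        f x * f y * ∏ i, schurKernel (o i) (ε i) (x i) (y i) ≤
      R * ∑ x ∈ Fintype.piFinset Λ, f x ^ 2 := by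
  set W : (∀ i, α i) → ℝ := fun x => ∏ i, if x i = o i then 1 else w i with hW
  have hWpos : ∀ x, 0 < W x := fun x => Finset.prod_pos fun i _ => by
    split_ifs
    exacts [one_pos, hw i]
  set S : (∀ i, α i) → (∀ i, α i) → ℝ := fun x y =>
    ∏ i, schurKernel (o i) (ε i) (x i) (y i) with hS
  have hS0 : ∀ x y, 0 ≤ S x y := fun x y =>
    Finset.prod_nonneg fun i _ => schurKernel_nonneg _ (hε i) _ _
  have hScomm : ∀ x y, S x y = S y x := fun x y =>
    Finset.prod_congr rfl fun i _ => schurKernel_comm _ _ _ _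
  have hrow : ∀ x, f x ≠ 0 → ∑ y ∈ Fintype.piFinset Λ, S x y * (W y / W x) ≤ R := by
    intro x hx
    refine le_trans ?_ (hR x hx)
    have h1 : ∀ y, S x y * (W y / W x) = ∏ i, (schurKernel (o i) (ε i) (x i) (y i) *
        ((if y i = o i then 1 else w i) / (if x i = o i then 1 else w i))) := fun y => by
      rw [Finset.prod_mul_distrib, Finset.prod_div_distrib]
    rw [Finset.sum_congr rfl fun y _ => h1 y]
    rw [← Finset.prod_univ_sum Λ (fun i z => schurKernel (o i) (ε i) (x i) z *
        ((if z = o i then 1 else w i) / (if x i = o i then 1 else w i)))]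
    refine Finset.prod_le_prod (fun i _ => Finset.sum_nonneg fun y _ => ?_) fun i _ =>
      schurKernel_row_le (Λ i) (o i) (hε i) (hw i) (hw1 i) (hB i) (x i)
    refine mul_nonneg (schurKernel_nonneg _ (hε i) _ _) (div_nonneg ?_ ?_)
    · split_ifs
      exacts [zero_le_one, (hw i).le]
    · split_ifs
      exacts [zero_le_one, (hw i).le]
  have hpoint : ∀ x y, f x * f y * S x y ≤
      (1 / 2) * (f x ^ 2 * (S x y * (W y / W x))) + (1 / 2) * (f y ^ 2 * (S y x * (W x / W y))) := by
    intro x y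
    rw [hScomm y x]
    have h2 : f x * f y ≤ 1 / 2 * (f x ^ 2 * (W y / W x)) + 1 / 2 * (f y ^ 2 * (W x / W y)) := by
      have h3 : f x ^ 2 * (W y / W x) + f y ^ 2 * (W x / W y) - 2 * (f x * f y) =
          (f x * W y - f y * W x) ^ 2 / (W x * W y) := by
        have hx := (hWpos x).ne'
        have hy := (hWpos y).ne'
        field_simp
        ring
      have h4 : 0 ≤ (f x * W y - f y * W x) ^ 2 / (W x * W y) :=
        div_nonneg (sq_nonneg _) (mul_pos (hWpos x) (hWpos y)).le
      linarith
    calc f x * f y * S x y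
        ≤ (1 / 2 * (f x ^ 2 * (W y / W x)) + 1 / 2 * (f y ^ 2 * (W x / W y))) * S x y :=
          mul_le_mul_of_nonneg_right h2 (hS0 x y)
      _ = _ := by ring
  set Q := ∑ x ∈ Fintype.piFinset Λ, ∑ y ∈ Fintype.piFinset Λ,
    f x ^ 2 * (S x y * (W y / W x)) with hQ
  have hQR : Q ≤ R * ∑ x ∈ Fintype.piFinset Λ, f x ^ 2 := by
    rw [hQ, Finset.mul_sum]
    refine Finset.sum_le_sum fun x _ => ?_
    rw [← Finset.mul_sum, mul_comm R]
    by_cases hx : f x = 0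
    · simp [hx]
    · exact mul_le_mul_of_nonneg_left (hrow x hx) (sq_nonneg _)
  refine le_trans ?_ hQR
  calc _ ≤ ∑ x ∈ Fintype.piFinset Λ, ∑ y ∈ Fintype.piFinset Λ,
        ((1 / 2) * (f x ^ 2 * (S x y * (W y / W x))) +
          (1 / 2) * (f y ^ 2 * (S y x * (W x / W y)))) :=
        Finset.sum_le_sum fun x _ => Finset.sum_le_sum fun y _ => hpoint x y
    _ = (1 / 2) * Q + (1 / 2) * ∑ x ∈ Fintype.piFinset Λ, ∑ y ∈ Fintype.piFinset Λ,
          f y ^ 2 * (S y x * (W x / W y)) := by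
        simp only [Finset.sum_add_distrib, ← Finset.mul_sum, hQ]
    _ = Q := by
        rw [Finset.sum_comm, ← hQ]
        ring

end Schur

/-! ### Products over primes -/

section PrimeSums

/-- Chebyshev's bound for the primes in a dyadic interval. -/
theorem sum_inv_primes_dyadic_le {k : ℕ} (hk : 0 < k) :
    ∑ p ∈ (Finset.Ioc (2 ^ k) (2 ^ (k + 1))).filter Nat.Prime, (1 : ℝ) / p ≤ 4 / k := by
  have hlog2 : 0 < Real.log 2 := Real.log_pos one_lt_two
  have hkR : (0 : ℝ) < k := by exact_mod_cast hk
  -- Since `log p ≥ k log 2` and `p > 2^k`, the sum is controlled by `θ(2^(k+1)) ≤ 2 log 2 ·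
  -- 2^(k+1)`; dividing by `2^k · k log 2` leaves `4/k`.
  have h1 : ∀ p ∈ (Finset.Ioc (2 ^ k) (2 ^ (k + 1))).filter Nat.Prime,
      (1 : ℝ) / p ≤ Real.log p * (1 / (2 ^ k * (k * Real.log 2))) := by
    intro p hp
    obtain ⟨hp1, -⟩ := Finset.mem_Ioc.mp (Finset.mem_filter.mp hp).1
    have hpR : (2 : ℝ) ^ k < p := by exact_mod_cast hp1
    have hl : k * Real.log 2 ≤ Real.log p := by
      rw [← Real.log_pow]
      exact Real.log_le_log (by positivity) hpR.le
    have hp0 : (0 : ℝ) < p := lt_trans (by positivity) hpR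
    rw [mul_one_div, div_le_div_iff₀ hp0 (by positivity), one_mul, mul_comm]
    exact mul_le_mul hl hpR.le (by positivity) (by positivity)
  refine (Finset.sum_le_sum h1).trans ?_
  rw [← Finset.sum_mul]
  have h2 : ∑ p ∈ (Finset.Ioc (2 ^ k) (2 ^ (k + 1))).filter Nat.Prime, Real.log p ≤
      Real.log 4 * 2 ^ (k + 1) := by
    have h3 := Chebyshev.theta_le_log4_mul_x (x := ((2 ^ (k + 1) : ℕ) : ℝ)) (Nat.cast_nonneg _)
    rw [Chebyshev.theta, Nat.floor_natCast] at h3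
    push_cast at h3
    refine le_trans (Finset.sum_le_sum_of_subset_of_nonneg ?_ fun p _ _ =>
      Real.log_natCast_nonneg p) h3
    intro p hp
    simp only [Finset.mem_filter, Finset.mem_Ioc] at hp ⊢
    exact ⟨⟨hp.2.pos, hp.1.2⟩, hp.2⟩
  refine (mul_le_mul_of_nonneg_right h2 (by positivity)).trans (le_of_eq ?_)
  have h4 : Real.log 4 = 2 * Real.log 2 := by
    rw [show (4 : ℝ) = 2 ^ 2 by norm_num, Real.log_pow]
    norm_num
  rw [h4, pow_succ]
  field_simp
  norm_num

/-- Summation of the dyadic bounds; the factor `8` comes from `4/k ≤ 8/(k+1)` for `k ≥ 1`. -/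
theorem sum_inv_primes_two_pow_le (k : ℕ) :
    ∑ p ∈ (Finset.Icc 1 (2 ^ k)).filter Nat.Prime, (1 : ℝ) / p ≤ 1 + 8 * (harmonic k : ℝ) := by
  induction k with
  | zero =>
    rw [pow_zero, Finset.Icc_self, Finset.filter_singleton, if_neg Nat.not_prime_one]
    simp
  | succ k ih =>
    have hsplit : (Finset.Icc 1 (2 ^ (k + 1))).filter Nat.Prime =
        (Finset.Icc 1 (2 ^ k)).filter Nat.Prime ∪
          (Finset.Ioc (2 ^ k) (2 ^ (k + 1))).filter Nat.Prime := by
      have : 2 ^ k ≤ 2 ^ (k + 1) := Nat.pow_le_pow_right two_pos (Nat.le_succ k)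
      rw [← Finset.filter_union]
      congr 1
      ext x
      have h1 : 1 ≤ 2 ^ k := Nat.one_le_two_pow
      simp only [Finset.mem_union, Finset.mem_Icc, Finset.mem_Ioc]
      omega
    have hle : ∑ p ∈ (Finset.Icc 1 (2 ^ (k + 1))).filter Nat.Prime, (1 : ℝ) / p ≤
        ∑ p ∈ (Finset.Icc 1 (2 ^ k)).filter Nat.Prime, (1 : ℝ) / p +
          ∑ p ∈ (Finset.Ioc (2 ^ k) (2 ^ (k + 1))).filter Nat.Prime, (1 : ℝ) / p := by
      rw [hsplit, ← Finset.sum_union_inter]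
      exact le_add_of_nonneg_right (Finset.sum_nonneg fun _ _ => by positivity)
    rw [harmonic_succ]
    push_cast
    rcases Nat.eq_zero_or_pos k with rfl | hk
    · refine hle.trans ?_
      have h2 : (Finset.Ioc (2 ^ 0) (2 ^ (0 + 1))).filter Nat.Prime ⊆ {2} := by
        intro x hx
        simp only [Finset.mem_filter, Finset.mem_Ioc, Finset.mem_singleton] at hx ⊢
        omega
      have h3 : ∑ p ∈ (Finset.Ioc (2 ^ 0) (2 ^ (0 + 1))).filter Nat.Prime, (1 : ℝ) / p ≤ 1 / 2 := by
        refine (Finset.sum_le_sum_of_subset_of_nonneg h2 fun _ _ _ => by positivity).trans ?_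
        simp
      have h4 : ((harmonic 0 : ℚ) : ℝ) = 0 := by simp
      rw [h4] at ih ⊢
      norm_num at ih h3 ⊢
      linarith
    · have h3 := sum_inv_primes_dyadic_le hk
      have hkR : (1 : ℝ) ≤ k := by exact_mod_cast hk
      have h5 : 4 / (k : ℝ) ≤ 8 * ((k : ℝ) + 1)⁻¹ := by
        rw [← div_eq_mul_inv, div_le_div_iff₀ (by positivity) (by positivity)]
        linarith
      linarith

/-- The upper half of Mertens' theorem, with `2^k` the first power of two reaching `y`. The harmonic
bound `1 + log k` turns `1 + 8 * harmonic k` into `9 + 8 log k`. -/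
theorem sum_inv_primes_le {y : ℝ} (hy : 1 ≤ y) (s : Finset ℕ) (hs : ∀ p ∈ s, p.Prime ∧ (p : ℝ) ≤ y) :
    ∑ p ∈ s, (1 : ℝ) / p ≤ 9 + 8 * Real.log (4 + 2 * Real.log y) := by
  have hlogy : 0 ≤ Real.log y := Real.log_nonneg hy
  set k := ⌈Real.log y / Real.log 2⌉₊ with hk
  have hlog2 : 1 / 2 < Real.log 2 := by linarith [Real.log_two_gt_d9]
  have hk1 : (k : ℝ) ≤ 2 * Real.log y + 1 := by
    refine (Nat.ceil_lt_add_one (by positivity)).le.trans ?_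
    have : Real.log y / Real.log 2 ≤ 2 * Real.log y := by
      rw [div_le_iff₀ (by linarith)]
      nlinarith
    linarith
  have hyk : y ≤ 2 ^ k := by
    have h1 : Real.log y ≤ k * Real.log 2 := by
      rw [← div_le_iff₀ (by linarith)]
      exact Nat.le_ceil _
    rw [← Real.log_pow] at h1
    exact (Real.log_le_log_iff (by linarith) (by positivity)).mp h1
  have hsub : s ⊆ (Finset.Icc 1 (2 ^ k)).filter Nat.Prime := by
    intro p hp
    obtain ⟨hp1, hp2⟩ := hs p hp
    rw [Finset.mem_filter, Finset.mem_Icc]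
    refine ⟨⟨hp1.pos, ?_⟩, hp1⟩
    exact_mod_cast hp2.trans hyk
  refine (Finset.sum_le_sum_of_subset_of_nonneg hsub fun _ _ _ => by positivity).trans
    ((sum_inv_primes_two_pow_le k).trans ?_)
  have h2 := harmonic_le_one_add_log k
  have h3 : Real.log k ≤ Real.log (4 + 2 * Real.log y) := by
    rcases Nat.eq_zero_or_pos k with h0 | h0
    · rw [h0, Nat.cast_zero, Real.log_zero]
      exact Real.log_nonneg (by linarith)
    · exact Real.log_le_log (by exact_mod_cast h0) (by linarith)
  linarith

/-- The Schur weights: `1` for primes up to `(log M)^2` and `p^{-1/2}` for larger primes. -/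
def primeWeight (M : ℝ) (p : ℕ) : ℝ :=
  if (p : ℝ) ≤ Real.log M ^ 2 then 1 else 1 / √(p : ℝ)

theorem primeWeight_pos (M : ℝ) {p : ℕ} (hp : p.Prime) : 0 < primeWeight M p := by
  have : (0 : ℝ) < p := by exact_mod_cast hp.pos
  unfold primeWeight
  split_ifs <;> positivity

theorem primeWeight_le_one (M : ℝ) {p : ℕ} (hp : p.Prime) : primeWeight M p ≤ 1 := by
  have : (1 : ℝ) ≤ p := by exact_mod_cast hp.one_lt.le
  unfold primeWeight
  split_ifs
  · exact le_rfl
  · rw [div_le_one (by positivity)]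
    exact Real.one_le_sqrt.mpr this

/-- Using `1 + t ≤ exp t`, three sums must be bounded. Primes up to `(log M)^2` give a Mertens sum
of size `log log log M`. Larger primes outside `Q` give a part of `∑ p^(-3/2)`. Each larger prime in
`Q` gives `p^(-1/2) ≤ 1/log M`, and `2^(#Q) ≤ M` allows at most `2 log M` of them. -/
theorem prod_primeWeight_le {K : ℝ} (hK : 0 ≤ K) : ∃ C A : ℝ, ∀ M : ℝ, 3 ≤ M →
    ∀ (ι : Type) [Fintype ι] (q : ι → ℕ), Function.Injective q → (∀ i, (q i).Prime) →
    ∀ (Q : ι → Prop) [DecidablePred Q], (∏ i, if Q i then (q i : ℝ) else 1) ≤ M →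
    ∏ i, (if Q i then 1 + K * (1 / (q i : ℝ) / primeWeight M (q i))
      else 1 + K * (1 / (q i : ℝ) * primeWeight M (q i))) ≤
      A * Real.log (Real.log M) ^ C := by
  have hsum : Summable fun m : ℕ => 1 / (m : ℝ) ^ (3 / 2 : ℝ) :=
    Real.summable_one_div_nat_rpow.mpr (by norm_num)
  set Z := ∑' m : ℕ, 1 / (m : ℝ) ^ (3 / 2 : ℝ) with hZ
  have hlog3 : 1 < Real.log 3 := by
    rw [Real.lt_log_iff_exp_lt (by norm_num)]
    exact Real.exp_one_lt_d9.trans (by norm_num)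
  set L₀ := Real.log (Real.log 3) with hL0
  have hL0pos : 0 < L₀ := Real.log_pos hlog3
  -- With `L = log log M ≥ L₀ > 0`, the Mertens sum is at most `9 + 8 log(4 + 4L)`, and `4 + 4L ≤
  -- (4/L₀ + 4) L` extracts a pure power of `L`.
  refine ⟨8 * K, Real.exp (K * (9 + Z + 2)) * (4 / L₀ + 4) ^ (8 * K), ?_⟩
  intro M hM ι _ q hq hprime Q _ hQ
  have hlogM : Real.log 3 ≤ Real.log M := Real.log_le_log (by norm_num) hM
  have hlogM1 : 1 < Real.log M := hlog3.trans_le hlogM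
  set L := Real.log (Real.log M) with hL
  have hLL : L₀ ≤ L := Real.log_le_log (by linarith) hlogM
  set y := Real.log M ^ 2 with hy
  have hy1 : 1 ≤ y := one_le_pow₀ hlogM1.le
  have hlogy : Real.log y = 2 * L := by
    rw [hy, Real.log_pow, ← hL]
    norm_num
  have hqpos : ∀ i, (0 : ℝ) < q i := fun i => by exact_mod_cast (hprime i).pos
  set g : ι → ℝ := fun i => (if (q i : ℝ) ≤ y then 1 / (q i : ℝ) else 0) +
    1 / (q i : ℝ) ^ (3 / 2 : ℝ) + (if Q i then 1 / Real.log M else 0) with hg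
  have hroot : ∀ i, 1 / (q i : ℝ) * (1 / √(q i : ℝ)) = 1 / (q i : ℝ) ^ (3 / 2 : ℝ) := fun i => by
    rw [Real.sqrt_eq_rpow, one_div_mul_one_div]
    congr 1
    rw [show (3 / 2 : ℝ) = 1 + 1 / 2 by norm_num, Real.rpow_add (hqpos i), Real.rpow_one]
  have hfac : ∀ i, (if Q i then 1 + K * (1 / (q i : ℝ) / primeWeight M (q i))
      else 1 + K * (1 / (q i : ℝ) * primeWeight M (q i))) ≤ Real.exp (K * g i) := by
    intro i
    have hpow : 0 ≤ 1 / (q i : ℝ) ^ (3 / 2 : ℝ) := by positivity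
    have hlg : 0 ≤ 1 / Real.log M := by positivity
    have hmain : ∀ t : ℝ, t ≤ g i → 1 + K * t ≤ Real.exp (K * g i) := fun t ht => by
      have h1 := Real.add_one_le_exp (K * g i)
      have h2 := mul_le_mul_of_nonneg_left ht hK
      linarith
    have hinv : 0 ≤ 1 / (q i : ℝ) := by positivity
    by_cases hyi : (q i : ℝ) ≤ y
    · have hw : primeWeight M (q i) = 1 := if_pos hyi
      rw [hw, div_one, mul_one, ite_self]
      refine hmain _ ?_
      simp only [hg, if_pos hyi]
      split_ifs <;> linarith
    · have hw : primeWeight M (q i) = 1 / √(q i : ℝ) := if_neg hyi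
      rw [hw]
      by_cases hQi : Q i
      · rw [if_pos hQi]
        refine hmain _ ?_
        simp only [hg, if_neg hyi, if_pos hQi]
        have h1 : 1 / (q i : ℝ) / (1 / √(q i : ℝ)) = 1 / √(q i : ℝ) := by
          have h2 : √(q i : ℝ) ≠ 0 := (Real.sqrt_pos.mpr (hqpos i)).ne'
          rw [div_div_eq_mul_div, div_one, div_mul_eq_mul_div, one_mul, div_eq_div_iff (hqpos i).ne' h2,
            Real.mul_self_sqrt (hqpos i).le, one_mul]
        rw [h1]
        have h3 : Real.log M ≤ √(q i : ℝ) := by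
          refine Real.le_sqrt_of_sq_le ?_
          exact (not_le.mp hyi).le
        have h4 : 1 / √(q i : ℝ) ≤ 1 / Real.log M := one_div_le_one_div_of_le (by linarith) h3
        linarith
      · rw [if_neg hQi]
        refine hmain _ ?_
        rw [hroot]
        simp only [hg, if_neg hyi, if_neg hQi]
        linarith
  have hnn : ∀ i, 0 ≤ (if Q i then 1 + K * (1 / (q i : ℝ) / primeWeight M (q i))
      else 1 + K * (1 / (q i : ℝ) * primeWeight M (q i))) := fun i => by
    have := primeWeight_pos M (hprime i)
    split_ifs <;> positivity
  refine (Finset.prod_le_prod (fun i _ => hnn i) fun i _ => hfac i).trans ?_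
  rw [← Real.exp_sum, ← Finset.mul_sum]
  have hg1 : ∑ i, (if (q i : ℝ) ≤ y then 1 / (q i : ℝ) else 0) ≤ 9 + 8 * Real.log (4 + 4 * L) := by
    rw [← Finset.sum_filter]
    have h1 := sum_inv_primes_le hy1 ((Finset.univ.filter fun i => (q i : ℝ) ≤ y).image q) (by
      intro p hp
      obtain ⟨i, hi, rfl⟩ := Finset.mem_image.mp hp
      exact ⟨hprime i, (Finset.mem_filter.mp hi).2⟩)
    rw [Finset.sum_image fun i _ j _ h => hq h, hlogy] at h1
    refine h1.trans (le_of_eq ?_)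
    ring_nf
  have hg2 : ∑ i, 1 / (q i : ℝ) ^ (3 / 2 : ℝ) ≤ Z := by
    rw [← Finset.sum_image (f := fun m : ℕ => 1 / (m : ℝ) ^ (3 / 2 : ℝ)) (s := Finset.univ) (g := q)
      fun i _ j _ h => hq h]
    exact hsum.sum_le_tsum _ fun _ _ => by positivity
  have hg3 : ∑ i, (if Q i then 1 / Real.log M else 0) ≤ 2 := by
    rw [← Finset.sum_filter, Finset.sum_const, nsmul_eq_mul, mul_one_div, div_le_iff₀ (by linarith)]
    have h1 : (2 : ℝ) ^ (Finset.univ.filter Q).card ≤ M := by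
      refine le_trans ?_ hQ
      rw [← Finset.prod_filter, ← Finset.prod_const]
      exact Finset.prod_le_prod (fun _ _ => zero_le_two) fun i _ => by
        exact_mod_cast (hprime i).two_le
    have h2 := Real.log_le_log (by positivity) h1
    rw [Real.log_pow] at h2
    have hlog2 : 1 / 2 < Real.log 2 := by linarith [Real.log_two_gt_d9]
    have h3 : ((Finset.univ.filter Q).card : ℝ) * (1 / 2) ≤
        (Finset.univ.filter Q).card * Real.log 2 :=
      mul_le_mul_of_nonneg_left hlog2.le (Nat.cast_nonneg _)
    linarith
  have hgs : ∑ i, g i ≤ 9 + 8 * Real.log (4 + 4 * L) + Z + 2 := by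
    simp only [hg, Finset.sum_add_distrib]
    linarith
  have hLpos : 0 < L := hL0pos.trans_le hLL
  calc Real.exp (K * ∑ i, g i) ≤ Real.exp (K * (9 + 8 * Real.log (4 + 4 * L) + Z + 2)) :=
        Real.exp_le_exp.mpr (mul_le_mul_of_nonneg_left hgs hK)
    _ = Real.exp (K * (9 + Z + 2)) * (4 + 4 * L) ^ (8 * K) := by
        rw [Real.rpow_def_of_pos (by positivity), ← Real.exp_add]
        congr 1
        ring
    _ ≤ Real.exp (K * (9 + Z + 2)) * ((4 / L₀ + 4) * L) ^ (8 * K) := by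
        refine mul_le_mul_of_nonneg_left (Real.rpow_le_rpow (by positivity) ?_ (by positivity))
          (Real.exp_pos _).le
        have : 4 ≤ 4 / L₀ * L := by
          rw [div_mul_eq_mul_div, le_div_iff₀ hL0pos]
          linarith
        linarith
    _ = _ := by
        rw [Real.mul_rpow (by positivity) hLpos.le]
        ring

end PrimeSums

/-! ### Boxes in the adelic group -/

section Boxes

open scoped Pointwise

variable {n : ℕ}

/-- The product of a family of subsets of the local groups. -/
def box (A : ∀ p : Primes, Set (PGL n ℚ_[p])) : Set (AdelicG n) := {g | ∀ p, g p ∈ A p}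

open scoped Classical in
/-- Extension of a finite family of local elements by `1`. -/
def extendOne (P : Finset Primes) (e : ∀ p : P, PGL n ℚ_[p.1]) : AdelicG n :=
  ⟨fun p => if h : p ∈ P then e ⟨p, h⟩ else 1, by
    refine Filter.mem_of_superset (P.finite_toSet.compl_mem_cofinite) fun p hp => ?_
    have hp' : p ∉ P := hp
    simp only [Set.mem_ofPred_eq, dif_neg hp']
    exact one_mem _⟩

theorem extendOne_apply (P : Finset Primes) (e : ∀ p : P, PGL n ℚ_[p.1]) (p : P) :
    extendOne P e p.1 = e p := dif_pos p.2

theorem extendOne_apply_of_notMem (P : Finset Primes) (e : ∀ p : P, PGL n ℚ_[p.1]) {p : Primes}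
    (hp : p ∉ P) : extendOne P e p = 1 := dif_neg hp

open scoped Classical in
/-- Extension of a finite family of local sets by `K_p`. -/
def extendSet (P : Finset Primes) (d : ∀ p : P, Set (PGL n ℚ_[p.1])) (p : Primes) :
    Set (PGL n ℚ_[p]) :=
  if h : p ∈ P then d ⟨p, h⟩ else (localK n p : Set (PGL n ℚ_[p]))

theorem extendSet_apply (P : Finset Primes) (d : ∀ p : P, Set (PGL n ℚ_[p.1])) (p : P) :
    extendSet P d p.1 = d p := dif_pos p.2

theorem extendSet_apply_of_notMem (P : Finset Primes) (d : ∀ p : P, Set (PGL n ℚ_[p.1]))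
    {p : Primes} (hp : p ∉ P) : extendSet P d p = (localK n p : Set (PGL n ℚ_[p])) := dif_neg hp

theorem muG_adelicK (n : ℕ) : muG n (adelicK n : Set (AdelicG n)) = 1 :=
  Measure.haarMeasure_self (K₀ := compactsK n)

/-- The volume of a box. -/
theorem integral_box {P : Finset Primes} {A : ∀ p : Primes, Set (PGL n ℚ_[p])}
    (hA : ∀ p, RightInvariant (localK n p) (A p)) (hfin : ∀ p, FiniteCosets (localK n p) (A p))
    (hP : ∀ p, p ∉ P → A p = (localK n p : Set (PGL n ℚ_[p]))) :
    Integrable ((box A).indicator (1 : AdelicG n → ℂ)) (muG n) ∧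
      ∫ g, (box A).indicator (1 : AdelicG n → ℂ) g ∂(muG n) =
        ∏ p : P, (cosetCount (localK n p.1) (A p.1) : ℂ) := by
  classical
  have : (muG n).IsMulLeftInvariant := by unfold muG; infer_instance
  choose E hEcard hEA hEinj hEsurj using fun p => exists_coset_reps (hfin p) (hA p)
  have hmem : ∀ e ∈ Fintype.piFinset fun p : P => E p.1, extendOne P e ∈ box A := by
    intro e he p
    by_cases hp : p ∈ P
    · rw [show extendOne P e p = e ⟨p, hp⟩ from extendOne_apply P e ⟨p, hp⟩]
      exact hEA p _ (Fintype.mem_piFinset.mp he ⟨p, hp⟩)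
    · rw [extendOne_apply_of_notMem P e hp, hP p hp]
      exact one_mem _
  have hinv : ∀ g, ∀ k ∈ adelicK n, g * k ∈ box A ↔ g ∈ box A := by
    intro g k hk
    constructor
    · intro h p
      have := hA p _ (h p) _ (inv_mem (hk p))
      simpa using this
    · exact fun h p => hA p _ (h p) _ (hk p)
  have main := integrable_and_integral_eq_sum (muG n) (isOpen_adelicK n) (muG_adelicK n)
    (Fintype.piFinset fun p : P => E p.1) (extendOne P) (by
      intro e he e' he' h
      funext p
      have h1 := h p.1
      rw [RestrictedProduct.mul_apply, RestrictedProduct.inv_apply, extendOne_apply,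
        extendOne_apply] at h1
      exact hEinj p.1 _ (Fintype.mem_piFinset.mp he p) _ (Fintype.mem_piFinset.mp he' p) h1)
    ((box A).indicator (1 : AdelicG n → ℂ)) (by
      intro g k hk
      simp only [Set.indicator_apply, hinv g k hk]
      rfl) (by
      intro g hg
      have hg' : g ∈ box A := Set.mem_of_indicator_ne_zero hg
      choose e he hek using fun p => hEsurj p (g p) (hg' p)
      refine ⟨fun p => e p.1, Fintype.mem_piFinset.mpr fun p => he p.1, fun p => ?_⟩
      rw [RestrictedProduct.mul_apply, RestrictedProduct.inv_apply]
      by_cases hp : p ∈ P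
      · rw [extendOne_apply P _ ⟨p, hp⟩]
        exact hek p
      · rw [extendOne_apply_of_notMem P _ hp, inv_one, one_mul]
        have := hg' p
        rwa [hP p hp] at this)
  refine ⟨main.1, main.2.trans ?_⟩
  rw [Finset.sum_congr rfl fun e he => Set.indicator_of_mem (hmem e he) _]
  simp [Fintype.card_piFinset, hEcard]

end Boxes

/-! ### Hecke functions as combinations of indicator functions of boxes -/

section HeckeFunctions

variable {n : ℕ}

/-- A finite set of double cosets that contains all `K_p diag(p^a) K_p` whose exponents differ by at
most `D`. -/
def cells (n D : ℕ) (p : Primes) : Finset (Set (PGL n ℚ_[p])) :=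
  open scoped Classical in (exponentBox n D).image (cell n p)

theorem mem_cells {D : ℕ} {p : Primes} {X : Set (PGL n ℚ_[p])} :
    X ∈ cells n D p ↔ ∃ a ∈ exponentBox n D, cell n p a = X := by
  classical
  simp only [cells, Finset.mem_image]

theorem card_cells_le (n D : ℕ) (p : Primes) : (cells n D p).card ≤ (2 * D + 1) ^ n := by
  classical
  exact Finset.card_image_le.trans (card_exponentBox_le n D)

theorem cell_zero (p : Primes) : cell n p 0 = (localK n p : Set (PGL n ℚ_[p])) := by
  rw [cell, cocharValue_zero, doubleCoset_one]

theorem localK_mem_cells (hn : 0 < n) (D : ℕ) (p : Primes) :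
    (localK n p : Set (PGL n ℚ_[p])) ∈ cells n D p :=
  mem_cells.mpr ⟨0, (mem_exponentBox hn).mpr ⟨rfl, fun i => by simp⟩, cell_zero p⟩

theorem cell_mem_cells (hn : 0 < n) {D : ℕ} {a : Fin n → ℤ} (ha : ∀ i j, a i - a j ≤ D)
    (p : Primes) : cell n p a ∈ cells n D p := by
  refine mem_cells.mpr ⟨a + fun _ => -a ⟨0, hn⟩, (mem_exponentBox hn).mpr ⟨by simp, fun i => ?_⟩, ?_⟩
  · have h1 := ha i ⟨0, hn⟩
    have h2 := ha ⟨0, hn⟩ i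
    simp only [Pi.add_apply]
    omega
  · rw [cell, cocharValue_add, cocharValue_const, mul_one]

theorem sub_le_of_mem_exponentBox (hn : 0 < n) {D : ℕ} {a : Fin n → ℤ}
    (ha : a ∈ exponentBox n D) (i j : Fin n) : a i - a j ≤ (2 * D : ℕ) := by
  have h := ((mem_exponentBox hn).mp ha).2
  have h1 := h i
  have h2 := h j
  push_cast
  omega

/-- Functions that are bi-invariant under `K_f` and supported on the double cosets of `H^{≤ κ}`. -/
def heckeSupported (n D : ℕ) (M : ℝ) : Submodule ℂ (AdelicG n → ℂ) where
  carrier := {ω | (∀ k ∈ adelicK n, ∀ k' ∈ adelicK n, ∀ g, ω (k * g * k') = ω g) ∧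
    ∀ g, ω g ≠ 0 → ∃ m : ℕ, Squarefree m ∧ (m : ℝ) ≤ M ∧
      ∀ p : Primes, ((p : ℕ) ∣ m → ∃ X ∈ cells n D p, g p ∈ X) ∧
        (¬ (p : ℕ) ∣ m → g p ∈ localK n p)}
  add_mem' := by
    rintro ω ω' ⟨h1, h2⟩ ⟨h1', h2'⟩
    refine ⟨fun k hk k' hk' g => ?_, fun g hg => ?_⟩
    · rw [Pi.add_apply, Pi.add_apply, h1 k hk k' hk', h1' k hk k' hk']
    · by_cases h : ω g = 0
      · exact h2' g fun h' => hg (by rw [Pi.add_apply, h, h', add_zero])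
      · exact h2 g h
  zero_mem' := ⟨fun _ _ _ _ _ => rfl, fun _ hg => absurd rfl hg⟩
  smul_mem' := by
    rintro c ω ⟨h1, h2⟩
    refine ⟨fun k hk k' hk' g => ?_, fun g hg => h2 g fun h => hg ?_⟩
    · rw [Pi.smul_apply, Pi.smul_apply, h1 k hk k' hk']
    · rw [Pi.smul_apply, h, smul_zero]

theorem localHecke_invariant {κ : ℝ} {p : Primes} {f : PGL n ℚ_[p] → ℂ}
    (hf : f ∈ localHecke n κ p) {k k' : PGL n ℚ_[p]} (hk : k ∈ localK n p) (hk' : k' ∈ localK n p)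
    (g : PGL n ℚ_[p]) : f (k * g * k') = f g := by
  induction hf using Submodule.span_induction with
  | mem f hf =>
    classical
    obtain ⟨a, -, rfl⟩ := hf
    have : k * g * k' ∈ cell n p a ↔ g ∈ cell n p a := by
      constructor
      · intro h
        have h1 := doubleCoset_leftInvariant _ _ (inv_mem hk)
          (doubleCoset_rightInvariant _ _ _ h _ (inv_mem hk'))
        simpa [mul_assoc] using h1
      · exact fun h => doubleCoset_rightInvariant _ _ _ (doubleCoset_leftInvariant _ _ hk h) _ hk'
    simp only [Set.indicator_apply, this]
    rfl
  | zero => rfl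
  | add f f' _ _ h h' => rw [Pi.add_apply, Pi.add_apply, h, h']
  | smul c f _ h => rw [Pi.smul_apply, Pi.smul_apply, h]

theorem localHecke_support (hn : 0 < n) {κ : ℝ} {D : ℕ} (hD : 2 * κ ≤ D) {p : Primes}
    {f : PGL n ℚ_[p] → ℂ} (hf : f ∈ localHecke n κ p) {g : PGL n ℚ_[p]} (hg : f g ≠ 0) :
    ∃ X ∈ cells n D p, g ∈ X := by
  induction hf using Submodule.span_induction with
  | mem f hf =>
    obtain ⟨a, ha, rfl⟩ := hf
    refine ⟨cell n p a, cell_mem_cells hn (fun i j => ?_) p, Set.mem_of_indicator_ne_zero hg⟩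
    have h1 := sub_le_cocharNorm a i j
    have h2 : ((a i - a j : ℤ) : ℝ) ≤ (D : ℤ) := by
      push_cast
      linarith
    exact_mod_cast h2
  | zero => exact absurd rfl hg
  | add f f' _ _ h h' =>
    by_cases h0 : f g = 0
    · exact h' fun h0' => hg (by rw [Pi.add_apply, h0, h0', add_zero])
    · exact h h0
  | smul c f _ h => exact h fun h0 => hg (by rw [Pi.smul_apply, h0, smul_zero])

/-- Only bi-invariance and the support condition are used from here on. The factor `2` is that of
`sub_le_cocharNorm`. -/
theorem truncHecke_le (hn : 0 < n) {κ : ℝ} {D : ℕ} (hD : 2 * κ ≤ D) (M : ℝ) :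
    truncHecke n κ M ≤ heckeSupported n D M := by
  refine iSup₂_le fun m hm => Submodule.span_le.mpr ?_
  rintro F ⟨f, hf, hf', rfl⟩
  obtain ⟨hsq, hmM⟩ := hm
  have hinv : ∀ p : Primes, ∀ k ∈ localK n p, ∀ k' ∈ localK n p, ∀ g, f p (k * g * k') = f p g := by
    intro p k hk k' hk' g
    by_cases hp : (p : ℕ) ∣ m
    · exact localHecke_invariant (hf p hp) hk hk' g
    · classical
      rw [hf' p hp]
      have : k * g * k' ∈ (localK n p : Set (PGL n ℚ_[p])) ↔
          g ∈ (localK n p : Set (PGL n ℚ_[p])) := by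
        rw [SetLike.mem_coe, Subgroup.mul_mem_cancel_right _ hk', Subgroup.mul_mem_cancel_left _ hk,
          SetLike.mem_coe]
      simp only [Set.indicator_apply, this]
      rfl
  refine ⟨fun k hk k' hk' g => finprod_congr fun p => hinv p _ (hk p) _ (hk' p) _, fun g hg => ?_⟩
  -- An infinite `finprod` has the default value `1`, so finiteness is needed to conclude that all
  -- factors of a nonzero product are nonzero.
  have hfin : (Function.mulSupport fun p : Primes => f p (g p)).Finite := by
    have h1 : {p : Primes | ¬ g p ∈ localK n p}.Finite := g.2
    have h2 : {p : Primes | (p : ℕ) ∣ m}.Finite := by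
      refine Set.Finite.preimage (f := fun p : Primes => (p : ℕ)) Subtype.val_injective.injOn
        ((Set.finite_Iic m).subset fun d hd =>
          Nat.le_of_dvd (Nat.pos_of_ne_zero hsq.ne_zero) hd)
    refine (h1.union h2).subset fun p hp => ?_
    by_contra hcon
    rw [Set.mem_union, not_or] at hcon
    obtain ⟨hc1, hc2⟩ := hcon
    refine hp ?_
    change f p (g p) = 1
    rw [hf' p hc2]
    exact Set.indicator_of_mem (not_not.mp hc1) _
  have hne : ∀ p, f p (g p) ≠ 0 := fun p h0 => hg (finprod_eq_zero (fun p => f p (g p)) p h0 hfin)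
  refine ⟨m, hsq, hmM, fun p => ⟨fun hp => localHecke_support hn hD (hf p hp) (hne p), fun hp => ?_⟩⟩
  have := hne p
  rw [hf' p hp] at this
  exact Set.mem_of_indicator_ne_zero this

end HeckeFunctions

/-! ### Expansion of `ω` in boxes -/

section Expansion

open scoped Pointwise

variable {n : ℕ}

theorem cells_rightInvariant {D : ℕ} {p : Primes} {X : Set (PGL n ℚ_[p])} (hX : X ∈ cells n D p) :
    RightInvariant (localK n p) X := by
  obtain ⟨a, -, rfl⟩ := mem_cells.mp hX
  exact doubleCoset_rightInvariant _ _

theorem cells_finiteCosets {D : ℕ} {p : Primes} {X : Set (PGL n ℚ_[p])} (hX : X ∈ cells n D p) :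
    FiniteCosets (localK n p) X := by
  obtain ⟨a, -, rfl⟩ := mem_cells.mp hX
  exact finiteCosets_cell a

theorem cells_cosetCount_pos {D : ℕ} {p : Primes} {X : Set (PGL n ℚ_[p])} (hX : X ∈ cells n D p) :
    0 < cosetCount (localK n p) X := by
  obtain ⟨a, -, rfl⟩ := mem_cells.mp hX
  exact cosetCount_pos (finiteCosets_cell a) ⟨_, DoubleCoset.mem_doubleCoset_self _ _ _⟩

theorem cells_smul {D : ℕ} {p : Primes} {X : Set (PGL n ℚ_[p])} (hX : X ∈ cells n D p)
    {k : PGL n ℚ_[p]} (hk : k ∈ localK n p) : k • X = X := by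
  obtain ⟨a, -, rfl⟩ := mem_cells.mp hX
  exact doubleCoset_smul _ _ hk

theorem cells_eq_of_mem {D : ℕ} {p : Primes} {X Y : Set (PGL n ℚ_[p])} (hX : X ∈ cells n D p)
    (hY : Y ∈ cells n D p) {g : PGL n ℚ_[p]} (hgX : g ∈ X) (hgY : g ∈ Y) : X = Y := by
  obtain ⟨a, -, rfl⟩ := mem_cells.mp hX
  obtain ⟨c, -, rfl⟩ := mem_cells.mp hY
  exact cell_eq_of_mem hgX hgY

theorem extendSet_mem_cells (hn : 0 < n) {D : ℕ} {P : Finset Primes}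
    {d : ∀ p : P, Set (PGL n ℚ_[p.1])} (hd : ∀ p, d p ∈ cells n D p.1) (p : Primes) :
    extendSet P d p ∈ cells n D p := by
  by_cases hp : p ∈ P
  · rw [extendSet_apply P d ⟨p, hp⟩]
    exact hd ⟨p, hp⟩
  · rw [extendSet_apply_of_notMem P d hp]
    exact localK_mem_cells hn D p

/-- Elements of the same box are related by `K_f` on both sides. -/
theorem exists_mul_mul_of_mem_box {D : ℕ} {A : ∀ p : Primes, Set (PGL n ℚ_[p])}
    (hA : ∀ p, A p ∈ cells n D p) {g g' : AdelicG n} (hg : g ∈ box A) (hg' : g' ∈ box A) :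
    ∃ k ∈ adelicK n, ∃ k' ∈ adelicK n, g' = k * g * k' := by
  have h : ∀ p : Primes, ∃ k : PGL n ℚ_[p], ∃ k' : PGL n ℚ_[p], k ∈ localK n p ∧ k' ∈ localK n p ∧
      g' p = k * g p * k' := fun p => by
    obtain ⟨a, -, ha⟩ := mem_cells.mp (hA p)
    have h1 : g p ∈ cell n p a := by rw [ha]; exact hg p
    have h2 : g' p ∈ cell n p a := by rw [ha]; exact hg' p
    rw [cell, ← DoubleCoset.doubleCoset_eq_of_mem h1] at h2
    obtain ⟨k, hk, k', hk', h3⟩ := DoubleCoset.mem_doubleCoset.mp h2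
    exact ⟨k, k', hk, hk', h3⟩
  choose k k' hk hk' hgk using h
  refine ⟨⟨k, Filter.Eventually.of_forall hk⟩, hk, ⟨k', Filter.Eventually.of_forall hk'⟩, hk', ?_⟩
  exact RestrictedProduct.ext _ _ hgk

open scoped Classical in
/-- The value of a function on a box. -/
def boxValue (P : Finset Primes) (ω : AdelicG n → ℂ) (d : ∀ p : P, Set (PGL n ℚ_[p.1])) : ℂ :=
  if h : (box (extendSet P d)).Nonempty then ω h.some else 0

theorem exists_of_boxValue_ne_zero {P : Finset Primes} {ω : AdelicG n → ℂ}
    {d : ∀ p : P, Set (PGL n ℚ_[p.1])} (h : boxValue P ω d ≠ 0) :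
    ∃ g ∈ box (extendSet P d), ω g ≠ 0 := by
  classical
  unfold boxValue at h
  split_ifs at h with hne
  · exact ⟨_, hne.some_mem, h⟩
  · exact absurd rfl h

theorem boxValue_eq (hn : 0 < n) {D : ℕ} {M : ℝ} {P : Finset Primes} {ω : AdelicG n → ℂ}
    (hω : ω ∈ heckeSupported n D M) {d : ∀ p : P, Set (PGL n ℚ_[p.1])}
    (hd : ∀ p, d p ∈ cells n D p.1) {g : AdelicG n} (hg : g ∈ box (extendSet P d)) :
    boxValue P ω d = ω g := by
  have hne : (box (extendSet P d)).Nonempty := ⟨g, hg⟩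
  rw [boxValue, dif_pos hne]
  obtain ⟨k, hk, k', hk', h⟩ :=
    exists_mul_mul_of_mem_box (extendSet_mem_cells hn hd) hg hne.some_mem
  rw [h]
  exact hω.1 k hk k' hk' g

/-- A Hecke function is a combination of indicator functions of boxes. -/
theorem eq_sum_boxValue (hn : 0 < n) {D : ℕ} {M : ℝ} {P : Finset Primes}
    (hP : ∀ p : Primes, ((p : ℕ) : ℝ) ≤ M → p ∈ P) {ω : AdelicG n → ℂ}
    (hω : ω ∈ heckeSupported n D M) (g : AdelicG n) :
    ω g = ∑ d ∈ Fintype.piFinset fun p : P => cells n D p.1,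
      boxValue P ω d * (box (extendSet P d)).indicator 1 g := by
  classical
  by_cases hex : ∃ d ∈ Fintype.piFinset fun p : P => cells n D p.1, g ∈ box (extendSet P d)
  · obtain ⟨d, hd, hg⟩ := hex
    have hd' := Fintype.mem_piFinset.mp hd
    rw [Finset.sum_eq_single d]
    · rw [Set.indicator_of_mem hg, boxValue_eq hn hω hd' hg]
      simp
    · intro d' hd2 hne
      rw [Set.indicator_of_notMem, mul_zero]
      intro hg'
      refine hne (funext fun p => ?_)
      have h1 := hg p.1
      have h2 := hg' p.1
      rw [extendSet_apply] at h1 h2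
      exact cells_eq_of_mem (Fintype.mem_piFinset.mp hd2 p) (hd' p) h2 h1
    · exact fun h => absurd hd h
  · rw [Finset.sum_eq_zero fun d hd => by
      rw [Set.indicator_of_notMem (fun hg => hex ⟨d, hd, hg⟩), mul_zero]]
    by_contra hne
    obtain ⟨m, hsq, hmM, hm⟩ := hω.2 g hne
    have hX : ∀ p : Primes, ∃ X ∈ cells n D p, g p ∈ X := fun p => by
      by_cases hp : (p : ℕ) ∣ m
      · exact (hm p).1 hp
      · exact ⟨_, localK_mem_cells hn D p, (hm p).2 hp⟩
    choose X hXc hXg using hX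
    refine hex ⟨fun p => X p.1, Fintype.mem_piFinset.mpr fun p => hXc p.1, fun p => ?_⟩
    by_cases hp : p ∈ P
    · rw [extendSet_apply P _ ⟨p, hp⟩]
      exact hXg p
    · rw [extendSet_apply_of_notMem P _ hp]
      refine (hm p).2 fun hdvd => hp (hP p (le_trans ?_ hmM))
      exact_mod_cast Nat.le_of_dvd (Nat.pos_of_ne_zero hsq.ne_zero) hdvd

-- A point of the box where `ω` is nonzero has some squarefree `m ≤ M` attached. At primes not
-- dividing `m` its component lies in `K_p`, so by disjointness the cell there is `K_p`. The product
-- of the remaining primes therefore divides `m`.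
open scoped Classical in
theorem prod_le_of_boxValue_ne_zero (hn : 0 < n) {D : ℕ} {M : ℝ} {P : Finset Primes}
    {ω : AdelicG n → ℂ} (hω : ω ∈ heckeSupported n D M) {d : ∀ p : P, Set (PGL n ℚ_[p.1])}
    (hd : ∀ p, d p ∈ cells n D p.1) (h : boxValue P ω d ≠ 0) :
    (∏ p : P, if ¬ d p = (localK n p.1 : Set (PGL n ℚ_[p.1])) then ((p.1 : ℕ) : ℝ) else 1) ≤ M := by
  obtain ⟨g, hg, hne⟩ := exists_of_boxValue_ne_zero h
  obtain ⟨m, hsq, hmM, hm⟩ := hω.2 g hne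
  refine le_trans ?_ hmM
  rw [← Finset.prod_filter]
  have hdvd : ∏ p ∈ Finset.univ.filter
      (fun p : P => ¬ d p = (localK n p.1 : Set (PGL n ℚ_[p.1]))), (p.1 : ℕ) ∣ m := by
    have hinj : ∀ p : P, ∀ q : P, (p.1 : ℕ) = q.1 → p = q := fun p q h =>
      Subtype.ext (Subtype.ext h)
    rw [← Finset.prod_image (f := fun x : ℕ => x) (g := fun p : P => (p.1 : ℕ))
      fun p _ q _ h => hinj p q h]
    refine Finset.prod_primes_dvd m ?_ ?_
    · intro x hx
      obtain ⟨p, -, rfl⟩ := Finset.mem_image.mp hx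
      exact p.1.2.prime
    · intro x hx
      obtain ⟨p, hp, rfl⟩ := Finset.mem_image.mp hx
      by_contra hcon
      have h1 := (hm p.1).2 hcon
      have h2 := hg p.1
      rw [extendSet_apply] at h2
      exact (Finset.mem_filter.mp hp).2
        (cells_eq_of_mem (hd p) (localK_mem_cells hn D p.1) h2 h1)
  exact_mod_cast Nat.le_of_dvd (Nat.pos_of_ne_zero hsq.ne_zero) hdvd

/-! ### The kernel `ω * ω^*` -/

theorem conv_adj_apply (ω : AdelicG n → ℂ) (g : AdelicG n) :
    conv ω (adj ω) g = ∫ h, ω h * starRingEnd ℂ (ω (g⁻¹ * h)) ∂(muG n) := by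
  simp only [conv, adj, mul_inv_rev, inv_inv]

/-- The volume of the intersection of a box with a translate of another box. -/
theorem integral_box_inter (hn : 0 < n) {D : ℕ} {P : Finset Primes}
    {d d' : ∀ p : P, Set (PGL n ℚ_[p.1])} (hd : ∀ p, d p ∈ cells n D p.1)
    (hd' : ∀ p, d' p ∈ cells n D p.1) (g : AdelicG n) :
    Integrable (fun h => (box (extendSet P d)).indicator (1 : AdelicG n → ℂ) h *
        (box (extendSet P d')).indicator (1 : AdelicG n → ℂ) (g⁻¹ * h)) (muG n) ∧
      ((∀ p, p ∉ P → g p ∈ localK n p) →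
        ∫ h, (box (extendSet P d)).indicator (1 : AdelicG n → ℂ) h *
          (box (extendSet P d')).indicator (1 : AdelicG n → ℂ) (g⁻¹ * h) ∂(muG n) =
        ∏ p : P, (cosetCount (localK n p.1) (d p ∩ g p.1 • d' p) : ℂ)) ∧
      (¬ (∀ p, p ∉ P → g p ∈ localK n p) →
        ∫ h, (box (extendSet P d)).indicator (1 : AdelicG n → ℂ) h *
          (box (extendSet P d')).indicator (1 : AdelicG n → ℂ) (g⁻¹ * h) ∂(muG n) = 0) := by
  classical
  -- The intersection of a box with a translated box is again a box. It is empty as soon as `g p ∉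
  -- K_p` for some `p ∉ P`.
  set A : ∀ p : Primes, Set (PGL n ℚ_[p]) := fun p => extendSet P d p ∩ g p • extendSet P d' p
    with hA
  have hfun : (fun h => (box (extendSet P d)).indicator (1 : AdelicG n → ℂ) h *
      (box (extendSet P d')).indicator (1 : AdelicG n → ℂ) (g⁻¹ * h)) =
      (box A).indicator (1 : AdelicG n → ℂ) := by
    funext h
    have hmem : h ∈ box A ↔ h ∈ box (extendSet P d) ∧ g⁻¹ * h ∈ box (extendSet P d') := by
      constructor
      · intro hh
        refine ⟨fun p => (hh p).1, fun p => ?_⟩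
        have := (hh p).2
        rw [Set.mem_smul_set_iff_inv_smul_mem] at this
        exact this
      · rintro ⟨h1, h2⟩ p
        refine ⟨h1 p, ?_⟩
        rw [Set.mem_smul_set_iff_inv_smul_mem]
        exact h2 p
    by_cases h1 : h ∈ box (extendSet P d) <;> by_cases h2 : g⁻¹ * h ∈ box (extendSet P d') <;>
      simp [hmem, h1, h2]
  have hc := extendSet_mem_cells hn hd
  have hc' := extendSet_mem_cells hn hd'
  rw [hfun]
  by_cases hg : ∀ p, p ∉ P → g p ∈ localK n p
  · have main := integral_box (P := P) (A := A)
      (fun p => (cells_rightInvariant (hc p)).inter ((cells_rightInvariant (hc' p)).smul _))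
      (fun p => (cells_finiteCosets (hc p)).mono Set.inter_subset_left)
      (fun p hp => by
        simp only [hA]
        rw [extendSet_apply_of_notMem P d hp, extendSet_apply_of_notMem P d' hp,
          cells_smul (localK_mem_cells hn D p) (hg p hp), Set.inter_self])
    refine ⟨main.1, fun _ => main.2.trans (Finset.prod_congr rfl fun p _ => ?_), fun h => absurd hg h⟩
    simp only [hA]
    rw [extendSet_apply, extendSet_apply]
  · have hempty : box A = ∅ := by
      rw [Set.eq_empty_iff_forall_notMem]
      intro h hh
      refine hg fun p hp => ?_
      obtain ⟨h1, h2⟩ := hh p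
      rw [Set.mem_smul_set_iff_inv_smul_mem, smul_eq_mul] at h2
      rw [extendSet_apply_of_notMem P d hp] at h1
      rw [extendSet_apply_of_notMem P d' hp] at h2
      have := mul_mem (SetLike.mem_coe.mp h1) (inv_mem (SetLike.mem_coe.mp h2))
      simpa using this
    rw [hempty, Set.indicator_empty]
    exact ⟨integrable_zero _ _ _, fun h => absurd h hg, fun _ => integral_zero _ _⟩

/-- The values of `ω * ω^*` in terms of intersections of double cosets. -/
theorem conv_adj_eq_sum (hn : 0 < n) {D : ℕ} {M : ℝ} {P : Finset Primes}
    (hP : ∀ p : Primes, ((p : ℕ) : ℝ) ≤ M → p ∈ P) {ω : AdelicG n → ℂ}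
    (hω : ω ∈ heckeSupported n D M) (g : AdelicG n) :
    ((∀ p, p ∉ P → g p ∈ localK n p) →
      conv ω (adj ω) g = ∑ d ∈ Fintype.piFinset fun p : P => cells n D p.1,
        ∑ d' ∈ Fintype.piFinset fun p : P => cells n D p.1,
          boxValue P ω d * starRingEnd ℂ (boxValue P ω d') *
            ∏ p : P, (cosetCount (localK n p.1) (d p ∩ g p.1 • d' p) : ℂ)) ∧
    (¬ (∀ p, p ∉ P → g p ∈ localK n p) → conv ω (adj ω) g = 0) := by
  have hexp : conv ω (adj ω) g = ∑ d ∈ Fintype.piFinset fun p : P => cells n D p.1,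
      ∑ d' ∈ Fintype.piFinset fun p : P => cells n D p.1,
        boxValue P ω d * starRingEnd ℂ (boxValue P ω d') *
          ∫ h, (box (extendSet P d)).indicator (1 : AdelicG n → ℂ) h *
            (box (extendSet P d')).indicator (1 : AdelicG n → ℂ) (g⁻¹ * h) ∂(muG n) := by
    rw [conv_adj_apply]
    have hpt : ∀ h, ω h * starRingEnd ℂ (ω (g⁻¹ * h)) =
        ∑ d ∈ Fintype.piFinset fun p : P => cells n D p.1,
          ∑ d' ∈ Fintype.piFinset fun p : P => cells n D p.1,
            boxValue P ω d * starRingEnd ℂ (boxValue P ω d') *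
              ((box (extendSet P d)).indicator (1 : AdelicG n → ℂ) h *
                (box (extendSet P d')).indicator (1 : AdelicG n → ℂ) (g⁻¹ * h)) := fun h => by
      have hreal : ∀ (A : Set (AdelicG n)) (x : AdelicG n),
          starRingEnd ℂ (A.indicator (1 : AdelicG n → ℂ) x) =
            A.indicator (1 : AdelicG n → ℂ) x := fun A x => by
        classical
        rw [Set.indicator_apply]
        split_ifs <;> simp
      rw [eq_sum_boxValue hn hP hω h, eq_sum_boxValue hn hP hω (g⁻¹ * h), map_sum,
        Finset.sum_mul_sum]
      refine Finset.sum_congr rfl fun d _ => Finset.sum_congr rfl fun d' _ => ?_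
      rw [map_mul, hreal]
      ring
    simp only [hpt]
    rw [integral_finsetSum _ fun d hd => integrable_finsetSum _ fun d' hd' =>
      (integral_box_inter hn (Fintype.mem_piFinset.mp hd) (Fintype.mem_piFinset.mp hd')
        g).1.const_mul _]
    refine Finset.sum_congr rfl fun d hd => ?_
    rw [integral_finsetSum _ fun d' hd' =>
      (integral_box_inter hn (Fintype.mem_piFinset.mp hd) (Fintype.mem_piFinset.mp hd')
        g).1.const_mul _]
    exact Finset.sum_congr rfl fun d' _ => integral_const_mul _ _
  rw [hexp]
  constructor
  · intro hg
    refine Finset.sum_congr rfl fun d hd => Finset.sum_congr rfl fun d' hd' => ?_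
    rw [(integral_box_inter hn (Fintype.mem_piFinset.mp hd) (Fintype.mem_piFinset.mp hd') g).2.1 hg]
  · intro hg
    refine Finset.sum_eq_zero fun d hd => Finset.sum_eq_zero fun d' hd' => ?_
    rw [(integral_box_inter hn (Fintype.mem_piFinset.mp hd) (Fintype.mem_piFinset.mp hd') g).2.2 hg,
      mul_zero]

/-- `(ω * ω^*)(1)` is the squared norm of `ω`. -/
theorem conv_adj_one (hn : 0 < n) {D : ℕ} {M : ℝ} {P : Finset Primes}
    (hP : ∀ p : Primes, ((p : ℕ) : ℝ) ≤ M → p ∈ P) {ω : AdelicG n → ℂ}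
    (hω : ω ∈ heckeSupported n D M) :
    conv ω (adj ω) 1 = ((∑ d ∈ Fintype.piFinset fun p : P => cells n D p.1,
      (‖boxValue P ω d‖ * ∏ p : P, √(cosetCount (localK n p.1) (d p) : ℝ)) ^ 2 : ℝ) : ℂ) := by
  rw [(conv_adj_eq_sum hn hP hω 1).1 fun p _ => one_mem _]
  push_cast
  refine Finset.sum_congr rfl fun d hd => ?_
  rw [Finset.sum_eq_single d]
  · rw [Complex.mul_conj, Complex.normSq_eq_norm_sq, mul_pow, ← Finset.prod_pow]
    push_cast
    congr 1
    refine Finset.prod_congr rfl fun p _ => ?_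
    rw [RestrictedProduct.one_apply, one_smul, Set.inter_self, ← Complex.ofReal_pow,
      Real.sq_sqrt (Nat.cast_nonneg _), Complex.ofReal_natCast]
  · intro d' hd' hne
    obtain ⟨p, hp⟩ : ∃ p, d' p ≠ d p := by
      by_contra hcon
      push Not at hcon
      exact hne (funext hcon)
    refine mul_eq_zero_of_right _ (Finset.prod_eq_zero (Finset.mem_univ p) ?_)
    have hempty : d p ∩ d' p = ∅ := by
      rw [Set.eq_empty_iff_forall_notMem]
      exact fun x hx => hp (cells_eq_of_mem (Fintype.mem_piFinset.mp hd' p)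
        (Fintype.mem_piFinset.mp hd p) hx.2 hx.1)
    rw [RestrictedProduct.one_apply, one_smul, hempty, cosetCount_empty, Nat.cast_zero]
  · exact fun h => absurd hd h

/-! ### The torus integral -/

theorem muH_subgroupOf (n : ℕ) :
    muH n ((adelicK n).subgroupOf (adelicH n) : Set (adelicH n)) = 1 :=
  Measure.haarMeasure_self (K₀ := compactsHK n)

/-- The torus element with components `diag(p^{b_p})` for `p ∈ P`. -/
def torusElement (P : Finset Primes) (b : P → Fin n → ℤ) : adelicH n :=
  ⟨extendOne P fun p => cocharValue n p.1 (b p), fun p => by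
    by_cases hp : p ∈ P
    · rw [extendOne_apply P _ ⟨p, hp⟩]
      exact cocharValue_mem_localH _
    · rw [extendOne_apply_of_notMem P _ hp]
      exact one_mem _⟩

theorem torusElement_apply (P : Finset Primes) (b : P → Fin n → ℤ) (p : P) :
    (torusElement P b : AdelicG n) p.1 = cocharValue n p.1 (b p) :=
  extendOne_apply P (fun p => cocharValue n p.1 (b p)) p

theorem torusElement_apply_of_notMem (P : Finset Primes) (b : P → Fin n → ℤ) {p : Primes}
    (hp : p ∉ P) : (torusElement P b : AdelicG n) p = 1 :=
  extendOne_apply_of_notMem P (fun p => cocharValue n p.1 (b p)) hp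

/-- The kernel is right invariant under `H ∩ K_f`, whose cosets are represented by exponents with
zero entry at `0`. Exponents in `exponentBox n D` differ by at most `2D`, so a nonempty intersection
of a cell with a translate forces `|b_i| ≤ 4D`. -/
theorem integral_adelicH_eq_sum (hn : 0 < n) {D : ℕ} {M : ℝ} {P : Finset Primes}
    (hP : ∀ p : Primes, ((p : ℕ) : ℝ) ≤ M → p ∈ P) {ω : AdelicG n → ℂ}
    (hω : ω ∈ heckeSupported n D M) :
    Integrable (fun h : adelicH n => conv ω (adj ω) h) (muH n) ∧
      ∫ h : adelicH n, conv ω (adj ω) h ∂(muH n) =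
        ∑ b ∈ Fintype.piFinset fun _ : P => exponentBox n (4 * D),
          conv ω (adj ω) (torusElement P b) := by
  have : (muH n).IsMulLeftInvariant := by unfold muH; infer_instance
  refine integrable_and_integral_eq_sum (muH n) (K := (adelicK n).subgroupOf (adelicH n))
    ((isOpen_adelicK n).preimage continuous_subtype_val) (muH_subgroupOf n)
    (Fintype.piFinset fun _ : P => exponentBox n (4 * D)) (torusElement P) ?_
    (fun h => conv ω (adj ω) h) ?_ ?_
  · intro b hb b' hb' h
    funext p
    have h1 : ((torusElement P b : AdelicG n)⁻¹ * (torusElement P b' : AdelicG n)) p.1 ∈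
      localK n p.1 := h p.1
    rw [RestrictedProduct.mul_apply, RestrictedProduct.inv_apply, torusElement_apply,
      torusElement_apply] at h1
    exact eq_of_mem_exponentBox hn (Fintype.mem_piFinset.mp hb p) (Fintype.mem_piFinset.mp hb' p) h1
  · intro g k hk
    rw [conv_adj_apply, conv_adj_apply]
    refine integral_congr_ae (Filter.Eventually.of_forall fun h => ?_)
    have hk' : (k : AdelicG n) ∈ adelicK n := hk
    have := hω.1 _ (inv_mem hk') 1 (one_mem _) ((g : AdelicG n)⁻¹ * h)
    simp only [Subgroup.coe_mul, mul_inv_rev]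
    rw [mul_one, ← mul_assoc] at this
    rw [this]
  · intro h hne
    have hout : ∀ p, p ∉ P → (h : AdelicG n) p ∈ localK n p := by
      by_contra hcon
      exact hne ((conv_adj_eq_sum hn hP hω (h : AdelicG n)).2 hcon)
    choose b hb0 hbK using fun p : P => exists_exponent hn (h.2 p.1)
    refine ⟨b, Fintype.mem_piFinset.mpr fun p => ?_, fun p => ?_⟩
    · simp only [(conv_adj_eq_sum hn hP hω (h : AdelicG n)).1 hout] at hne
      obtain ⟨d, hd, hne⟩ := Finset.exists_ne_zero_of_sum_ne_zero hne
      obtain ⟨d', hd', hne⟩ := Finset.exists_ne_zero_of_sum_ne_zero hne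
      have hp := Finset.prod_ne_zero_iff.mp (right_ne_zero_of_mul hne) p (Finset.mem_univ p)
      have hsm : (h : AdelicG n) p.1 • d' p = cocharValue n p.1 (b p) • d' p := by
        conv_rhs => rw [← cells_smul (Fintype.mem_piFinset.mp hd' p) (hbK p)]
        rw [smul_smul, mul_inv_cancel_left]
      rw [hsm] at hp
      obtain ⟨a, ha, had⟩ := mem_cells.mp (Fintype.mem_piFinset.mp hd p)
      obtain ⟨c, hc, hcd⟩ := mem_cells.mp (Fintype.mem_piFinset.mp hd' p)
      rw [← had, ← hcd] at hp
      have hnonempty : (cell n p.1 a ∩ cocharValue n p.1 (b p) • cell n p.1 c).Nonempty := by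
        rw [Set.nonempty_iff_ne_empty]
        intro h0
        rw [h0, cosetCount_empty] at hp
        exact hp Nat.cast_zero
      have hsub := sub_le_of_inter_nonempty (sub_le_of_mem_exponentBox hn ha)
        (sub_le_of_mem_exponentBox hn hc) hnonempty
      refine (mem_exponentBox hn).mpr ⟨hb0 p, fun i => ?_⟩
      have h1 := hsub i ⟨0, hn⟩
      have h2 := hsub ⟨0, hn⟩ i
      rw [hb0 p] at h1 h2
      push_cast at h1 h2 ⊢
      omega
    · change ((torusElement P b : AdelicG n)⁻¹ * (h : AdelicG n)) p ∈ localK n p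
      rw [RestrictedProduct.mul_apply, RestrictedProduct.inv_apply]
      by_cases hp : p ∈ P
      · rw [torusElement_apply P b ⟨p, hp⟩]
        exact hbK ⟨p, hp⟩
      · rw [torusElement_apply_of_notMem P b hp, inv_one, one_mul]
        exact hout p hp

/-- The local torus sums are bounded by the majorant kernel. -/
theorem sum_cosetCount_le_schurKernel (hn : 3 ≤ n) {D : ℕ} {p : Primes}
    {X Y : Set (PGL n ℚ_[p])} (hX : X ∈ cells n D p) (hY : Y ∈ cells n D p) (D' : ℕ) :
    ∑ b ∈ exponentBox n D', (cosetCount (localK n p) (X ∩ cocharValue n p b • Y) : ℝ) ≤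
      schurKernel (localK n p : Set (PGL n ℚ_[p]))
        ((2 * D' + 1) ^ n * (2 * n) * (1 / (p : ℕ))) X Y *
      (√(cosetCount (localK n p) X : ℝ) * √(cosetCount (localK n p) Y : ℝ)) := by
  classical
  rw [schurKernel]
  split_ifs with h0 hXY
  · obtain ⟨rfl, rfl⟩ := h0
    refine (sum_cosetCount_inter_localK_le (by omega) D').trans ?_
    simp [cosetCount_self]
  all_goals
    obtain ⟨a, -, rfl⟩ := mem_cells.mp hX
    obtain ⟨c, -, rfl⟩ := mem_cells.mp hY
    have h := sum_cosetCount_inter_le (p := p) hn D' a c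
    rw [Real.sqrt_mul (Nat.cast_nonneg _)] at h
    first
      | rw [if_pos hXY] at h
      | rw [if_neg hXY] at h
    refine h.trans (le_of_eq ?_)
    ring

/-- For fixed `d`, `d'` the sum over families of exponents of a product over primes is the product
of the local torus sums. The local square roots of coset numbers are absorbed into the coefficients.
-/
theorem norm_integral_le (hn : 3 ≤ n) {D : ℕ} {M : ℝ} {P : Finset Primes}
    (hP : ∀ p : Primes, ((p : ℕ) : ℝ) ≤ M → p ∈ P) {ω : AdelicG n → ℂ}
    (hω : ω ∈ heckeSupported n D M) :
    ‖∫ h : adelicH n, conv ω (adj ω) h ∂(muH n)‖ ≤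
      ∑ d ∈ Fintype.piFinset fun p : P => cells n D p.1,
        ∑ d' ∈ Fintype.piFinset fun p : P => cells n D p.1,
          (‖boxValue P ω d‖ * ∏ p : P, √(cosetCount (localK n p.1) (d p) : ℝ)) *
          (‖boxValue P ω d'‖ * ∏ p : P, √(cosetCount (localK n p.1) (d' p) : ℝ)) *
          ∏ p : P, schurKernel (localK n p.1 : Set (PGL n ℚ_[p.1]))
            ((2 * ((4 * D : ℕ) : ℝ) + 1) ^ n * (2 * n) * (1 / (p.1 : ℕ))) (d p) (d' p) := by
  have hn0 : 0 < n := by omega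
  rw [(integral_adelicH_eq_sum hn0 hP hω).2]
  have hval : ∀ b : P → Fin n → ℤ, conv ω (adj ω) (torusElement P b) =
      ∑ d ∈ Fintype.piFinset fun p : P => cells n D p.1,
        ∑ d' ∈ Fintype.piFinset fun p : P => cells n D p.1,
          boxValue P ω d * starRingEnd ℂ (boxValue P ω d') *
            ∏ p : P, (cosetCount (localK n p.1) (d p ∩ cocharValue n p.1 (b p) • d' p) : ℂ) :=
    fun b => by
      rw [(conv_adj_eq_sum hn0 hP hω (torusElement P b)).1 fun p hp => by
        rw [torusElement_apply_of_notMem P b hp]; exact one_mem _]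
      simp only [torusElement_apply]
  rw [Finset.sum_congr rfl fun b _ => hval b, Finset.sum_comm]
  refine (norm_sum_le _ _).trans (Finset.sum_le_sum fun d hd => ?_)
  rw [Finset.sum_comm]
  refine (norm_sum_le _ _).trans (Finset.sum_le_sum fun d' hd' => ?_)
  rw [← Finset.mul_sum, norm_mul, norm_mul, RCLike.norm_conj]
  rw [← Finset.prod_univ_sum (fun _ : P => exponentBox n (4 * D)) fun p b =>
    (cosetCount (localK n p.1) (d p ∩ cocharValue n p.1 b • d' p) : ℂ), norm_prod]
  have hprod : ∏ p : P, ‖∑ b ∈ exponentBox n (4 * D),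
      (cosetCount (localK n p.1) (d p ∩ cocharValue n p.1 b • d' p) : ℂ)‖ ≤
      ∏ p : P, (schurKernel (localK n p.1 : Set (PGL n ℚ_[p.1]))
            ((2 * ((4 * D : ℕ) : ℝ) + 1) ^ n * (2 * n) * (1 / (p.1 : ℕ))) (d p) (d' p) *
        (√(cosetCount (localK n p.1) (d p) : ℝ) * √(cosetCount (localK n p.1) (d' p) : ℝ))) := by
    refine Finset.prod_le_prod (fun _ _ => norm_nonneg _) fun p _ => ?_
    refine le_trans (le_of_eq ?_) (sum_cosetCount_le_schurKernel hn
      (Fintype.mem_piFinset.mp hd p) (Fintype.mem_piFinset.mp hd' p) (4 * D))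
    rw [← Nat.cast_sum, ← Nat.cast_sum, Complex.norm_natCast]
  refine (mul_le_mul_of_nonneg_left hprod (by positivity)).trans (le_of_eq ?_)
  rw [Finset.prod_mul_distrib, Finset.prod_mul_distrib]
  ring

theorem finite_primes_le (M : ℝ) : {p : Primes | ((p : ℕ) : ℝ) ≤ M}.Finite := by
  refine Set.Finite.preimage (f := fun p : Primes => (p : ℕ)) (s := {m : ℕ | (m : ℝ) ≤ M})
    Subtype.val_injective.injOn ((Set.finite_Iic ⌊M⌋₊).subset fun m hm => ?_)
  exact Nat.le_floor hm

end Expansion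

end ToricHecke

end

/-! ### The theorem -/

theorem proposition7p12 (n : ℕ) (hn : 3 ≤ n) (κ : ℝ) (hκ : 0 < κ) :
    ∃ C A : ℝ, ∀ M : ℝ, 3 ≤ M →
      ∀ ω ∈ ToricHecke.truncHecke n κ M, ω ≠ 0 →
        let k : ToricHecke.AdelicG n → ℂ := ToricHecke.conv ω (ToricHecke.adj ω)
        k 1 ≠ 0 ∧
        Integrable (fun h : ToricHecke.adelicH n => k h) (ToricHecke.muH n) ∧
        ‖(∫ h : ToricHecke.adelicH n, k h ∂(ToricHecke.muH n)) / k 1‖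
          ≤ A * (Real.log (Real.log M)) ^ C := by
  classical
  have hn0 : 0 < n := by omega
  set D := ⌈2 * κ⌉₊
  have hD : 2 * κ ≤ D := Nat.le_ceil _
  set ε : ℝ := (2 * ((4 * D : ℕ) : ℝ) + 1) ^ n * (2 * n)
  set B : ℝ := (((2 * D + 1) ^ n : ℕ) : ℝ)
  have hε : 0 ≤ ε := by positivity
  -- Here `ε / p` is the local error and `B` bounds the number of local cells, hence the number of
  -- error terms in a row.
  obtain ⟨C, A, hCA⟩ := ToricHecke.prod_primeWeight_le (K := B * ε) (by positivity)
  refine ⟨C, A, fun M hM ω hω hne => ?_⟩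
  have hω' := ToricHecke.truncHecke_le hn0 hD M hω
  set P : Finset ToricHecke.Primes := (ToricHecke.finite_primes_le M).toFinset
  have hP : ∀ p : ToricHecke.Primes, ((p : ℕ) : ℝ) ≤ M → p ∈ P := fun p hp =>
    (ToricHecke.finite_primes_le M).mem_toFinset.mpr hp
  intro k
  have hone := ToricHecke.conv_adj_one hn0 hP hω'
  set Λ := Fintype.piFinset fun p : P => ToricHecke.cells n D p.1
  -- Coefficients normalized by the square root of the volume. Extension by zero outside `Λ`
  -- confines the row condition of the Schur test to families of cells.
  let f : (∀ p : P, Set (ToricHecke.PGL n ℚ_[p.1])) → ℝ := fun d =>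
    if d ∈ Λ then ‖ToricHecke.boxValue P ω d‖ *
      ∏ p : P, √(ToricHecke.cosetCount (ToricHecke.localK n p.1) (d p) : ℝ) else 0
  have hf : ∀ d ∈ Λ, f d = ‖ToricHecke.boxValue P ω d‖ *
      ∏ p : P, √(ToricHecke.cosetCount (ToricHecke.localK n p.1) (d p) : ℝ) := fun d hd =>
    if_pos hd
  have hk1 : k 1 = ((∑ d ∈ Λ, f d ^ 2 : ℝ) : ℂ) := by
    rw [Finset.sum_congr rfl fun d hd => by rw [hf d hd]]
    exact hone
  have hpos : 0 < ∑ d ∈ Λ, f d ^ 2 := by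
    obtain ⟨g, hg⟩ := Function.ne_iff.mp hne
    rw [ToricHecke.eq_sum_boxValue hn0 hP hω' g] at hg
    obtain ⟨d, hd, hd0⟩ := Finset.exists_ne_zero_of_sum_ne_zero hg
    refine Finset.sum_pos' (fun _ _ => sq_nonneg _) ⟨d, hd, ?_⟩
    rw [hf d hd]
    have h1 : 0 < ‖ToricHecke.boxValue P ω d‖ := norm_pos_iff.mpr (left_ne_zero_of_mul hd0)
    have h2 : 0 < ∏ p : P, √(ToricHecke.cosetCount (ToricHecke.localK n p.1) (d p) : ℝ) :=
      Finset.prod_pos fun p _ => Real.sqrt_pos.mpr (by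
        exact_mod_cast ToricHecke.cells_cosetCount_pos (Fintype.mem_piFinset.mp hd p))
    positivity
  refine ⟨?_, (ToricHecke.integral_adelicH_eq_sum hn0 hP hω').1, ?_⟩
  · rw [hk1]
    exact_mod_cast hpos.ne'
  · rw [norm_div, hk1, Complex.norm_real, Real.norm_of_nonneg hpos.le, div_le_iff₀ hpos]
    refine (ToricHecke.norm_integral_le hn hP hω').trans ?_
    have hprime : ∀ p : P, (p.1 : ℕ).Prime := fun p => p.1.2
    have hschur := ToricHecke.sum_schurKernel_le (fun p : P => ToricHecke.cells n D p.1)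
      (fun p : P => (ToricHecke.localK n p.1 : Set (ToricHecke.PGL n ℚ_[p.1])))
      (ε := fun p => ε * (1 / (p.1 : ℕ))) (w := fun p => ToricHecke.primeWeight M p.1)
      (B := B) (R := A * Real.log (Real.log M) ^ C) (fun p => by positivity)
      (fun p => ToricHecke.primeWeight_pos M (hprime p))
      (fun p => ToricHecke.primeWeight_le_one M (hprime p))
      (fun p => Nat.cast_le.mpr (ToricHecke.card_cells_le n D p.1)) f (by
        intro d hd
        have hdΛ : d ∈ Λ := by
          by_contra hcon
          exact hd (if_neg hcon)
        rw [hf d hdΛ] at hd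
        have h1 := hCA M hM P (fun p => (p.1 : ℕ)) (fun p q h => Subtype.ext (Subtype.ext h)) hprime
          (fun p => ¬ d p = (ToricHecke.localK n p.1 : Set (ToricHecke.PGL n ℚ_[p.1])))
          (ToricHecke.prod_le_of_boxValue_ne_zero hn0 hω' (Fintype.mem_piFinset.mp hdΛ)
            (norm_ne_zero_iff.mp (left_ne_zero_of_mul hd)))
        refine le_trans (le_of_eq (Finset.prod_congr rfl fun p _ => ?_)) h1
        rw [ite_not]
        congr 1 <;> ring)
    refine le_trans (le_of_eq ?_) hschur
    refine Finset.sum_congr rfl fun d hd => Finset.sum_congr rfl fun d' hd' => ?_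
    rw [hf d hd, hf d' hd']
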